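/- Consider a spatially homogeneous spacetime with a group-invariant orthonormal frame $\{e_0,e_1,e_2,e_3\}$, where $e_0$ is the unit normal to the group orbits, $[e_0,e_\beta]=-\sum_\alpha\bigl(H\delta_{\alpha\beta}+\sigma_{\alpha\beta}-\epsilon_{\alpha\beta\mu}\Omega_\mu\bigr)e_\alpha$ and $[e_\beta,e_\gamma]=\sum_{\alpha,\delta}\epsilon_{\beta\gamma\delta}n_{\delta\alpha}e_\alpha$; here $\sigma$ is symmetric and trace-free, $n$ is symmetric, and all coefficients depend only on time. Assume Bianchi type VII$_0$ with $e_1$ along the kernel of $n$, i.e. $n_{1\alpha}=0$ and $n_{22}n_{33}-n_{23}^2>0$, and assume $H>0$. Let the Einstein equations $R_{ab}-\tfrac12 R g_{ab}=T_{ab}$ hold, with $\Lambda=0$ and $T_{ab}$ the energy-momentum tensor of a radiation fluid ($p=\tfrac13\times$ energy density in the fluid rest frame) with 4-velocity $u=(e_0+v^\alpha e_\alpha)/\sqrt{1-v_\alpha v^\alpha}$, $v_\alpha v^\alpha<1$, that is irrotational ($u_{[a}\nabla_b u_{c]}=0$). Use the time $\tau$ with $dt/d\tau=1/H$, where $t$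 is clock time along $e_0$, and suppose that the solution exists for all $\tau>\tau_0$. Put $\Omega=T(e_0,e_0)/(3H^2)$, $\Sigma_{\alpha\beta}=\sigma_{\alpha\beta}/H$, $N_{\alpha\beta}=n_{\alpha\beta}/H$, $$\Sigma_-=\tfrac{\Sigma_{22}-\Sigma_{33}}{2\sqrt3},\quad \Sigma_\times=\tfrac{\Sigma_{23}}{\sqrt3},\quad N_+=\tfrac{N_{22}+N_{33}}2,\quad N_-=\tfrac{N_{22}-N_{33}}{2\sqrt3},\quad N_\times=\tfrac{N_{23}}{\sqrt3},\quad M=\tfrac1{N_+},$$ $$\mathcal R_1=\Sigma_-^2+\Sigma_\times^2+N_-^2+N_\times^2,\quad \mathcal R_2(\cos2\psi,\sin2\psi)=\bigl(\Sigma_-^2+\Sigma_\times^2-N_-^2-N_\times^2,\;2(\Sigma_-N_-+\Sigma_\times N_\times)\bigr),$$ $$\Sigma=\sqrt{\tfrac16\Sigma_{\alpha\beta}\Sigma^{\alpha\beta}},\qquad \mathcal W_1=\frac{C_{abcd}C^{abcd}}{48H^4},\qquad \mathcal W_2=\frac{C_{abcd}{}^*C^{abcd}}{48H^4},$$ where $C_{abcd}$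 is the Weyl tensor and ${}^*C_{abcd}=\tfrac12\eta_{ab}{}^{ef}C_{efcd}$ with $\eta^{0123}=1$. Suppose that $\Omega>0$, $\mathcal R_1>0$, $\mathcal R_2>0$ and $v_1>0$ for all $\tau>\tau_0$. Then, as $\tau\to+\infty$, $$\Omega\to1,\qquad v_\alpha\to0,\qquad \Sigma\to0,\qquad M\to0,\qquad \frac{\mathcal R_2}{M^2}\to+\infty .$$ If, moreover, $\mathcal R_2/\mathcal R_1$ does not tend to $0$ (which is the general case), then $$(\mathcal W_1,\mathcal W_2)=-\frac{4\mathcal R_2}{M^2}\bigl[(\cos2\psi,\sin2\psi)+\mathcal O(M)\bigr]\qquad(\tau\to+\infty),$$ and hence $\sqrt{\mathcal W_1^2+\mathcal W_2^2}\to+\infty$. Thus the models isotropize with respect to the shear but, in the general case, not with respect to the Weyl curvature. -/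

import Mathlib

open Filter Topology Asymptotics

noncomputable section

/-- The data of a spatially homogeneous cosmology of Bianchi class A with a tilted fluid, relative
to a group-invariant orthonormal frame `e₀, e₁, e₂, e₃` whose `e₀` is the unit normal to the group
orbits. Every quantity is a function of the dimensionless time `τ`, related to clock time `t`
along `e₀` by `dt/dτ = 1/H`. The spatial indices `1, 2, 3` are `0, 1, 2 : Fin 3`. -/
structure BianchiModel where
  /-- Hubble scalar -/
  H : ℝ → ℝ
  /-- rate of shear tensor -/
  σ : ℝ → Matrix (Fin 3) (Fin 3) ℝ
  /-- spatial curvature variables -/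
  n : ℝ → Matrix (Fin 3) (Fin 3) ℝ
  /-- angular velocity of the spatial frame -/
  ω : ℝ → Fin 3 → ℝ
  /-- energy density of the fluid in its rest frame -/
  μ : ℝ → ℝ
  /-- tilt vector of the fluid -/
  v : ℝ → Fin 3 → ℝ

namespace BianchiModel

/-- The alternating symbol on three indices, with `eps3 0 1 2 = 1`. -/
def eps3 (i j k : Fin 3) : ℝ :=
  (((j : ℕ) : ℝ) - (i : ℕ)) * (((k : ℕ) : ℝ) - (i : ℕ)) * (((k : ℕ) : ℝ) - (j : ℕ)) / 2

/-- The alternating symbol on four indices, with `eps4 0 1 2 3 = 1`. -/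
def eps4 (a b c d : Fin 4) : ℝ :=
  (((b : ℕ) : ℝ) - (a : ℕ)) * (((c : ℕ) : ℝ) - (a : ℕ)) * (((d : ℕ) : ℝ) - (a : ℕ)) *
    (((c : ℕ) : ℝ) - (b : ℕ)) * (((d : ℕ) : ℝ) - (b : ℕ)) * (((d : ℕ) : ℝ) - (c : ℕ)) / 12

/-- Diagonal entries of the metric in an orthonormal frame. -/
def sgn (a : Fin 4) : ℝ := Fin.cases (-1) (fun _ => 1) a

/-- Metric components in an orthonormal frame. -/
def g (a b : Fin 4) : ℝ := if a = b then sgn a else 0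

variable (B : BianchiModel)

/-- The coefficient of `e_α` in `[e₀, e_β]`. -/
def timeComm (τ : ℝ) (α β : Fin 3) : ℝ :=
  -((if α = β then B.H τ else 0) + B.σ τ α β - ∑ μ, eps3 α β μ * B.ω τ μ)

/-- The coefficient of `e_α` in `[e_β, e_γ]` (class A). -/
def spaceComm (τ : ℝ) (α β γ : Fin 3) : ℝ := ∑ δ, eps3 β γ δ * B.n τ δ α

/-- Commutation functions: `[e_a, e_b] = ∑ c, comm τ c a b • e_c`. -/
def comm (τ : ℝ) (c a b : Fin 4) : ℝ :=
  Fin.cases 0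
    (fun α => Fin.cases
      (Fin.cases 0 (fun β => B.timeComm τ α β) b)
      (fun β => Fin.cases (-B.timeComm τ α β) (fun γ => B.spaceComm τ α β γ) b) a) c

/-- The derivative of a function of time along `e_a`: `e₀ = d/dt = H d/dτ`, and the spatial frame
vectors are tangent to the group orbits. -/
def frameDeriv (a : Fin 4) (f : ℝ → ℝ) (τ : ℝ) : ℝ :=
  if a = 0 then B.H τ * deriv f τ else 0

/-- The Jacobi identities `[e_a, [e_b, e_c]] + cyclic = 0`. -/
def Jacobi (τ : ℝ) : Prop :=
  ∀ a b c d : Fin 4,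
    (B.frameDeriv a (fun s => B.comm s d b c) τ + ∑ f, B.comm τ f b c * B.comm τ d a f) +
    (B.frameDeriv b (fun s => B.comm s d c a) τ + ∑ f, B.comm τ f c a * B.comm τ d b f) +
    (B.frameDeriv c (fun s => B.comm s d a b) τ + ∑ f, B.comm τ f a b * B.comm τ d c f) = 0

/-- Levi-Civita connection, `∇_{e_a} e_b = ∑ c, conn τ c a b • e_c`, by the Koszul formula. -/
def conn (τ : ℝ) (c a b : Fin 4) : ℝ :=
  sgn c * ((sgn c * B.comm τ c a b - sgn a * B.comm τ a b c + sgn b * B.comm τ b c a) / 2)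

/-- Riemann tensor `R^a_{bcd}`: the coefficient of `e_a` in
`∇_{e_c} ∇_{e_d} e_b - ∇_{e_d} ∇_{e_c} e_b - ∇_{[e_c, e_d]} e_b`. -/
def riem (τ : ℝ) (a b c d : Fin 4) : ℝ :=
  B.frameDeriv c (fun s => B.conn s a d b) τ - B.frameDeriv d (fun s => B.conn s a c b) τ +
    ∑ f, (B.conn τ f d b * B.conn τ a c f - B.conn τ f c b * B.conn τ a d f -
      B.comm τ f c d * B.conn τ a f b)

/-- Ricci tensor. -/
def ricci (τ : ℝ) (b d : Fin 4) : ℝ := ∑ a, B.riem τ a b a d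

/-- Scalar curvature. -/
def scalar (τ : ℝ) : ℝ := ∑ a, sgn a * B.ricci τ a a

/-- Weyl tensor `C_{abcd}`. -/
def weyl (τ : ℝ) (a b c d : Fin 4) : ℝ :=
  sgn a * B.riem τ a b c d -
    (g a c * B.ricci τ b d - g a d * B.ricci τ b c +
      g b d * B.ricci τ a c - g b c * B.ricci τ a d) / 2 +
    B.scalar τ / 6 * (g a c * g b d - g a d * g b c)

/-- Dual Weyl tensor `*C_{abcd} = ½ η_{ab}^{ef} C_{efcd}`, where `η_{abcd}` is the volume form
normalized by `η^{0123} = 1`, that is `η_{0123} = -1`. -/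
def weylDual (τ : ℝ) (a b c d : Fin 4) : ℝ :=
  (∑ e, ∑ f, -eps4 a b e f * sgn e * sgn f * B.weyl τ e f c d) / 2

/-- The covariant components `u_a` of the fluid velocity `u = (n + v) / √(1 - v_α v^α)`. -/
def u (τ : ℝ) (a : Fin 4) : ℝ :=
  Fin.cases (-1) (fun α => B.v τ α) a / √(1 - ∑ α, B.v τ α ^ 2)

/-- Covariant derivative `∇_a u_b`. -/
def covU (τ : ℝ) (a b : Fin 4) : ℝ :=
  B.frameDeriv a (fun s => B.u s b) τ - ∑ c, B.conn τ c a b * B.u τ c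

/-- Vanishing vorticity of the fluid: `u_{[a} ∇_b u_{c]} = 0`. -/
def Irrotational (τ : ℝ) : Prop :=
  ∀ a b c : Fin 4,
    B.u τ a * (B.covU τ b c - B.covU τ c b) + B.u τ b * (B.covU τ c a - B.covU τ a c) +
      B.u τ c * (B.covU τ a b - B.covU τ b a) = 0

/-- Energy-momentum tensor of a perfect fluid with the radiation equation of state
`p = μ / 3`. -/
def stress (τ : ℝ) (a b : Fin 4) : ℝ :=
  B.μ τ * B.u τ a * B.u τ b + B.μ τ / 3 * (g a b + B.u τ a * B.u τ b)

/-- Einstein field equations with zero cosmological constant, in units with `8πG = c = 1`. -/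
def Einstein (τ : ℝ) : Prop :=
  ∀ a b : Fin 4, B.ricci τ a b - B.scalar τ / 2 * g a b = B.stress τ a b

/-- The model is an irrotational radiation-filled cosmology of Bianchi type VII₀ for `τ > τ₀`,
expanding (`H > 0`), with the frame vector `e₁` in the kernel of `n`; type VII₀ means that the
other two eigenvalues of `n` are non-zero and of the same sign. -/
structure IsRadiationVII0 (τ₀ : ℝ) : Prop where
  H_pos : ∀ τ > τ₀, 0 < B.H τ
  H_diff : ∀ τ > τ₀, DifferentiableAt ℝ B.H τ
  σ_diff : ∀ τ > τ₀, ∀ i j, DifferentiableAt ℝ (fun s => B.σ s i j) τ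
  n_diff : ∀ τ > τ₀, ∀ i j, DifferentiableAt ℝ (fun s => B.n s i j) τ
  μ_diff : ∀ τ > τ₀, DifferentiableAt ℝ B.μ τ
  v_diff : ∀ τ > τ₀, ∀ i, DifferentiableAt ℝ (fun s => B.v s i) τ
  σ_symm : ∀ τ > τ₀, (B.σ τ).IsSymm
  σ_trace : ∀ τ > τ₀, (B.σ τ).trace = 0
  n_symm : ∀ τ > τ₀, (B.n τ).IsSymm
  n_ker : ∀ τ > τ₀, ∀ j, B.n τ 0 j = 0
  typeVII : ∀ τ > τ₀, 0 < B.n τ 1 1 * B.n τ 2 2 - B.n τ 1 2 ^ 2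
  v_lt_one : ∀ τ > τ₀, ∑ α, B.v τ α ^ 2 < 1
  jacobi : ∀ τ > τ₀, B.Jacobi τ
  einstein : ∀ τ > τ₀, B.Einstein τ
  irrotational : ∀ τ > τ₀, B.Irrotational τ

/-- Density parameter `Ω = ρ / (3 H²)`, where `ρ = T(e₀, e₀)`. -/
def Ω (τ : ℝ) : ℝ := B.stress τ 0 0 / (3 * B.H τ ^ 2)

/-- Hubble-normalized shear `Σ_{αβ} = σ_{αβ} / H`. -/
def Sh (τ : ℝ) (i j : Fin 3) : ℝ := B.σ τ i j / B.H τ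

/-- Hubble-normalized spatial curvature `N_{αβ} = n_{αβ} / H`. -/
def N (τ : ℝ) (i j : Fin 3) : ℝ := B.n τ i j / B.H τ

/-- `Σ₋`, where `Σ₂₂ = Σ₊ + √3 Σ₋` and `Σ₃₃ = Σ₊ - √3 Σ₋`. -/
def Sm (τ : ℝ) : ℝ := (B.Sh τ 1 1 - B.Sh τ 2 2) / (2 * √3)

/-- `Σ_×`, where `Σ₂₃ = √3 Σ_×`. -/
def Sx (τ : ℝ) : ℝ := B.Sh τ 1 2 / √3

/-- `N₊`, where `N₂₂ = N₊ + √3 N₋` and `N₃₃ = N₊ - √3 N₋`. -/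
def Np (τ : ℝ) : ℝ := (B.N τ 1 1 + B.N τ 2 2) / 2

/-- `N₋`. -/
def Nm (τ : ℝ) : ℝ := (B.N τ 1 1 - B.N τ 2 2) / (2 * √3)

/-- `N_×`, where `N₂₃ = √3 N_×`. -/
def Nx (τ : ℝ) : ℝ := B.N τ 1 2 / √3

/-- `M = 1 / N₊`. -/
def M (τ : ℝ) : ℝ := 1 / B.Np τ

/-- `𝓡₁ = Σ₋² + Σ_×² + N₋² + N_×²`. -/
def R1 (τ : ℝ) : ℝ := B.Sm τ ^ 2 + B.Sx τ ^ 2 + B.Nm τ ^ 2 + B.Nx τ ^ 2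

/-- `𝓡₂` and the angle `ψ` are polar coordinates `(𝓡₂, 2ψ)` of the rotation-invariant pair
`(Σ₋² + Σ_×² - N₋² - N_×², 2 (Σ₋ N₋ + Σ_× N_×))`. -/
def IsPolar (R2 ψ : ℝ → ℝ) (τ : ℝ) : Prop :=
  R2 τ * Real.cos (2 * ψ τ) = B.Sm τ ^ 2 + B.Sx τ ^ 2 - B.Nm τ ^ 2 - B.Nx τ ^ 2 ∧
  R2 τ * Real.sin (2 * ψ τ) = 2 * (B.Sm τ * B.Nm τ + B.Sx τ * B.Nx τ)

/-- Shear parameter, `Σ² = σ_{αβ} σ^{αβ} / (6 H²)`. -/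
def shear (τ : ℝ) : ℝ := √((∑ i, ∑ j, B.σ τ i j ^ 2) / (6 * B.H τ ^ 2))

/-- Weyl parameter `𝓦₁ = C_{abcd} C^{abcd} / (48 H⁴)`. -/
def W1 (τ : ℝ) : ℝ :=
  (∑ a, ∑ b, ∑ c, ∑ d, sgn a * sgn b * sgn c * sgn d * B.weyl τ a b c d * B.weyl τ a b c d) /
    (48 * B.H τ ^ 4)

/-- Weyl parameter `𝓦₂ = C_{abcd} *C^{abcd} / (48 H⁴)`. -/
def W2 (τ : ℝ) : ℝ :=
  (∑ a, ∑ b, ∑ c, ∑ d, sgn a * sgn b * sgn c * sgn d * B.weyl τ a b c d * B.weylDual τ a b c d) /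
    (48 * B.H τ ^ 4)

end BianchiModel

end

/-! Vanishing vorticity forces the quadratic form of `n` to vanish on the transverse tilt. That form
is definite, so only `v₁` survives. The Codazzi equations and the Jacobi identities then remove
`σ₁₂`, `σ₁₃` and two of the angular velocities. Modulo rotations about `e₁` the model becomes the
autonomous system `InvariantFlow`, in which `R² = A² + C² + 4X²` and `X` is tied to `v` by the
remaining Codazzi equation.

The variable `N = N₊` rotates the pair `(A, C)` rapidly, and the proof averages over this rotation:
`(C/N)' = 4A + O(C/N)`, so `A` is almost a total derivative. A combination of the monotone function
`logMono`, of `logPart` and of `C/N` grows linearly, which makes `1/N` decay exponentially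
(`inv_N_le_exp`). Every `O(1/N)` error is integrable from then on. Since `logPart` is bounded above
and its derivative is `2x²` up to oscillation and integrable error, it converges and `x → 0`
(`logPart_converges_and_x_tendsto`). Convergence makes `X` comparable to `v`; as `R ≥ 2X`, the tilt
obeys, after averaging, an inequality of the type `v' ≤ -c v²`, so `v → 0` (`tendsto_v`).

The ratios `r = R/X`, `a = A/X`, `c = C/X` move on the hyperboloid `r² = a² + c² + 4`. Averaging
shows that `r` converges (`r_converges`), so `R = rX → 0`, which gives `Ω → 1` and `Σ → 0`.

The Weyl parameters are `-4N²(A, C)` plus a remainder of size `NR + 1` (`W1_expansion`,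
`W2_expansion`, `weyl_remainder_le`), so a lower bound on `𝓡₂ = √(A² + C²)` is needed
(`amplitude_dichotomy`). With `c` corrected for its drift, `a² + cTilde²` has a limit `h`. If `h >
0`, then `𝓡₂` is at least a multiple of `X`, hence of `R`. If `h = 0`, then `𝓡₂/𝓡₁ → 0`, but the
drift of `c` still outweighs the residual oscillation and `𝓡₂ ≥ X/(2N)`. Since `XN → ∞`, `𝓡₂N² → ∞`
either way; the first case gives the Weyl asymptotics. -/

/-! ### Limits of functions from differential inequalities. -/

lemma monotoneOn_Ici_of_hasDerivAt {f f' : ℝ → ℝ} {T : ℝ}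
    (hf : ∀ t ≥ T, HasDerivAt f (f' t) t) (h0 : ∀ t ≥ T, 0 ≤ f' t) :
    MonotoneOn f (Set.Ici T) := by
  refine monotoneOn_of_hasDerivWithinAt_nonneg (convex_Ici T)
    (fun t ht => (hf t ht).continuousAt.continuousWithinAt)
    (fun t ht => (hf t (interior_subset ht)).hasDerivWithinAt)
    (fun t ht => h0 t (interior_subset ht))

lemma exists_tendsto_of_deriv_nonneg {f f' : ℝ → ℝ} {T b : ℝ}
    (hf : ∀ t ≥ T, HasDerivAt f (f' t) t) (h0 : ∀ t ≥ T, 0 ≤ f' t) (hb : ∀ t ≥ T, f t ≤ b) :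
    ∃ l, Tendsto f atTop (𝓝 l) := by
  have hm := monotoneOn_Ici_of_hasDerivAt hf h0
  have hg : Monotone fun t => f (max T t) := fun s t hst =>
    hm (le_max_left T s) (le_max_left T t) (max_le_max le_rfl hst)
  have hbd : BddAbove (Set.range fun t => f (max T t)) :=
    ⟨b, by rintro _ ⟨t, rfl⟩; exact hb _ (le_max_left _ _)⟩
  refine ⟨_, (tendsto_atTop_ciSup hg hbd).congr' ?_⟩
  filter_upwards [eventually_ge_atTop T] with t ht
  simp [max_eq_right ht]

lemma tendsto_atTop_of_deriv_ge {f f' : ℝ → ℝ} {T c : ℝ} (hc : 0 < c)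
    (hf : ∀ t ≥ T, HasDerivAt f (f' t) t) (h0 : ∀ t ≥ T, c ≤ f' t) :
    Tendsto f atTop atTop := by
  have hm : MonotoneOn (fun t => f t - c * t) (Set.Ici T) :=
    monotoneOn_Ici_of_hasDerivAt (f' := fun t => f' t - c * 1)
      (fun t ht => (hf t ht).sub ((hasDerivAt_id t).const_mul c))
      (fun t ht => by linarith [h0 t ht])
  refine tendsto_atTop_mono' atTop (f₁ := fun t => c * t + (f T - c * T)) ?_
    (tendsto_atTop_add_const_right _ _ (tendsto_id.const_mul_atTop hc))
  filter_upwards [eventually_ge_atTop T] with t ht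
  have := hm (Set.mem_Ici.2 le_rfl) (Set.mem_Ici.2 ht) ht
  simp only at this
  linarith

lemma hasDerivAt_exp_neg_mul (κ t : ℝ) :
    HasDerivAt (fun s => Real.exp (-κ * s)) (-κ * Real.exp (-κ * t)) t := by
  have := ((hasDerivAt_id t).const_mul (-κ)).exp
  simp only [id, mul_one] at this
  rwa [mul_comm] at this

lemma tendsto_exp_neg_mul {κ : ℝ} (hκ : 0 < κ) :
    Tendsto (fun s => Real.exp (-κ * s)) atTop (𝓝 0) :=
  Real.tendsto_exp_atBot.comp (tendsto_id.const_mul_atTop_of_neg (by linarith))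

/-- A function whose derivative decays exponentially has a limit. -/
lemma exists_tendsto_of_abs_deriv_le_exp {f f' : ℝ → ℝ} {T b κ : ℝ} (hκ : 0 < κ)
    (hf : ∀ t ≥ T, HasDerivAt f (f' t) t) (hb : ∀ t ≥ T, |f' t| ≤ b * Real.exp (-κ * t)) :
    ∃ l, Tendsto f atTop (𝓝 l) := by
  -- The correction is a primitive of `-b e^(-κt)`: with `s = 1` the sum decreases, which supplies
  -- the upper bound, and with `s = -1` it increases.
  have hd : ∀ t ≥ T, ∀ s : ℝ, HasDerivAt (fun t => f t + s * (b / κ * Real.exp (-κ * t)))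
      (f' t + s * (b / κ * (-κ * Real.exp (-κ * t)))) t := fun t ht s =>
    (hf t ht).add (((hasDerivAt_exp_neg_mul κ t).const_mul _).const_mul _)
  have key : ∀ t, b / κ * (-κ * Real.exp (-κ * t)) = -(b * Real.exp (-κ * t)) := by
    intro t; field_simp
  have hup := monotoneOn_Ici_of_hasDerivAt (T := T) (fun t ht => (hd t ht 1).neg) (fun t ht => by
    have := hb t ht
    rw [key]; linarith [le_abs_self (f' t)])
  have hbnn : 0 ≤ b := by
    have h1 := (abs_nonneg _).trans (hb T le_rfl)
    exact nonneg_of_mul_nonneg_left h1 (Real.exp_pos _)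
  obtain ⟨l, hl⟩ := exists_tendsto_of_deriv_nonneg (T := T)
    (b := f T + 1 * (b / κ * Real.exp (-κ * T))) (fun t ht => hd t ht (-1)) (fun t ht => by
      have := hb t ht
      rw [key]; linarith [neg_abs_le (f' t)]) (fun t ht => by
      have h1 := hup (Set.mem_Ici.2 le_rfl) (Set.mem_Ici.2 ht) ht
      have h2 : 0 ≤ b / κ * Real.exp (-κ * t) := by positivity
      simp only [Pi.neg_apply] at h1
      linarith)
  refine ⟨l, ?_⟩
  have h0 : Tendsto (fun t => b / κ * Real.exp (-κ * t)) atTop (𝓝 0) := by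
    simpa using (tendsto_exp_neg_mul hκ).const_mul (b / κ)
  simpa using hl.add h0

/-- If `x²` is dominated by the derivative of a convergent function and `x` is Lipschitz, then
`x` tends to zero. -/
lemma tendsto_zero_of_sq_le_deriv {L L' x x' : ℝ → ℝ} {T K l : ℝ}
    (hL : ∀ t ≥ T, HasDerivAt L (L' t) t) (hx : ∀ t ≥ T, HasDerivAt x (x' t) t)
    (hle : ∀ t ≥ T, x t ^ 2 ≤ L' t) (hK : ∀ t ≥ T, |x' t| ≤ K) (hlim : Tendsto L atTop (𝓝 l)) :
    Tendsto x atTop (𝓝 0) := by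
  have hKnn : 0 ≤ K := (abs_nonneg _).trans (hK T le_rfl)
  have hmL : MonotoneOn L (Set.Ici T) :=
    monotoneOn_Ici_of_hasDerivAt hL (fun t ht => (sq_nonneg _).trans (hle t ht))
  have hLl : ∀ t ≥ T, L t ≤ l := fun t ht =>
    ge_of_tendsto hlim ((eventually_ge_atTop t).mono fun s hs =>
      hmL (Set.mem_Ici.2 ht) (Set.mem_Ici.2 (ht.trans hs)) hs)
  -- The derivative of `x³` is at most `3K L'` in absolute value, so `3K L ± x³` are both monotone
  -- and `x³` inherits a limit from `L`.
  have hcube : ∀ t ≥ T, HasDerivAt (fun t => x t ^ 3) (3 * x t ^ 2 * x' t) t := fun t ht => by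
    simpa using (hx t ht).fun_pow 3
  have habs : ∀ t ≥ T, |3 * x t ^ 2 * x' t| ≤ 3 * K * L' t := fun t ht => by
    rw [abs_mul, abs_of_nonneg (by positivity)]
    calc 3 * x t ^ 2 * |x' t| ≤ 3 * x t ^ 2 * K := by gcongr; exact hK t ht
      _ = 3 * K * x t ^ 2 := by ring
      _ ≤ _ := by gcongr; exact hle t ht
  have hup := monotoneOn_Ici_of_hasDerivAt (T := T)
    (fun t ht => ((hL t ht).const_mul (3 * K)).sub (hcube t ht))
    (fun t ht => by linarith [le_abs_self (3 * x t ^ 2 * x' t), habs t ht])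
  obtain ⟨m, hm⟩ := exists_tendsto_of_deriv_nonneg (T := T)
    (b := 3 * K * l + 3 * K * l - (3 * K * L T - x T ^ 3))
    (fun t ht => ((hL t ht).const_mul (3 * K)).add (hcube t ht))
    (fun t ht => by linarith [neg_abs_le (3 * x t ^ 2 * x' t), habs t ht])
    (fun t ht => by
      have h1 := hup (Set.mem_Ici.2 le_rfl) (Set.mem_Ici.2 ht) ht
      have h2 := mul_le_mul_of_nonneg_left (hLl t ht) (by linarith : 0 ≤ 3 * K)
      simp only [Pi.sub_apply, Pi.add_apply] at h1 ⊢
      linarith)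
  have hc : Tendsto (fun t => x t ^ 3) atTop (𝓝 (m - 3 * K * l)) := by
    refine (hm.sub (hlim.const_mul (3 * K))).congr fun t => ?_
    simp
  set p := m - 3 * K * l
  have hp : p = 0 := by
    by_contra hp
    have hx2 : Tendsto (fun t => (x t ^ 2) ^ 3) atTop (𝓝 (p ^ 2)) := by
      refine (hc.pow 2).congr fun t => ?_
      ring
    have hpos : 0 < p ^ 2 := by positivity
    obtain ⟨e, he, hep⟩ : ∃ e : ℝ, 0 < e ∧ e ^ 3 < p ^ 2 := by
      -- For `e ≤ 1` one has `e³ ≤ e`, and `e ≤ p²/2 < p²`. Eventually `x² > e`, so `L` would grow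
      -- without bound.
      refine ⟨min 1 (p ^ 2 / 2), by positivity, ?_⟩
      have h1 : min 1 (p ^ 2 / 2) ≤ 1 := min_le_left _ _
      have h2 : min 1 (p ^ 2 / 2) ≤ p ^ 2 / 2 := min_le_right _ _
      have h3 : 0 < min 1 (p ^ 2 / 2) := by positivity
      nlinarith [mul_le_one₀ h1 h3.le h1]
    obtain ⟨T', hT'⟩ := eventually_atTop.1 ((hx2.eventually_const_lt hep).and
      (eventually_ge_atTop T))
    have htop := tendsto_atTop_of_deriv_ge he (T := T') (fun t ht => hL t (hT' t ht).2)
      (fun t ht => (lt_of_pow_lt_pow_left₀ 3 (sq_nonneg _) (hT' t ht).1).le.trans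
        (hle t (hT' t ht).2))
    exact not_tendsto_nhds_of_tendsto_atTop htop _ hlim
  rw [hp] at hc
  rw [Metric.tendsto_atTop] at hc ⊢
  intro e he
  obtain ⟨T', hT'⟩ := hc (e ^ 3) (by positivity)
  refine ⟨T', fun t ht => ?_⟩
  have := hT' t ht
  rw [Real.dist_eq, sub_zero, abs_pow] at this
  rw [Real.dist_eq, sub_zero]
  exact lt_of_pow_lt_pow_left₀ 3 he.le this

/-! ### The rotation-invariant dynamical system and a priori bounds. -/

/-- The evolution of the quantities invariant under rotations of the frame about `e₁`:
`x = Σ₊`, `R = 𝓡₁`, `A = Σ₋² + Σ_×² - N₋² - N_×²`, `C = 2 (Σ₋ N₋ + Σ_× N_×)`,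
`X = Σ_× N₋ - Σ₋ N_×`, `N = N₊` and the tilt `v = v₁`, for an irrotational radiation fluid in
Bianchi type VII₀. The density parameter is `1 - x² - R`. -/
structure InvariantFlow (τ₀ : ℝ) where
  (x R A C X N v : ℝ → ℝ)
  hx : ∀ t > τ₀, HasDerivAt x ((x t ^ 2 + A t - 1) * x t - (R t - A t) -
    4 * v t ^ 2 * (1 - x t ^ 2 - R t) / (3 + v t ^ 2)) t
  hR : ∀ t > τ₀, HasDerivAt R (2 * (x t ^ 2 + A t + x t) * R t - 2 * (1 + x t) * A t) t
  hA : ∀ t > τ₀, HasDerivAt A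
    (2 * (x t ^ 2 + A t + x t) * A t - 2 * (1 + x t) * R t - 4 * N t * C t) t
  hC : ∀ t > τ₀, HasDerivAt C (2 * (x t ^ 2 + A t + x t) * C t + 4 * N t * A t) t
  hX : ∀ t > τ₀, HasDerivAt X (2 * (x t ^ 2 + A t + x t) * X t) t
  hN : ∀ t > τ₀, HasDerivAt N (((1 + x t) ^ 2 + A t) * N t + 3 * C t) t
  hv : ∀ t > τ₀, HasDerivAt v (6 * x t * v t * (1 - v t ^ 2) / (3 - v t ^ 2)) t
  v_pos : ∀ t > τ₀, 0 < v t
  v_lt : ∀ t > τ₀, v t < 1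
  Om_pos : ∀ t > τ₀, 0 < 1 - x t ^ 2 - R t
  X_eq : ∀ t > τ₀, X t = 2 * v t * (1 - x t ^ 2 - R t) / (3 + v t ^ 2)
  R_nonneg : ∀ t > τ₀, 0 ≤ R t
  R_sq : ∀ t > τ₀, R t ^ 2 = A t ^ 2 + C t ^ 2 + 4 * X t ^ 2
  N_pos : ∀ t > τ₀, 0 < N t
  det_pos : ∀ t > τ₀, 0 < N t ^ 2 - 3 / 2 * (R t - A t)

namespace InvariantFlow

variable {τ₀ : ℝ} (F : InvariantFlow τ₀) {t : ℝ}

lemma R_lt_one (ht : t > τ₀) : F.R t < 1 := by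
  linarith [F.Om_pos t ht, sq_nonneg (F.x t)]

lemma x_sq_lt_one (ht : t > τ₀) : F.x t ^ 2 < 1 := by
  linarith [F.Om_pos t ht, F.R_nonneg t ht]

lemma x_lt_one (ht : t > τ₀) : F.x t < 1 := by
  nlinarith [F.x_sq_lt_one ht]

lemma neg_one_lt_x (ht : t > τ₀) : -1 < F.x t := by
  nlinarith [F.x_sq_lt_one ht]

lemma abs_A_le (ht : t > τ₀) : |F.A t| ≤ F.R t :=
  abs_le_of_sq_le_sq (by nlinarith [F.R_sq t ht, sq_nonneg (F.C t), sq_nonneg (F.X t)])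
    (F.R_nonneg t ht)

lemma abs_C_le (ht : t > τ₀) : |F.C t| ≤ F.R t :=
  abs_le_of_sq_le_sq (by nlinarith [F.R_sq t ht, sq_nonneg (F.A t), sq_nonneg (F.X t)])
    (F.R_nonneg t ht)

lemma v_sq_lt_one (ht : t > τ₀) : F.v t ^ 2 < 1 := by
  nlinarith [F.v_pos t ht, F.v_lt t ht]

lemma X_pos (ht : t > τ₀) : 0 < F.X t := by
  rw [F.X_eq t ht]
  have := F.v_pos t ht
  have := F.Om_pos t ht
  positivity

lemma two_mul_X_le (ht : t > τ₀) : 2 * F.X t ≤ F.R t :=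
  abs_le_of_sq_le_sq' (by nlinarith [F.R_sq t ht, sq_nonneg (F.A t), sq_nonneg (F.C t)])
    (F.R_nonneg t ht) |>.2

lemma X_le_v (ht : t > τ₀) : F.X t ≤ F.v t := by
  have hv := F.v_pos t ht
  rw [F.X_eq t ht, div_le_iff₀ (by positivity)]
  have := F.R_nonneg t ht
  nlinarith [sq_nonneg (F.x t), sq_nonneg (F.v t), mul_nonneg hv.le this,
    mul_nonneg hv.le (sq_nonneg (F.x t)), mul_nonneg hv.le (sq_nonneg (F.v t))]

lemma R_pos (ht : t > τ₀) : 0 < F.R t := by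
  linarith [F.X_pos ht, F.two_mul_X_le ht]

lemma tilt_stress_nonneg (ht : t > τ₀) :
    0 ≤ 4 * F.v t ^ 2 * (1 - F.x t ^ 2 - F.R t) / (3 + F.v t ^ 2) := by
  have := F.Om_pos t ht
  positivity

/-- The right-hand side of the evolution equation of `Σ₊`. -/
noncomputable def x' (t : ℝ) : ℝ := (F.x t ^ 2 + F.A t - 1) * F.x t - (F.R t - F.A t) -
    4 * F.v t ^ 2 * (1 - F.x t ^ 2 - F.R t) / (3 + F.v t ^ 2)

lemma hasDerivAt_x (ht : t > τ₀) : HasDerivAt F.x (F.x' t) t := F.hx t ht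

lemma abs_x'_le (ht : t > τ₀) : |F.x' t| ≤ 8 := by
  have h1 := abs_le.1 (F.abs_A_le ht)
  have h2 := F.R_lt_one ht
  have h3 := F.x_sq_lt_one ht
  have h4 := F.x_lt_one ht
  have h5 := F.neg_one_lt_x ht
  have h6 := F.tilt_stress_nonneg ht
  have h7 : 4 * F.v t ^ 2 * (1 - F.x t ^ 2 - F.R t) / (3 + F.v t ^ 2) ≤ 4 := by
    rw [div_le_iff₀ (by positivity)]
    nlinarith [F.v_sq_lt_one ht, F.Om_pos t ht, sq_nonneg (F.x t), F.R_nonneg t ht,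
      sq_nonneg (F.v t)]
  have h8 : |(F.x t ^ 2 + F.A t - 1) * F.x t| ≤ 2 * 1 := by
    rw [abs_mul]
    have : |F.x t ^ 2 + F.A t - 1| ≤ 2 := abs_le.2 ⟨by nlinarith, by nlinarith⟩
    have : |F.x t| ≤ 1 := abs_le.2 ⟨h5.le, h4.le⟩
    gcongr
  have h9 := abs_le.1 h8
  unfold x'
  rw [abs_le]
  constructor <;> linarith

/-! ### Monotone functions and the exponential growth of `N₊`. -/

/-- Logarithm of the conserved particle number density in Hubble-normalized form. -/
noncomputable def logPart (t : ℝ) : ℝ :=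
  Real.log (F.X t) - Real.log (F.v t) + 1 / 3 * Real.log (1 - F.v t ^ 2)

/-- The tilt part `log v - (1/3) log (1 - v²)` has derivative `2x`, which cancels the term linear in
`x` in the growth rate of `X`. -/
lemma hasDerivAt_logPart (ht : t > τ₀) :
    HasDerivAt F.logPart (2 * (F.x t ^ 2 + F.A t)) t := by
  have hv := F.v_pos t ht
  have hv2 : 0 < 1 - F.v t ^ 2 := by linarith [F.v_sq_lt_one ht]
  have hv3 : 0 < 3 - F.v t ^ 2 := by linarith
  have hX := F.X_pos ht
  refine ((((F.hX t ht).log hX.ne').sub ((F.hv t ht).log hv.ne')).add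
    (((((F.hv t ht).fun_pow 2).const_sub 1).log hv2.ne').const_mul (1 / 3))).congr_deriv ?_
  simp only [Nat.cast_ofNat, Nat.add_one_sub_one, pow_one]
  field_simp
  ring

lemma logPart_nonpos (ht : t > τ₀) : F.logPart t ≤ 0 := by
  have h1 := Real.log_le_log (F.X_pos ht) (F.X_le_v ht)
  have h2 : Real.log (1 - F.v t ^ 2) ≤ 0 :=
    Real.log_nonpos (by linarith [F.v_sq_lt_one ht]) (by linarith [sq_nonneg (F.v t)])
  unfold logPart
  linarith

/-- Determinant of the non-trivial block of `N_{αβ}`. -/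
noncomputable def det (t : ℝ) : ℝ := F.N t ^ 2 - 3 / 2 * (F.R t - F.A t)

lemma hasDerivAt_det (ht : t > τ₀) :
    HasDerivAt F.det (2 * ((1 + F.x t) ^ 2 + F.A t) * F.det t) t := by
  refine (((F.hN t ht).fun_pow 2).sub
    (((F.hR t ht).sub (F.hA t ht)).const_mul (3 / 2))).congr_deriv ?_
  simp only [det, Nat.cast_ofNat, Nat.add_one_sub_one, pow_one]
  ring

/-- Logarithm of a monotone function of the flow. -/
noncomputable def logMono (t : ℝ) : ℝ :=
  1 / 3 * Real.log (F.det t) + 2 / 3 * F.logPart t - 2 * Real.log (1 + F.x t / 2)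

/-- The weights `1/3`, `2/3` and the factor `1 + x/2` make the terms in `x³` and `xA` cancel. The
rest is a square plus two non-negative terms, since `|A| ≤ R`. -/
lemma hasDerivAt_logMono (ht : t > τ₀) :
    HasDerivAt F.logMono ((2 / 3 * (1 + 2 * F.x t) ^ 2 + (F.A t + F.R t) +
      4 * F.v t ^ 2 * (1 - F.x t ^ 2 - F.R t) / (3 + F.v t ^ 2)) / (1 + F.x t / 2)) t := by
  have hD : F.det t ≠ 0 := (F.det_pos t ht).ne'
  have hx : 1 + F.x t / 2 ≠ 0 := by linarith [F.neg_one_lt_x ht]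
  refine (((((F.hasDerivAt_det ht).log hD).const_mul (1 / 3)).add
    ((F.hasDerivAt_logPart ht).const_mul (2 / 3))).sub
    (((((F.hx t ht).div_const 2).const_add 1).log hx).const_mul 2)).congr_deriv ?_
  have hx2 : 2 + F.x t ≠ 0 := by linarith [F.neg_one_lt_x ht]
  have hv3 : 3 + F.v t ^ 2 ≠ 0 := by positivity
  field_simp
  ring

lemma logMono_deriv_ge (ht : t > τ₀) :
    2 / 3 * (2 / 3 * (1 + 2 * F.x t) ^ 2 + (F.A t + F.R t)) ≤
    (2 / 3 * (1 + 2 * F.x t) ^ 2 + (F.A t + F.R t) +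
      4 * F.v t ^ 2 * (1 - F.x t ^ 2 - F.R t) / (3 + F.v t ^ 2)) / (1 + F.x t / 2) := by
  have h1 := F.neg_one_lt_x ht
  have h2 := F.x_lt_one ht
  have h3 := F.tilt_stress_nonneg ht
  have h4 : 0 ≤ F.A t + F.R t := by linarith [(abs_le.1 (F.abs_A_le ht)).1]
  rw [le_div_iff₀ (by linarith)]
  set d := 4 * F.v t ^ 2 * (1 - F.x t ^ 2 - F.R t) / (3 + F.v t ^ 2)
  have h5 : 0 ≤ 2 / 3 * (1 + 2 * F.x t) ^ 2 + (F.A t + F.R t) := by positivity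
  set w := 2 / 3 * (1 + 2 * F.x t) ^ 2 + (F.A t + F.R t)
  nlinarith

lemma log_det_ge (ht : t > τ₀) :
    3 * F.logMono t - 6 * Real.log 2 ≤ Real.log (F.det t) := by
  have h1 := F.logPart_nonpos ht
  have h2 : -Real.log 2 ≤ Real.log (1 + F.x t / 2) := by
    rw [← Real.log_inv]
    exact Real.log_le_log (by norm_num) (by linarith [F.neg_one_lt_x ht])
  unfold logMono
  linarith

lemma log_det_le (ht : t > τ₀) : Real.log (F.det t) ≤ 2 * Real.log (F.N t) := by
  have : Real.log (F.det t) ≤ Real.log (F.N t ^ 2) :=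
    Real.log_le_log (F.det_pos t ht)
      (by unfold det; linarith [(abs_le.1 (F.abs_A_le ht)).2])
  simpa using this

/-- The averaging identity: `A` is a quarter of a total derivative up to a term of order `C/N`.
Subtracting multiples of the bounded function `C/N` removes `A` from other evolution equations. -/
lemma hasDerivAt_C_div_N (ht : t > τ₀) :
    HasDerivAt (fun s => F.C s / F.N s)
      (4 * F.A t + F.C t / F.N t * (F.x t ^ 2 + F.A t - 1 - 3 * (F.C t / F.N t))) t := by
  have hN := (F.N_pos t ht).ne'
  refine ((F.hC t ht).fun_div (F.hN t ht) hN).congr_deriv ?_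
  field_simp
  ring

lemma abs_C_div_N_le (ht : t > τ₀) : |F.C t / F.N t| ≤ 1 / F.N t := by
  have hN := F.N_pos t ht
  rw [abs_div, abs_of_pos hN]
  have := F.abs_C_le ht
  have := F.R_lt_one ht
  gcongr
  linarith

lemma C_div_N_deriv_error (ht : t > τ₀) :
    |F.C t / F.N t * (F.x t ^ 2 + F.A t - 1 - 3 * (F.C t / F.N t))| ≤
      |F.C t| * ((2 + 3 * (1 / F.N t)) / F.N t) := by
  have hN := F.N_pos t ht
  have h1 := abs_le.1 (F.abs_A_le ht)
  have h2 := F.R_lt_one ht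
  have h3 := F.x_sq_lt_one ht
  have h4 := abs_le.1 (F.abs_C_div_N_le ht)
  have : |F.x t ^ 2 + F.A t - 1 - 3 * (F.C t / F.N t)| ≤ 2 + 3 * (1 / F.N t) :=
    abs_le.2 ⟨by nlinarith [sq_nonneg (F.x t)], by nlinarith⟩
  rw [abs_mul, abs_div, abs_of_pos hN]
  calc |F.C t| / F.N t * _ ≤ |F.C t| / F.N t * (2 + 3 * (1 / F.N t)) := by gcongr
    _ = _ := by ring

/-- `C² ≤ (R - A)(R + A)` and `R - A ≤ 2`. This lets the derivative of `logMono` absorb errors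
quadratic in `C`. -/
lemma C_sq_le (ht : t > τ₀) : F.C t ^ 2 ≤ 2 * (F.A t + F.R t) := by
  have h1 := abs_le.1 (F.abs_A_le ht)
  have h2 := F.R_lt_one ht
  nlinarith [F.R_sq t ht, sq_nonneg (F.X t)]

/-- `1 / N₊` decays exponentially. -/
lemma inv_N_le_exp : ∃ b κ T : ℝ, 0 < b ∧ 0 < κ ∧ τ₀ < T ∧
    ∀ t ≥ T, 1 / F.N t ≤ b * Real.exp (-κ * t) := by
  have hT : τ₀ < τ₀ + 1 := by linarith
  have hgt : ∀ t ≥ τ₀ + 1, t > τ₀ := fun t ht => hT.trans_le ht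
  have hmono := monotoneOn_Ici_of_hasDerivAt (T := τ₀ + 1)
    (fun t ht => F.hasDerivAt_logMono (hgt t ht)) (fun t ht =>
      le_trans (by
        have := (abs_le.1 (F.abs_A_le (hgt t ht))).1
        have : 0 ≤ F.A t + F.R t := by linarith
        positivity) (F.logMono_deriv_ge (hgt t ht)))
  set Z₀ := F.logMono (τ₀ + 1)
  set m : ℝ := Real.exp (-((3 * Z₀ - 6 * Real.log 2) / 2)) with hm
  have hm0 : 0 < m := Real.exp_pos _
  have hNinv : ∀ t ≥ τ₀ + 1,
      1 / F.N t ≤ Real.exp (-((3 * F.logMono t - 6 * Real.log 2) / 2)) := by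
    intro t ht
    have h1 := F.log_det_ge (hgt t ht)
    have h2 := F.log_det_le (hgt t ht)
    have hN := F.N_pos t (hgt t ht)
    rw [← Real.log_le_iff_le_exp (by positivity), one_div, Real.log_inv]
    linarith
  have hMm : ∀ t ≥ τ₀ + 1, 1 / F.N t ≤ m := by
    intro t ht
    refine (hNinv t ht).trans (Real.exp_le_exp.2 ?_)
    have := hmono (Set.mem_Ici.2 le_rfl) (Set.mem_Ici.2 ht) ht
    simp only [Z₀]
    linarith
  -- Half of the error in `(C/N)'` is at most `k|C| ≤ 1/8 + 2k²C²`. The weight `K` of `logMono` is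
  -- large enough to absorb the `C²` part and to leave `(1 + 2x)²/2` over.
  set k : ℝ := (2 + 3 * m) * m / 2 with hk
  have hk0 : 0 < k := by positivity
  set K : ℝ := 2 + 6 * k ^ 2 with hK
  have hK0 : 0 < K := by positivity
  have hf := fun t (ht : t ≥ τ₀ + 1) =>
    ((F.hasDerivAt_logPart (hgt t ht)).fun_sub
      ((F.hasDerivAt_C_div_N (hgt t ht)).div_const 2)).fun_add
      ((F.hasDerivAt_logMono (hgt t ht)).const_mul K)
  have hlow := monotoneOn_Ici_of_hasDerivAt (T := τ₀ + 1)
    (fun t ht => (hf t ht).fun_sub ((hasDerivAt_id t).const_mul (1 / 8))) (fun t ht => by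
      have ht' := hgt t ht
      have h1 := F.logMono_deriv_ge ht'
      have h2 := F.C_div_N_deriv_error ht'
      have h3 : |F.C t| * ((2 + 3 * (1 / F.N t)) / F.N t) ≤ |F.C t| * (2 * k) := by
        have hN := F.N_pos t ht'
        have h4 := hMm t ht
        have : (2 + 3 * (1 / F.N t)) / F.N t = (2 + 3 * (1 / F.N t)) * (1 / F.N t) := by ring
        rw [this, hk]
        have h5 : 0 < 1 / F.N t := by positivity
        have : (2 + 3 * (1 / F.N t)) * (1 / F.N t) ≤ 2 * ((2 + 3 * m) * m / 2) := by
          nlinarith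
        gcongr
      have h4 := (abs_le.1 (h2.trans h3)).2
      have h5 := F.C_sq_le ht'
      have h6 : 0 ≤ F.A t + F.R t := by linarith [(abs_le.1 (F.abs_A_le ht')).1]
      have h7 : |F.C t| * k ≤ 1 / 8 + 2 * k ^ 2 * F.C t ^ 2 := by
        rw [← sq_abs (F.C t)]
        nlinarith [sq_nonneg (4 * k * |F.C t| - 1)]
      have h8 := mul_le_mul_of_nonneg_left h1 hK0.le
      have h9 : 2 * k ^ 2 * F.C t ^ 2 ≤ 4 * k ^ 2 * (F.A t + F.R t) := by
        nlinarith [sq_nonneg k]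
      have h10 : (1 + 2 * F.x t) ^ 2 / 2 + 4 * k ^ 2 * (F.A t + F.R t) ≤
          K * (2 / 3 * (2 / 3 * (1 + 2 * F.x t) ^ 2 + (F.A t + F.R t))) := by
        rw [hK]
        nlinarith [mul_nonneg (sq_nonneg k) (sq_nonneg (1 + 2 * F.x t)),
          sq_nonneg (1 + 2 * F.x t)]
      -- `2x² + (1 + 2x)²/2 = (1 + 4x)²/4 + 1/4`, and `1/4 - 1/8` leaves the growth rate `1/8`.
      nlinarith [sq_nonneg (1 + 4 * F.x t)])
  set c₀ : ℝ := F.logPart (τ₀ + 1) - F.C (τ₀ + 1) / F.N (τ₀ + 1) / 2 +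
    K * F.logMono (τ₀ + 1) - 1 / 8 * (τ₀ + 1) with hc₀
  refine ⟨Real.exp (-(3 / (2 * K)) * (c₀ - m / 2) + 3 * Real.log 2), 3 / (16 * K), τ₀ + 1,
    Real.exp_pos _, by positivity, hT, fun t ht => (hNinv t ht).trans ?_⟩
  rw [← Real.exp_add]
  apply Real.exp_le_exp.2
  have h1 := hlow (Set.mem_Ici.2 le_rfl) (Set.mem_Ici.2 ht) ht
  simp only [id] at h1
  rw [← hc₀] at h1
  have h2 := F.logPart_nonpos (hgt t ht)
  have h3 := (abs_le.1 ((F.abs_C_div_N_le (hgt t ht)).trans (hMm t ht))).1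
  -- Both `logPart` and `-C/(2N)` are bounded above, so the linear growth must come from `logMono`.
  have h4 : (c₀ - m / 2 + 1 / 8 * t) / K ≤ F.logMono t := by
    rw [div_le_iff₀ hK0]
    linarith
  have h5 : (c₀ - m / 2 + 1 / 8 * t) / K * (3 / 2) =
      3 / (2 * K) * (c₀ - m / 2) + 3 / (16 * K) * t := by
    field_simp
    ring
  linarith

lemma inv_N_pos (ht : t > τ₀) : 0 < 1 / F.N t := one_div_pos.2 (F.N_pos t ht)

lemma tendsto_inv_N : Tendsto (fun t => 1 / F.N t) atTop (𝓝 0) := by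
  obtain ⟨b, κ, T, hb, hκ, hT, h⟩ := F.inv_N_le_exp
  refine squeeze_zero' (g := fun t => b * Real.exp (-κ * t)) ?_ ?_
    (by simpa using (tendsto_exp_neg_mul hκ).const_mul b)
  · filter_upwards [eventually_gt_atTop τ₀] with t ht using (F.inv_N_pos ht).le
  · filter_upwards [eventually_ge_atTop T] with t ht using h t ht

lemma tendsto_C_div_N : Tendsto (fun t => F.C t / F.N t) atTop (𝓝 0) := by
  refine squeeze_zero_norm' ?_ F.tendsto_inv_N
  filter_upwards [eventually_gt_atTop τ₀] with t ht using F.abs_C_div_N_le ht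

/-! ### Decay of `Σ₊` and of the tilt. -/

lemma logPart_converges_and_x_tendsto :
    (∃ l, Tendsto F.logPart atTop (𝓝 l)) ∧ Tendsto F.x atTop (𝓝 0) := by
  obtain ⟨b, κ, T, hb, hκ, hT, h⟩ := F.inv_N_le_exp
  have hgt : ∀ t ≥ T, t > τ₀ := fun t ht => hT.trans_le ht
  set m := b * Real.exp (-κ * T) with hm
  have hMm : ∀ t ≥ T, 1 / F.N t ≤ m := fun t ht =>
    (h t ht).trans (by rw [hm]; gcongr b * Real.exp ?_; nlinarith)
  have hm0 : 0 < m := by positivity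
  set B := (2 + 3 * m) / 2 * b with hB
  have herr : ∀ t ≥ T, |F.C t / F.N t * (F.x t ^ 2 + F.A t - 1 - 3 * (F.C t / F.N t))| ≤
      2 * B * Real.exp (-κ * t) := fun t ht => by
    have h0 := hgt t ht
    have hM := F.inv_N_pos h0
    calc _ ≤ |F.C t| * ((2 + 3 * (1 / F.N t)) / F.N t) := F.C_div_N_deriv_error h0
      _ = |F.C t| * ((2 + 3 * (1 / F.N t)) * (1 / F.N t)) := by ring
      _ ≤ 1 * ((2 + 3 * m) * (b * Real.exp (-κ * t))) := by
        have := (F.abs_C_le h0).trans (F.R_lt_one h0).le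
        have := hMm t ht
        have := h t ht
        gcongr
      _ = _ := by rw [hB]; ring
  have hd := fun t (ht : t ≥ T) =>
    ((F.hasDerivAt_logPart (hgt t ht)).fun_sub
      ((F.hasDerivAt_C_div_N (hgt t ht)).div_const 2)).fun_sub
      ((hasDerivAt_exp_neg_mul κ t).const_mul (B / κ))
  have hk : ∀ t, B / κ * (-κ * Real.exp (-κ * t)) = -(B * Real.exp (-κ * t)) := fun t => by
    field_simp
  -- Subtracting `C/(2N)` cancels `2A`; the exponential term, whose derivative contributes `+B
  -- e^(-κt)`, pays for the averaging error.
  have hge : ∀ t ≥ T, F.x t ^ 2 ≤ 2 * (F.x t ^ 2 + F.A t) -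
      (4 * F.A t + F.C t / F.N t * (F.x t ^ 2 + F.A t - 1 - 3 * (F.C t / F.N t))) / 2 -
      B / κ * (-κ * Real.exp (-κ * t)) := fun t ht => by
    rw [hk]
    linarith [(abs_le.1 (herr t ht)).2, sq_nonneg (F.x t)]
  obtain ⟨l, hl⟩ := exists_tendsto_of_deriv_nonneg (b := m) hd
    (fun t ht => (sq_nonneg _).trans (hge t ht)) (fun t ht => by
      have h1 := F.logPart_nonpos (hgt t ht)
      have h2 := (abs_le.1 ((F.abs_C_div_N_le (hgt t ht)).trans (hMm t ht))).1
      have h3 : 0 ≤ B / κ * Real.exp (-κ * t) := by positivity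
      linarith)
  refine ⟨⟨l + 0 / 2 + B / κ * 0, ?_⟩, tendsto_zero_of_sq_le_deriv hd
    (fun t ht => F.hasDerivAt_x (hgt t ht)) hge (fun t ht => F.abs_x'_le (hgt t ht)) hl⟩
  refine ((hl.add (F.tendsto_C_div_N.div_const 2)).add
    ((tendsto_exp_neg_mul hκ).const_mul (B / κ))).congr fun t => ?_
  ring

lemma tendsto_x : Tendsto F.x atTop (𝓝 0) := F.logPart_converges_and_x_tendsto.2

/-- A function comparable to the logarithm of the tilt, which tends to `-∞`. -/
noncomputable def logTilt (t : ℝ) : ℝ :=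
  F.x t + (1 / 2 * Real.log (F.v t) - 1 / 6 * Real.log (1 - F.v t ^ 2)) - F.logPart t / 2 -
    F.x t * (F.C t / F.N t) / 4

/-- The tilt bracket has derivative `x`. Adding `x` itself turns this into decay at rate `R`;
`logPart/2` and `x(C/N)/4` remove the oscillating terms `A` and `xA`. -/
lemma hasDerivAt_logTilt (ht : t > τ₀) : HasDerivAt F.logTilt
    (F.x' t + F.x t - (F.x t ^ 2 + F.A t) - (F.x' t * (F.C t / F.N t) + F.x t *
      (4 * F.A t + F.C t / F.N t * (F.x t ^ 2 + F.A t - 1 - 3 * (F.C t / F.N t)))) / 4) t := by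
  have hv := F.v_pos t ht
  have hv2 : 0 < 1 - F.v t ^ 2 := by linarith [F.v_sq_lt_one ht]
  have hv3 : 0 < 3 - F.v t ^ 2 := by linarith
  have hP : HasDerivAt
      (fun t => 1 / 2 * Real.log (F.v t) - 1 / 6 * Real.log (1 - F.v t ^ 2)) (F.x t) t := by
    refine ((((F.hv t ht).log hv.ne').const_mul (1 / 2)).fun_sub
      (((((F.hv t ht).fun_pow 2).const_sub 1).log hv2.ne').const_mul (1 / 6))).congr_deriv ?_
    simp only [Nat.cast_ofNat, Nat.add_one_sub_one, pow_one]
    field_simp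
    ring
  refine ((((F.hasDerivAt_x ht).fun_add hP).fun_sub ((F.hasDerivAt_logPart ht).div_const 2)).fun_sub
    (((F.hasDerivAt_x ht).fun_mul (F.hasDerivAt_C_div_N ht)).div_const 4)).congr_deriv ?_
  ring

/-- The main terms are `x³ - x² - R` minus the tilt stress, at most `-R`. All averaging errors are
multiples of `R/N`, and for `1/N ≤ 1/8` they cost at most `R/2`. -/
lemma logTilt_deriv_le (ht : t > τ₀) (hM : 1 / F.N t ≤ 1 / 8) :
    F.x' t + F.x t - (F.x t ^ 2 + F.A t) - (F.x' t * (F.C t / F.N t) + F.x t *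
      (4 * F.A t + F.C t / F.N t * (F.x t ^ 2 + F.A t - 1 - 3 * (F.C t / F.N t)))) / 4 ≤
      -(F.R t / 2) := by
  have hM0 := F.inv_N_pos ht
  have hR := F.R_nonneg t ht
  have hCN : |F.C t / F.N t| ≤ F.R t * (1 / 8) := by
    rw [div_eq_mul_one_div, abs_mul, abs_of_pos hM0]
    have := F.abs_C_le ht
    gcongr
  have h1 : |F.x' t * (F.C t / F.N t)| ≤ 8 * (F.R t * (1 / 8)) := by
    rw [abs_mul]
    have := F.abs_x'_le ht
    gcongr
  have hx1 : |F.x t| ≤ 1 := abs_le.2 ⟨(F.neg_one_lt_x ht).le, (F.x_lt_one ht).le⟩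
  have h2 : |F.x t * (F.C t / F.N t * (F.x t ^ 2 + F.A t - 1 - 3 * (F.C t / F.N t)))| ≤
      1 * (F.R t * ((2 + 3 * (1 / 8)) * (1 / 8))) := by
    rw [abs_mul]
    have h3 := F.C_div_N_deriv_error ht
    have h4 : |F.C t| * ((2 + 3 * (1 / F.N t)) / F.N t) ≤
        F.R t * ((2 + 3 * (1 / 8)) * (1 / 8)) := by
      rw [div_eq_mul_one_div (2 + 3 * (1 / F.N t))]
      have := F.abs_C_le ht
      gcongr
    have := h3.trans h4
    gcongr
  have h3 := (abs_le.1 h1).1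
  have h4 := (abs_le.1 h2).1
  have h5 := F.tilt_stress_nonneg ht
  have h6 : F.x t ^ 3 ≤ F.x t ^ 2 := by
    nlinarith [sq_nonneg (F.x t), F.x_lt_one ht]
  have h7 : F.x' t + F.x t - (F.x t ^ 2 + F.A t) - F.x t * F.A t = F.x t ^ 3 - F.x t ^ 2 - F.R t -
      4 * F.v t ^ 2 * (1 - F.x t ^ 2 - F.R t) / (3 + F.v t ^ 2) := by
    unfold x'; ring
  linarith

lemma tendsto_v : Tendsto F.v atTop (𝓝 0) := by
  obtain ⟨l, hl⟩ := F.logPart_converges_and_x_tendsto.1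
  obtain ⟨T, hT⟩ := eventually_atTop.1 (((hl.eventually_const_le (sub_one_lt l)).and
    (F.tendsto_inv_N.eventually_le_const (by norm_num : (0 : ℝ) < 1 / 8))).and
    (eventually_gt_atTop τ₀))
  have hgt : ∀ t ≥ T, t > τ₀ := fun t ht => (hT t ht).2
  set k := -(l - 1) with hk
  -- The corrections in `logTilt` are bounded, so `v` and `exp (2 logTilt)` are comparable; the
  -- lower bound on `logPart` makes `X` at least a multiple of `v`.
  have hle : ∀ t ≥ T, 2 * F.logTilt t ≤ Real.log (F.v t) + 2 * k + 4 ∧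
      Real.log (F.v t) ≤ 2 * F.logTilt t + 3 ∧ Real.exp (-k) * F.v t ≤ F.X t := by
    intro t ht
    have h0 := hgt t ht
    have h1 : -k ≤ F.logPart t := by rw [hk, neg_neg]; exact (hT t ht).1.1
    have h2 := Real.log_le_log (F.X_pos h0) (F.X_le_v h0)
    have h3 : Real.log (1 - F.v t ^ 2) ≤ 0 :=
      Real.log_nonpos (by linarith [F.v_sq_lt_one h0]) (by linarith [sq_nonneg (F.v t)])
    have hx1 : |F.x t| ≤ 1 := abs_le.2 ⟨(F.neg_one_lt_x h0).le, (F.x_lt_one h0).le⟩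
    have h4 : |F.x t * (F.C t / F.N t)| ≤ 1 * 1 := by
      rw [abs_mul]
      have := (F.abs_C_div_N_le h0).trans (hT t ht).1.2
      gcongr
      linarith
    have h5 := abs_le.1 h4
    have h6 := abs_le.1 hx1
    have h7 := F.logPart_nonpos h0
    have h8 : F.logPart t =
      Real.log (F.X t) - Real.log (F.v t) + 1 / 3 * Real.log (1 - F.v t ^ 2) := rfl
    have h9 : F.logTilt t = F.x t + (1 / 2 * Real.log (F.v t) - 1 / 6 * Real.log (1 - F.v t ^ 2)) -
      F.logPart t / 2 - F.x t * (F.C t / F.N t) / 4 := rfl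
    refine ⟨by linarith, by linarith, ?_⟩
    rw [← Real.log_le_log_iff (by have := F.v_pos t h0; positivity) (F.X_pos h0),
      Real.log_mul (Real.exp_pos _).ne' (F.v_pos t h0).ne', Real.log_exp]
    linarith
  -- With `y = exp (2 logTilt)`, the bounds `R/2 ≥ X ≥ const · v ≥ const · y` give `y' ≤ -c y²`,
  -- that is `(1/y)' ≥ c > 0`.
  have htop : Tendsto (fun t => Real.exp (-(2 * F.logTilt t))) atTop atTop := by
    refine tendsto_atTop_of_deriv_ge (T := T) (c := 2 * Real.exp (-3 * k - 4)) (by positivity)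
      (fun t ht => ((F.hasDerivAt_logTilt (hgt t ht)).const_mul 2).fun_neg.exp) (fun t ht => ?_)
    have h0 := hgt t ht
    have h1 := F.logTilt_deriv_le h0 (hT t ht).1.2
    obtain ⟨h2, -, h3⟩ := hle t ht
    have h4 := F.two_mul_X_le h0
    have h5 : Real.exp (-3 * k - 4) * Real.exp (2 * F.logTilt t) ≤ Real.exp (-k) * F.v t := by
      calc _ = Real.exp (-3 * k - 4 + 2 * F.logTilt t) := (Real.exp_add _ _).symm
        _ ≤ Real.exp (-k + Real.log (F.v t)) := Real.exp_le_exp.2 (by linarith)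
        _ = _ := by rw [Real.exp_add, Real.exp_log (F.v_pos t h0)]
    have h6 : Real.exp (-3 * k - 4) =
        Real.exp (-(2 * F.logTilt t)) * (Real.exp (-3 * k - 4) * Real.exp (2 * F.logTilt t)) := by
      rw [Real.exp_neg]
      field_simp
    calc 2 * Real.exp (-3 * k - 4) = Real.exp (-(2 * F.logTilt t)) *
          (2 * (Real.exp (-3 * k - 4) * Real.exp (2 * F.logTilt t))) := by linarith
      _ ≤ _ := by gcongr; linarith
  have hbot : Tendsto (fun t => Real.exp 3 * (Real.exp (-(2 * F.logTilt t)))⁻¹) atTop (𝓝 0) := by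
    simpa using htop.inv_tendsto_atTop.const_mul (Real.exp 3)
  refine squeeze_zero' ?_ ?_ hbot
  · filter_upwards [eventually_ge_atTop T] with t ht using (F.v_pos t (hgt t ht)).le
  · filter_upwards [eventually_ge_atTop T] with t ht
    rw [← Real.exp_neg, neg_neg, ← Real.exp_add, ← Real.log_le_iff_le_exp (F.v_pos t (hgt t ht))]
    linarith [(hle t ht).2.1]

lemma tendsto_X : Tendsto F.X atTop (𝓝 0) := by
  refine squeeze_zero' ?_ ?_ F.tendsto_v
  · filter_upwards [eventually_gt_atTop τ₀] with t ht using (F.X_pos ht).le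
  · filter_upwards [eventually_gt_atTop τ₀] with t ht using F.X_le_v ht

/-! ### Motion on the hyperboloid and convergence of `R / X`. -/

/-- `R / X`, with `A / X` and `C / X` the coordinates of a motion on a hyperboloid. -/
noncomputable def r (t : ℝ) : ℝ := F.R t / F.X t

/-- `A / X`. -/
noncomputable def a (t : ℝ) : ℝ := F.A t / F.X t

/-- `C / X`. -/
noncomputable def c (t : ℝ) : ℝ := F.C t / F.X t

/-- Division by `X` cancels the common growth rate of `R`, `A`, `C` and `X`, leaving a boost and the
rotation by `N`. -/
lemma hasDerivAt_r (ht : t > τ₀) : HasDerivAt F.r (-2 * (1 + F.x t) * F.a t) t := by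
  have hX := (F.X_pos ht).ne'
  refine ((F.hR t ht).fun_div (F.hX t ht) hX).congr_deriv ?_
  unfold a
  field_simp
  ring

lemma hasDerivAt_a (ht : t > τ₀) :
    HasDerivAt F.a (-2 * (1 + F.x t) * F.r t - 4 * F.N t * F.c t) t := by
  have hX := (F.X_pos ht).ne'
  refine ((F.hA t ht).fun_div (F.hX t ht) hX).congr_deriv ?_
  unfold r c
  field_simp
  ring

lemma hasDerivAt_c (ht : t > τ₀) : HasDerivAt F.c (4 * F.N t * F.a t) t := by
  have hX := (F.X_pos ht).ne'
  refine ((F.hC t ht).fun_div (F.hX t ht) hX).congr_deriv ?_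
  unfold a
  field_simp
  ring

lemma two_le_r (ht : t > τ₀) : 2 ≤ F.r t := by
  rw [r, le_div_iff₀ (F.X_pos ht)]
  exact F.two_mul_X_le ht

lemma r_sq (ht : t > τ₀) : F.r t ^ 2 = F.a t ^ 2 + F.c t ^ 2 + 4 := by
  have hX := (F.X_pos ht).ne'
  unfold r a c
  field_simp
  linarith [F.R_sq t ht]

lemma abs_a_le (ht : t > τ₀) : |F.a t| ≤ F.r t :=
  abs_le_of_sq_le_sq (by nlinarith [F.r_sq ht, sq_nonneg (F.c t)]) (by linarith [F.two_le_r ht])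

lemma abs_c_le (ht : t > τ₀) : |F.c t| ≤ F.r t :=
  abs_le_of_sq_le_sq (by nlinarith [F.r_sq ht, sq_nonneg (F.a t)]) (by linarith [F.two_le_r ht])

lemma hasDerivAt_inv_N (ht : t > τ₀) : HasDerivAt (fun s => 1 / F.N s)
    (-(1 / F.N t) * ((1 + F.x t) ^ 2 + F.A t + 3 * (F.C t / F.N t))) t := by
  have hN := (F.N_pos t ht).ne'
  simp only [one_div]
  refine ((F.hN t ht).fun_inv hN).congr_deriv ?_
  field_simp

/-- `R / X` with the leading oscillation removed. -/
noncomputable def rHat (t : ℝ) : ℝ := F.r t + (1 + F.x t) * F.c t * (1 / F.N t) / 2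

/-- Since `c' = 4Na`, the correction cancels `r' = -2(1 + x)a` exactly and the remaining derivative
carries a factor `1/N`. -/
lemma hasDerivAt_rHat (ht : t > τ₀) : HasDerivAt F.rHat
    ((1 / F.N t) * (F.c t / 2 *
      (F.x' t - (1 + F.x t) * ((1 + F.x t) ^ 2 + F.A t + 3 * (F.C t / F.N t))))) t := by
  have hN := (F.N_pos t ht).ne'
  refine ((F.hasDerivAt_r ht).fun_add (((((F.hasDerivAt_x ht).const_add 1).fun_mul
    (F.hasDerivAt_c ht)).fun_mul (F.hasDerivAt_inv_N ht)).div_const 2)).congr_deriv ?_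
  field_simp
  ring

lemma r_converges : ∃ l, Tendsto F.r atTop (𝓝 l) := by
  obtain ⟨b, κ, T₀, hb, hκ, hT₀, h⟩ := F.inv_N_le_exp
  obtain ⟨T, hT⟩ := eventually_atTop.1
    ((F.tendsto_inv_N.eventually_le_const (by norm_num : (0 : ℝ) < 1 / 2)).and
    (eventually_ge_atTop T₀))
  have hgt : ∀ t ≥ T, t > τ₀ := fun t ht => hT₀.trans_le (hT t ht).2
  have hdiff : ∀ t ≥ T, |(1 + F.x t) * F.c t * (1 / F.N t) / 2| ≤ F.r t * (1 / F.N t) := by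
    intro t ht
    have h0 := hgt t ht
    have hM := F.inv_N_pos h0
    have h1 := F.neg_one_lt_x h0
    have h2 := F.x_lt_one h0
    rw [abs_div, abs_mul, abs_mul, abs_of_pos hM, abs_of_pos (by linarith : 0 < 1 + F.x t),
      abs_of_pos (by norm_num : (0 : ℝ) < 2)]
    calc (1 + F.x t) * |F.c t| * (1 / F.N t) / 2 ≤ 2 * F.r t * (1 / F.N t) / 2 := by
          have := F.abs_c_le h0
          gcongr
          linarith
      _ = _ := by ring
  have hbound : ∀ t ≥ T, |(1 / F.N t) * (F.c t / 2 *
      (F.x' t - (1 + F.x t) * ((1 + F.x t) ^ 2 + F.A t + 3 * (F.C t / F.N t))))| ≤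
      b * Real.exp (-κ * t) * (F.r t * 15) := by
    intro t ht
    have h0 := hgt t ht
    have hM := F.inv_N_pos h0
    have h1 := F.neg_one_lt_x h0
    have h2 := F.x_lt_one h0
    have h3 := abs_le.1 (F.abs_x'_le h0)
    have h4 := abs_le.1 ((F.abs_A_le h0).trans (F.R_lt_one h0).le)
    have h5 := abs_le.1 ((F.abs_C_div_N_le h0).trans (hT t ht).1)
    have h6 : |F.x' t - (1 + F.x t) * ((1 + F.x t) ^ 2 + F.A t + 3 * (F.C t / F.N t))| ≤ 30 := by
      rw [abs_le]; constructor <;> nlinarith [sq_nonneg (1 + F.x t)]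
    rw [abs_mul, abs_of_pos hM, abs_mul, abs_div, abs_of_pos (by norm_num : (0 : ℝ) < 2)]
    have h7 := F.abs_c_le h0
    have h8 := h t (hT t ht).2
    have h9 := F.two_le_r h0
    have h10 : 0 ≤ F.r t / 2 := by linarith
    calc 1 / F.N t * (|F.c t| / 2 * _) ≤ b * Real.exp (-κ * t) * (F.r t / 2 * 30) := by gcongr
      _ = _ := by ring
  have hhat : ∀ t ≥ T, F.r t ≤ 2 * F.rHat t := fun t ht => by
    have h0 := hgt t ht
    have h1 := (abs_le.1 (hdiff t ht)).1
    have h2 := F.two_le_r h0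
    have h3 := (hT t ht).1
    unfold rHat
    nlinarith
  have hpos : ∀ t ≥ T, 0 < F.rHat t := fun t ht => by
    linarith [hhat t ht, F.two_le_r (hgt t ht)]
  -- No upper bound on `r` is available yet. The error is proportional to `r ≤ 2 rHat`, so the
  -- logarithm of `rHat` has an exponentially small derivative.
  obtain ⟨l, hl⟩ := exists_tendsto_of_abs_deriv_le_exp (T := T) hκ (b := 30 * b)
    (fun t ht => (F.hasDerivAt_rHat (hgt t ht)).log (hpos t ht).ne') (fun t ht => by
      rw [abs_div, abs_of_pos (hpos t ht), div_le_iff₀ (hpos t ht)]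
      refine (hbound t ht).trans ?_
      have := hhat t ht
      calc b * Real.exp (-κ * t) * (F.r t * 15) ≤
            b * Real.exp (-κ * t) * (2 * F.rHat t * 15) := by gcongr
        _ = _ := by ring)
  have hrhat : Tendsto F.rHat atTop (𝓝 (Real.exp l)) := by
    refine ((Real.continuous_exp.tendsto l).comp hl).congr' ?_
    filter_upwards [eventually_ge_atTop T] with t ht using Real.exp_log (hpos t ht)
  refine ⟨Real.exp l, ?_⟩
  have hz : Tendsto (fun t => (1 + F.x t) * F.c t * (1 / F.N t) / 2) atTop (𝓝 0) := by
    refine squeeze_zero_norm' (a := fun t => 2 * F.rHat t * (1 / F.N t)) ?_ ?_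
    · filter_upwards [eventually_ge_atTop T] with t ht
      refine (hdiff t ht).trans ?_
      have := F.inv_N_pos (hgt t ht)
      gcongr
      exact hhat t ht
    · simpa using (hrhat.const_mul 2).mul F.tendsto_inv_N
  have := hrhat.sub hz
  rw [sub_zero] at this
  refine this.congr fun t => ?_
  simp [rHat]

lemma tendsto_R : Tendsto F.R atTop (𝓝 0) := by
  obtain ⟨l, hl⟩ := F.r_converges
  have := hl.mul F.tendsto_X
  rw [mul_zero] at this
  refine this.congr' ?_
  filter_upwards [eventually_gt_atTop τ₀] with t ht
  exact div_mul_cancel₀ _ (F.X_pos ht).ne'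

lemma tendsto_A : Tendsto F.A atTop (𝓝 0) := by
  refine squeeze_zero_norm' ?_ F.tendsto_R
  filter_upwards [eventually_gt_atTop τ₀] with t ht using F.abs_A_le ht

/-- The logarithmic derivative of `XN` tends to `1`: `X` decays more slowly than `N` grows. -/
lemma tendsto_X_mul_N : Tendsto (fun t => F.X t * F.N t) atTop atTop := by
  have hlim : Tendsto (fun t => 2 * (F.x t ^ 2 + F.A t + F.x t) +
      ((1 + F.x t) ^ 2 + F.A t + 3 * (F.C t / F.N t))) atTop (𝓝 1) := by
    have hx := F.tendsto_x
    have hA := F.tendsto_A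
    have := ((((hx.pow 2).add hA).add hx).const_mul 2).add
      ((((hx.const_add 1).pow 2).add hA).add (F.tendsto_C_div_N.const_mul 3))
    simpa using this
  obtain ⟨T, hT⟩ := eventually_atTop.1 ((hlim.eventually_const_le
    (by norm_num : (1 / 2 : ℝ) < 1)).and (eventually_gt_atTop τ₀))
  have hlog : Tendsto (fun t => Real.log (F.X t * F.N t)) atTop atTop := by
    refine tendsto_atTop_of_deriv_ge (T := T) (c := 1 / 2) (by norm_num)
      (fun t ht => ((F.hX t (hT t ht).2).fun_mul (F.hN t (hT t ht).2)).log
        (mul_pos (F.X_pos (hT t ht).2) (F.N_pos t (hT t ht).2)).ne') (fun t ht => ?_)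
    have hX := (F.X_pos (hT t ht).2).ne'
    have hN := (F.N_pos t (hT t ht).2).ne'
    refine (hT t ht).1.trans (le_of_eq ?_)
    field_simp
  refine (Real.tendsto_exp_atTop.comp hlog).congr' ?_
  filter_upwards [eventually_gt_atTop τ₀] with t ht
  exact Real.exp_log (mul_pos (F.X_pos ht) (F.N_pos t ht))

/-! ### Second-order averaging of the oscillation. -/

/-- The part `3 Ω (1 - v²) / (3 + v²)` of the density that drives `1 + Σ₊`. -/
noncomputable def E (t : ℝ) : ℝ := 3 / 2 * (F.X t / F.v t * (1 - F.v t ^ 2))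

lemma E_eq (ht : t > τ₀) :
    F.E t = 3 * (1 - F.x t ^ 2 - F.R t) * (1 - F.v t ^ 2) / (3 + F.v t ^ 2) := by
  have hv := (F.v_pos t ht).ne'
  have h3 : 3 + F.v t ^ 2 ≠ 0 := by positivity
  rw [E, F.X_eq t ht]
  field_simp

/-- In this form the `A` in `x'` cancels against the `A` in the growth rate of `N` when `cTilde` is
differentiated. Hence `G` contains the fast variable only through `a` and `C/N`, and `E` has a
bounded derivative. -/
lemma x'_eq (ht : t > τ₀) :
    F.x' t = F.E t - (1 - F.x t ^ 2 - F.A t) * (1 + F.x t) := by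
  have h3 : 3 + F.v t ^ 2 ≠ 0 := by positivity
  rw [F.E_eq ht, x']
  field_simp
  ring

lemma E_nonneg (ht : t > τ₀) : 0 ≤ F.E t := by
  have := F.X_pos ht
  have := F.v_pos t ht
  have : 0 < 1 - F.v t ^ 2 := by linarith [F.v_sq_lt_one ht]
  unfold E
  positivity

lemma E_le (ht : t > τ₀) : F.E t ≤ 3 / 2 := by
  have hv := F.v_pos t ht
  have h1 : F.X t / F.v t ≤ 1 := (div_le_one hv).2 (F.X_le_v ht)
  have h2 : 0 < F.X t / F.v t := div_pos (F.X_pos ht) hv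
  have h3 := F.v_sq_lt_one ht
  unfold E
  nlinarith [sq_nonneg (F.v t)]

/-- The derivative of `E`. -/
noncomputable def E' (t : ℝ) : ℝ := F.E t *
  (2 * (F.x t ^ 2 + F.A t + F.x t) - 6 * F.x t * (1 + F.v t ^ 2) / (3 - F.v t ^ 2))

lemma hasDerivAt_E (ht : t > τ₀) : HasDerivAt F.E (F.E' t) t := by
  have hv := (F.v_pos t ht).ne'
  have hv3 : 3 - F.v t ^ 2 ≠ 0 := by linarith [F.v_sq_lt_one ht]
  refine ((((F.hX t ht).fun_div (F.hv t ht) hv).fun_mul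
    (((F.hv t ht).fun_pow 2).const_sub 1)).const_mul (3 / 2)).congr_deriv ?_
  simp only [Nat.cast_ofNat, Nat.add_one_sub_one, pow_one, E', E]
  field_simp
  ring

lemma abs_x_le (ht : t > τ₀) : |F.x t| ≤ 1 :=
  abs_le.2 ⟨(F.neg_one_lt_x ht).le, (F.x_lt_one ht).le⟩

lemma abs_E'_le (ht : t > τ₀) : |F.E' t| ≤ 18 := by
  have h0 := F.E_nonneg ht
  have h1 := F.E_le ht
  have hx := F.abs_x_le ht
  have hA := abs_le.1 ((F.abs_A_le ht).trans (F.R_lt_one ht).le)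
  have hx2 := F.x_sq_lt_one ht
  have hv2 := F.v_sq_lt_one ht
  have hx' := abs_le.1 hx
  have h2 : |6 * F.x t * (1 + F.v t ^ 2) / (3 - F.v t ^ 2)| ≤ 6 := by
    rw [abs_div, abs_of_pos (by linarith : 0 < 3 - F.v t ^ 2), div_le_iff₀ (by linarith),
      abs_mul, abs_mul, abs_of_pos (by norm_num : (0 : ℝ) < 6),
      abs_of_pos (by positivity : 0 < 1 + F.v t ^ 2)]
    nlinarith [sq_nonneg (F.v t), abs_nonneg (F.x t)]
  have h3 := abs_le.1 h2
  have h4 : |2 * (F.x t ^ 2 + F.A t + F.x t) -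
      6 * F.x t * (1 + F.v t ^ 2) / (3 - F.v t ^ 2)| ≤ 12 := by
    rw [abs_le]; constructor <;> nlinarith [sq_nonneg (F.x t)]
  rw [E', abs_mul, abs_of_nonneg h0]
  calc _ ≤ 3 / 2 * (12 : ℝ) := by gcongr
    _ = 18 := by norm_num

/-- `C / X` with its first-order drift removed. -/
noncomputable def cTilde (t : ℝ) : ℝ := F.c t + (1 + F.x t) * F.r t * (1 / F.N t) / 2

/-- The forcing term of `cTilde`, multiplied by `2 N`. -/
noncomputable def G (t : ℝ) : ℝ :=
  F.r t * (F.E t - 2 * (1 + F.x t) ^ 2 - 3 * (1 + F.x t) * (F.C t / F.N t)) -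
    2 * (1 + F.x t) ^ 2 * F.a t

/-- `A / X` with its second-order drift removed. -/
noncomputable def aTilde (t : ℝ) : ℝ := F.a t + F.G t * (1 / F.N t) ^ 2 / 8

/-- The boost term in `a'` is absorbed by shifting the centre of the rotation, which is what defines
`cTilde`. -/
lemma hasDerivAt_a' (ht : t > τ₀) : HasDerivAt F.a (-4 * F.N t * F.cTilde t) t := by
  have hN := (F.N_pos t ht).ne'
  refine (F.hasDerivAt_a ht).congr_deriv ?_
  unfold cTilde
  field_simp
  ring

lemma hasDerivAt_cTilde (ht : t > τ₀) : HasDerivAt F.cTilde (4 * F.N t * F.aTilde t) t := by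
  have hN := (F.N_pos t ht).ne'
  refine ((F.hasDerivAt_c ht).fun_add (((((F.hasDerivAt_x ht).const_add 1).fun_mul
    (F.hasDerivAt_r ht)).fun_mul (F.hasDerivAt_inv_N ht)).div_const 2)).congr_deriv ?_
  rw [F.x'_eq ht, aTilde, G]
  field_simp
  ring

/-- The derivative of `C / N`. -/
noncomputable def q' (t : ℝ) : ℝ :=
  4 * F.A t + F.C t / F.N t * (F.x t ^ 2 + F.A t - 1 - 3 * (F.C t / F.N t))

/-- The derivative of `G`, up to the term with a factor `N`. -/
noncomputable def G' (t : ℝ) : ℝ :=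
  -2 * (1 + F.x t) * F.a t *
      (F.E t - 2 * (1 + F.x t) ^ 2 - 3 * (1 + F.x t) * (F.C t / F.N t)) +
    F.r t * (F.E' t - 4 * (1 + F.x t) * F.x' t -
      (3 * F.x' t * (F.C t / F.N t) + 3 * (1 + F.x t) * F.q' t)) -
    4 * (1 + F.x t) * F.x' t * F.a t

/-- The only term with a factor `N` comes from `a'`, and it is proportional to `cTilde`. -/
lemma hasDerivAt_G (ht : t > τ₀) :
    HasDerivAt F.G (F.G' t + 8 * (1 + F.x t) ^ 2 * F.N t * F.cTilde t) t := by
  have hy := (F.hasDerivAt_x ht).const_add 1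
  refine (((F.hasDerivAt_r ht).fun_mul (((F.hasDerivAt_E ht).fun_sub
    ((hy.fun_pow 2).const_mul 2)).fun_sub ((hy.const_mul 3).fun_mul
    (F.hasDerivAt_C_div_N ht)))).fun_sub
    (((hy.fun_pow 2).const_mul 2).fun_mul (F.hasDerivAt_a' ht))).congr_deriv ?_
  simp only [Nat.cast_ofNat, Nat.add_one_sub_one, pow_one, G', q']
  ring

/-- The forcing term of `aTilde`. -/
noncomputable def Q (t : ℝ) : ℝ :=
  ((F.G' t + 8 * (1 + F.x t) ^ 2 * F.N t * F.cTilde t) * (1 / F.N t) ^ 2 -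
    2 * F.G t * (1 / F.N t) ^ 2 * ((1 + F.x t) ^ 2 + F.A t + 3 * (F.C t / F.N t))) / 8

lemma hasDerivAt_aTilde (ht : t > τ₀) :
    HasDerivAt F.aTilde (-4 * F.N t * F.cTilde t + F.Q t) t := by
  refine ((F.hasDerivAt_a' ht).fun_add (((F.hasDerivAt_G ht).fun_mul
    ((F.hasDerivAt_inv_N ht).fun_pow 2)).div_const 8)).congr_deriv ?_
  simp only [Nat.cast_ofNat, Nat.add_one_sub_one, pow_one, Q]
  ring

lemma abs_C_div_N_le_one (ht : t > τ₀) (hM : 1 / F.N t ≤ 1) :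
    |F.C t / F.N t| ≤ 1 := (F.abs_C_div_N_le ht).trans hM

lemma abs_inner_le (ht : t > τ₀) (hM : 1 / F.N t ≤ 1) :
    |F.E t - 2 * (1 + F.x t) ^ 2 - 3 * (1 + F.x t) * (F.C t / F.N t)| ≤ 16 := by
  have h1 := abs_le.1 (F.abs_C_div_N_le_one ht hM)
  have h2 := F.neg_one_lt_x ht
  have h3 := F.x_lt_one ht
  have h4 := F.E_nonneg ht
  have h5 := F.E_le ht
  rw [abs_le]
  constructor <;> nlinarith

lemma abs_G_le (ht : t > τ₀) (hM : 1 / F.N t ≤ 1) :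
    |F.G t| ≤ 24 * F.r t := by
  have h1 := F.abs_inner_le ht hM
  have h2 := F.neg_one_lt_x ht
  have h3 := F.x_lt_one ht
  have h4 := F.abs_a_le ht
  have h5 := F.two_le_r ht
  have h6 : |F.r t * (F.E t - 2 * (1 + F.x t) ^ 2 - 3 * (1 + F.x t) * (F.C t / F.N t))| ≤
      F.r t * 16 := by
    rw [abs_mul, abs_of_pos (by linarith)]
    gcongr
  have h7 : |2 * (1 + F.x t) ^ 2 * F.a t| ≤ 8 * F.r t := by
    rw [abs_mul, abs_of_nonneg (by positivity)]
    have : 2 * (1 + F.x t) ^ 2 ≤ 8 := by nlinarith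
    gcongr
  unfold G
  refine (abs_sub _ _).trans ?_
  linarith

lemma abs_cTilde_le (ht : t > τ₀) (hM : 1 / F.N t ≤ 1) :
    |F.cTilde t| ≤ 2 * F.r t := by
  have h2 := F.neg_one_lt_x ht
  have h3 := F.x_lt_one ht
  have h4 := F.abs_c_le ht
  have h5 := F.two_le_r ht
  have h6 := F.inv_N_pos ht
  have h7 : |(1 + F.x t) * F.r t * (1 / F.N t) / 2| ≤ 2 * F.r t * 1 / 2 := by
    have h8 : 0 < 1 + F.x t := by linarith
    have h9 : 0 < F.r t := by linarith
    rw [abs_of_pos (by positivity)]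
    gcongr
    linarith
  unfold cTilde
  refine (abs_add_le _ _).trans ?_
  linarith

lemma abs_G'_le (ht : t > τ₀) (hM : 1 / F.N t ≤ 1) :
    |F.G' t| ≤ 300 * F.r t := by
  have h1 := F.abs_inner_le ht hM
  have hx1 := F.neg_one_lt_x ht
  have hx2 := F.x_lt_one ht
  have h4 := F.abs_a_le ht
  have h5 := F.two_le_r ht
  have h6 := F.abs_C_div_N_le_one ht hM
  have h7 := F.abs_x'_le ht
  have hy : |1 + F.x t| ≤ 2 := abs_le.2 ⟨by linarith, by linarith⟩
  have hr : |F.r t| = F.r t := abs_of_pos (by linarith)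
  have hq : |F.q' t| ≤ 9 := by
    have h8 := abs_le.1 ((F.abs_A_le ht).trans (F.R_lt_one ht).le)
    have h9 := F.C_div_N_deriv_error ht
    have h10 : |F.C t| * ((2 + 3 * (1 / F.N t)) / F.N t) ≤ 1 * ((2 + 3 * 1) * 1) := by
      rw [div_eq_mul_one_div (2 + 3 * (1 / F.N t))]
      have := (F.abs_C_le ht).trans (F.R_lt_one ht).le
      have := F.inv_N_pos ht
      gcongr
    have h11 := abs_le.1 (h9.trans h10)
    unfold q'
    rw [abs_le]
    constructor <;> linarith
  have t1 : |-2 * (1 + F.x t) * F.a t *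
      (F.E t - 2 * (1 + F.x t) ^ 2 - 3 * (1 + F.x t) * (F.C t / F.N t))| ≤
      2 * 2 * F.r t * 16 := by
    rw [abs_mul, abs_mul, abs_mul, abs_neg, abs_two]
    gcongr
  have t2 : |4 * (1 + F.x t) * F.x' t| ≤ 4 * 2 * 8 := by
    rw [abs_mul, abs_mul, abs_of_pos (by norm_num : (0 : ℝ) < 4)]
    gcongr
  have t3 : |3 * F.x' t * (F.C t / F.N t)| ≤ 3 * 8 * 1 := by
    rw [abs_mul, abs_mul, abs_of_pos (by norm_num : (0 : ℝ) < 3)]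
    gcongr
  have t4 : |3 * (1 + F.x t) * F.q' t| ≤ 3 * 2 * 9 := by
    rw [abs_mul, abs_mul, abs_of_pos (by norm_num : (0 : ℝ) < 3)]
    gcongr
  have t5 : |F.r t * (F.E' t - 4 * (1 + F.x t) * F.x' t -
      (3 * F.x' t * (F.C t / F.N t) + 3 * (1 + F.x t) * F.q' t))| ≤ F.r t * 160 := by
    rw [abs_mul, hr]
    have h8 := abs_le.1 (F.abs_E'_le ht)
    have h9 := abs_le.1 t2
    have h10 := abs_le.1 t3
    have h11 := abs_le.1 t4
    have : |F.E' t - 4 * (1 + F.x t) * F.x' t -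
      (3 * F.x' t * (F.C t / F.N t) + 3 * (1 + F.x t) * F.q' t)| ≤ 160 := by
      rw [abs_le]; constructor <;> linarith
    gcongr
  have t6 : |4 * (1 + F.x t) * F.x' t * F.a t| ≤ 4 * 2 * 8 * F.r t := by
    rw [abs_mul]
    gcongr
  have h8 := abs_le.1 t1
  have h9 := abs_le.1 t5
  have h10 := abs_le.1 t6
  unfold G'
  rw [abs_le]
  constructor <;> linarith

lemma abs_rate_le (ht : t > τ₀) (hM : 1 / F.N t ≤ 1) :
    |(1 + F.x t) ^ 2 + F.A t + 3 * (F.C t / F.N t)| ≤ 8 := by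
  have h1 := abs_le.1 (F.abs_C_div_N_le_one ht hM)
  have h2 := F.neg_one_lt_x ht
  have h3 := F.x_lt_one ht
  have h4 := abs_le.1 ((F.abs_A_le ht).trans (F.R_lt_one ht).le)
  rw [abs_le]
  constructor <;> nlinarith

/-- The forcing is `1/N` times a quantity that tends to zero as soon as `cTilde` does. -/
lemma abs_Q_le (ht : t > τ₀) (hM : 1 / F.N t ≤ 1) :
    |F.Q t| ≤ 1 / F.N t * (90 * F.r t * (1 / F.N t) + 4 * |F.cTilde t|) := by
  have hN := F.N_pos t ht
  have hM0 := F.inv_N_pos ht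
  have h1 := F.abs_G_le ht hM
  have h2 := F.abs_G'_le ht hM
  have h3 := F.abs_rate_le ht hM
  have h5 := F.two_le_r ht
  have hx1 := F.neg_one_lt_x ht
  have hx2 := F.x_lt_one ht
  have hy : (1 + F.x t) ^ 2 ≤ 4 := by nlinarith
  have e1 : F.Q t = (F.G' t * (1 / F.N t) ^ 2 +
      8 * (1 + F.x t) ^ 2 * (1 / F.N t) * F.cTilde t -
      2 * F.G t * (1 / F.N t) ^ 2 * ((1 + F.x t) ^ 2 + F.A t + 3 * (F.C t / F.N t))) / 8 := by
    unfold Q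
    field_simp
  set M := 1 / F.N t
  have t1 : |F.G' t * M ^ 2| ≤ 300 * F.r t * M ^ 2 := by
    rw [abs_mul, abs_of_pos (by positivity : 0 < M ^ 2)]
    gcongr
  have t2 : |8 * (1 + F.x t) ^ 2 * M * F.cTilde t| ≤ 8 * 4 * M * |F.cTilde t| := by
    rw [abs_mul, abs_of_nonneg (by positivity : 0 ≤ 8 * (1 + F.x t) ^ 2 * M)]
    gcongr
  have t3 : |2 * F.G t * M ^ 2 * ((1 + F.x t) ^ 2 + F.A t + 3 * (F.C t / F.N t))| ≤
      2 * (24 * F.r t) * M ^ 2 * 8 := by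
    rw [abs_mul, abs_mul, abs_mul, abs_two, abs_of_pos (by positivity : 0 < M ^ 2)]
    gcongr
  have h6 := abs_le.1 t1
  have h7 := abs_le.1 t2
  have h8 := abs_le.1 t3
  have h9 : 0 < F.r t * M ^ 2 := by
    have : 0 < F.r t := by linarith
    positivity
  rw [e1, abs_le]
  constructor <;> nlinarith

/-- The rotation preserves `a² + cTilde²`, so its derivative is only `cTilde · G / N`, which decays
exponentially because `r` is bounded. -/
lemma energy_converges :
    ∃ h, Tendsto (fun t => F.a t ^ 2 + F.cTilde t ^ 2) atTop (𝓝 h) := by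
  obtain ⟨b, κ, T₀, hb, hκ, hT₀, h⟩ := F.inv_N_le_exp
  obtain ⟨l, hl⟩ := F.r_converges
  obtain ⟨T, hT⟩ := eventually_atTop.1
    (((F.tendsto_inv_N.eventually_le_const zero_lt_one).and
    (hl.eventually_le_const (lt_add_one l))).and (eventually_ge_atTop T₀))
  have hgt : ∀ t ≥ T, t > τ₀ := fun t ht => hT₀.trans_le (hT t ht).2
  refine exists_tendsto_of_abs_deriv_le_exp (T := T) hκ (b := 2 * (l + 1) * (24 * (l + 1)) * b)
    (f' := fun t => F.cTilde t * F.G t * (1 / F.N t)) (fun t ht => ?_) (fun t ht => ?_)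
  · have hN := (F.N_pos t (hgt t ht)).ne'
    refine (((F.hasDerivAt_a' (hgt t ht)).fun_pow 2).fun_add
      ((F.hasDerivAt_cTilde (hgt t ht)).fun_pow 2)).congr_deriv ?_
    simp only [Nat.cast_ofNat, Nat.add_one_sub_one, pow_one, aTilde]
    field_simp
    ring
  · have h0 := hgt t ht
    have hM := (hT t ht).1.1
    have h1 := F.abs_G_le h0 hM
    have h2 := F.abs_cTilde_le h0 hM
    have h3 := h t (hT t ht).2
    have h4 := F.inv_N_pos h0
    have h5 := (hT t ht).1.2
    have h6 := F.two_le_r h0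
    have h7 : 0 < l + 1 := by linarith
    rw [abs_mul, abs_mul, abs_of_pos h4]
    calc |F.cTilde t| * |F.G t| * (1 / F.N t) ≤
          2 * (l + 1) * (24 * (l + 1)) * (b * Real.exp (-κ * t)) := by
          gcongr
          · linarith
          · linarith
      _ = _ := by ring

lemma tendsto_drift : Tendsto (fun t => F.cTilde t - F.c t) atTop (𝓝 0) := by
  obtain ⟨l, hl⟩ := F.r_converges
  have := ((((F.tendsto_x.const_add 1).mul hl).mul F.tendsto_inv_N).div_const 2)
  rw [mul_zero, zero_div] at this
  refine this.congr fun t => ?_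
  simp [cTilde]

lemma tendsto_G_mul : Tendsto (fun t => F.G t * (1 / F.N t) ^ 2 / 8) atTop (𝓝 0) := by
  obtain ⟨l, hl⟩ := F.r_converges
  refine squeeze_zero_norm' (a := fun t => 24 * F.r t * (1 / F.N t) ^ 2 / 8) ?_ ?_
  · filter_upwards [F.tendsto_inv_N.eventually_le_const zero_lt_one, eventually_gt_atTop τ₀]
      with t hM ht
    have := F.abs_G_le ht hM
    have := F.inv_N_pos ht
    rw [Real.norm_eq_abs, abs_div, abs_mul, abs_of_pos (by positivity : 0 < (1 / F.N t) ^ 2),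
      abs_of_pos (by norm_num : (0 : ℝ) < 8)]
    gcongr
  · simpa using ((hl.const_mul 24).mul (F.tendsto_inv_N.pow 2)).div_const 8

/-- If the amplitude of the oscillation decays, it is negligible against the drift. -/
lemma abs_cTilde_le_of_energy (h0 : Tendsto (fun t => F.a t ^ 2 + F.cTilde t ^ 2) atTop (𝓝 0)) :
    ∀ᶠ t in atTop, |F.cTilde t| ≤ 1 / F.N t / 4 := by
  obtain ⟨l, hl⟩ := F.r_converges
  have ha : Tendsto F.a atTop (𝓝 0) := by
    rw [tendsto_zero_iff_abs_tendsto_zero]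
    have h1 : Tendsto (fun t => √(F.a t ^ 2 + F.cTilde t ^ 2)) atTop (𝓝 0) := by
      simpa using h0.sqrt
    refine squeeze_zero (fun _ => abs_nonneg _) (fun t => ?_) h1
    exact Real.abs_le_sqrt (by nlinarith [sq_nonneg (F.cTilde t)])
  have hc : Tendsto F.cTilde atTop (𝓝 0) := by
    rw [tendsto_zero_iff_abs_tendsto_zero]
    have h1 : Tendsto (fun t => √(F.a t ^ 2 + F.cTilde t ^ 2)) atTop (𝓝 0) := by
      simpa using h0.sqrt
    refine squeeze_zero (fun _ => abs_nonneg _) (fun t => ?_) h1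
    exact Real.abs_le_sqrt (by nlinarith [sq_nonneg (F.a t)])
  have haT : Tendsto F.aTilde atTop (𝓝 0) := by
    have := ha.add F.tendsto_G_mul
    rwa [add_zero] at this
  -- The argument yields `√U ≤ 6ε/N`, and `6ε = 1/4` is the constant claimed.
  set ε : ℝ := 1 / 24 with hε
  have hε0 : 0 < ε := by norm_num
  have hrate : Tendsto (fun t => (1 + F.x t) ^ 2 + F.A t + 3 * (F.C t / F.N t)) atTop (𝓝 1) := by
    simpa using (((F.tendsto_x.const_add 1).pow 2).add F.tendsto_A).add
      (F.tendsto_C_div_N.const_mul 3)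
  have hsmall : Tendsto (fun t => 90 * F.r t * (1 / F.N t) + 4 * |F.cTilde t|) atTop (𝓝 0) := by
    simpa using ((hl.const_mul 90).mul F.tendsto_inv_N).add (hc.abs.const_mul 4)
  obtain ⟨T, hT⟩ := eventually_atTop.1
    ((((F.tendsto_inv_N.eventually_le_const zero_lt_one).and
    (hsmall.eventually_le_const hε0)).and
    ((hrate.eventually_const_le (by norm_num : (1 / 2 : ℝ) < 1)).and
      (hrate.eventually_le_const (by norm_num : (1 : ℝ) < 2)))).and (eventually_gt_atTop τ₀))
  -- First-order averaging would bound `cTilde` only by a multiple of `1/N` comparable to the drift,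
  -- hence `aTilde` in place of `a`. The last summand keeps `U` positive, so that its square root is
  -- differentiable.
  set U : ℝ → ℝ := fun t => F.aTilde t ^ 2 + F.cTilde t ^ 2 + ε ^ 2 * (1 / F.N t) ^ 2 with hU
  have hUpos : ∀ t ≥ T, 0 < U t := fun t ht => by
    have := F.inv_N_pos (hT t ht).2
    simp only [hU]
    positivity
  have hUd : ∀ t ≥ T, HasDerivAt U (2 * (F.aTilde t * F.Q t - ε ^ 2 * (1 / F.N t) ^ 2 *
      ((1 + F.x t) ^ 2 + F.A t + 3 * (F.C t / F.N t)))) t := fun t ht => by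
    have h1 := (hT t ht).2
    refine ((((F.hasDerivAt_aTilde h1).fun_pow 2).fun_add
      ((F.hasDerivAt_cTilde h1).fun_pow 2)).fun_add
      (((F.hasDerivAt_inv_N h1).fun_pow 2).const_mul (ε ^ 2))).congr_deriv ?_
    simp only [Nat.cast_ofNat, Nat.add_one_sub_one, pow_one]
    ring
  -- `(√U)' ≥ -3ε/N`, while `1/N` decreases at a relative rate of at least `1/2`, so `√U - 6ε/N` is
  -- increasing. Its limit is `0`, so it is never positive.
  have hmono := monotoneOn_Ici_of_hasDerivAt (T := T)
    (fun t ht => ((hUd t ht).sqrt (hUpos t ht).ne').fun_sub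
      ((F.hasDerivAt_inv_N (hT t ht).2).const_mul (6 * ε))) (fun t ht => by
      obtain ⟨⟨⟨hM, hs⟩, hr1, hr2⟩, h1⟩ := hT t ht
      have hM0 := F.inv_N_pos h1
      have hs0 : 0 < √(U t) := Real.sqrt_pos.2 (hUpos t ht)
      have h2 : |F.aTilde t| ≤ √(U t) := Real.abs_le_sqrt (by
        simp only [hU]; nlinarith [sq_nonneg (F.cTilde t), sq_nonneg (ε * (1 / F.N t))])
      have h3 : ε * (1 / F.N t) ≤ √(U t) := Real.le_sqrt_of_sq_le (by
        simp only [hU]; nlinarith [sq_nonneg (F.cTilde t), sq_nonneg (F.aTilde t)])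
      have h4 : |F.Q t| ≤ 1 / F.N t * ε :=
        (F.abs_Q_le h1 hM).trans (by gcongr)
      set u := (1 + F.x t) ^ 2 + F.A t + 3 * (F.C t / F.N t)
      set M := 1 / F.N t
      have h5 : |F.aTilde t * F.Q t| ≤ √(U t) * (M * ε) := by
        rw [abs_mul]; gcongr
      have h6 : ε ^ 2 * M ^ 2 * u ≤ √(U t) * (2 * (M * ε)) := by
        calc ε ^ 2 * M ^ 2 * u = (ε * M) * (u * (M * ε)) := by ring
          _ ≤ √(U t) * (2 * (M * ε)) := by gcongr
      have h7 := (abs_le.1 h5).1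
      have h8 : -(3 * (M * ε)) ≤ 2 * (F.aTilde t * F.Q t - ε ^ 2 * M ^ 2 * u) / (2 * √(U t)) := by
        rw [le_div_iff₀ (by positivity)]
        nlinarith
      have h9 : 3 * (M * ε) ≤ 6 * ε * (M * u) := by
        have : 0 < M * ε := by positivity
        nlinarith
      generalize 2 * (F.aTilde t * F.Q t - ε ^ 2 * M ^ 2 * u) / (2 * √(U t)) = w at h8 ⊢
      have h10 : w - 6 * ε * (-M * u) = w + 6 * ε * (M * u) := by ring
      rw [h10]
      linarith only [h8, h9])
  have hlim : Tendsto (fun t => √(U t) - 6 * ε * (1 / F.N t)) atTop (𝓝 0) := by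
    have h1 : Tendsto U atTop (𝓝 0) := by
      have := ((haT.pow 2).add (hc.pow 2)).add ((F.tendsto_inv_N.pow 2).const_mul (ε ^ 2))
      rwa [zero_pow two_ne_zero, mul_zero, add_zero, add_zero] at this
    simpa using h1.sqrt.sub (F.tendsto_inv_N.const_mul (6 * ε))
  filter_upwards [eventually_ge_atTop T] with t ht
  have h1 : √(U t) - 6 * ε * (1 / F.N t) ≤ 0 :=
    ge_of_tendsto hlim ((eventually_ge_atTop t).mono fun s hs =>
      hmono (Set.mem_Ici.2 ht) (Set.mem_Ici.2 (ht.trans hs)) hs)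
  have h2 : |F.cTilde t| ≤ √(U t) := Real.abs_le_sqrt (by
    simp only [hU]; nlinarith [sq_nonneg (F.aTilde t), sq_nonneg (ε * (1 / F.N t))])
  rw [hε] at h1
  linarith

/-! ### Lower bounds for `𝓡₂`. -/

/-- Either the motion on the hyperboloid keeps a positive amplitude, or it decays to its drift. -/
lemma amplitude_dichotomy :
    (∃ h > 0, ∀ᶠ t in atTop, h * F.X t ≤ √(F.A t ^ 2 + F.C t ^ 2)) ∨
    (Tendsto (fun t => √(F.A t ^ 2 + F.C t ^ 2) / F.R t) atTop (𝓝 0) ∧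
      ∀ᶠ t in atTop, F.X t * (1 / F.N t) / 2 ≤ √(F.A t ^ 2 + F.C t ^ 2)) := by
  have hAa : ∀ t > τ₀, F.A t = F.a t * F.X t := fun t ht =>
    (div_mul_cancel₀ _ (F.X_pos ht).ne').symm
  have hCc : ∀ t > τ₀, F.C t = F.c t * F.X t := fun t ht =>
    (div_mul_cancel₀ _ (F.X_pos ht).ne').symm
  have hRr : ∀ t > τ₀, F.R t = F.r t * F.X t := fun t ht =>
    (div_mul_cancel₀ _ (F.X_pos ht).ne').symm
  have hsq : ∀ t > τ₀, √(F.A t ^ 2 + F.C t ^ 2) = √(F.a t ^ 2 + F.c t ^ 2) * F.X t := by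
    intro t ht
    rw [hAa t ht, hCc t ht, ← Real.sqrt_sq (F.X_pos ht).le, ← Real.sqrt_mul (by positivity),
      Real.sqrt_sq (F.X_pos ht).le]
    ring_nf
  obtain ⟨h, hh⟩ := F.energy_converges
  obtain ⟨l, hl⟩ := F.r_converges
  have hcb : ∀ᶠ t in atTop, |F.cTilde t + F.c t| ≤ 3 * (l + 1) := by
    filter_upwards [F.tendsto_inv_N.eventually_le_const zero_lt_one, eventually_gt_atTop τ₀,
      hl.eventually_le_const (lt_add_one l)] with t hM ht hr
    have := F.abs_cTilde_le ht hM
    have := F.abs_c_le ht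
    refine (abs_add_le _ _).trans (by linarith)
  have hdiff : Tendsto (fun t => (F.cTilde t - F.c t) * (F.cTilde t + F.c t)) atTop (𝓝 0) :=
    F.tendsto_drift.zero_mul_isBoundedUnder_le
      (isBoundedUnder_of_eventually_le (a := 3 * (l + 1)) hcb)
  have hac : Tendsto (fun t => F.a t ^ 2 + F.c t ^ 2) atTop (𝓝 h) := by
    have := hh.sub hdiff
    rw [sub_zero] at this
    refine this.congr fun t => ?_
    ring
  have hnn : 0 ≤ h := ge_of_tendsto' hh fun t => by positivity
  rcases hnn.lt_or_eq with hpos | hzero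
  · left
    refine ⟨√(h / 2), Real.sqrt_pos.2 (by positivity), ?_⟩
    filter_upwards [hac.eventually_const_le (by linarith : h / 2 < h), eventually_gt_atTop τ₀]
      with t h1 ht
    have := (F.X_pos ht).le
    rw [hsq t ht]
    gcongr
  · right
    rw [← hzero] at hh hac
    constructor
    · have h1 : Tendsto (fun t => √(F.a t ^ 2 + F.c t ^ 2)) atTop (𝓝 0) := by simpa using hac.sqrt
      refine squeeze_zero' ?_ ?_ h1
      · filter_upwards [eventually_gt_atTop τ₀] with t ht
        have := F.R_nonneg t ht
        positivity
      · filter_upwards [eventually_gt_atTop τ₀] with t ht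
        have hX := F.X_pos ht
        have hr := F.two_le_r ht
        rw [hsq t ht, div_le_iff₀ (F.R_pos ht), hRr t ht]
        have : 0 ≤ √(F.a t ^ 2 + F.c t ^ 2) * F.X t := by positivity
        nlinarith
    · filter_upwards [F.abs_cTilde_le_of_energy hh, eventually_gt_atTop τ₀,
        F.tendsto_x.eventually_const_le (by norm_num : (-1 / 4 : ℝ) < 0)] with t h1 ht hx
      have hX := F.X_pos ht
      have hM := F.inv_N_pos ht
      have hr := F.two_le_r ht
      -- `r ≥ 2` keeps the drift of `c` at least `3/(4N)`; the oscillation takes away at most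
      -- `1/(4N)`.
      have h2 : 3 / 4 * (1 / F.N t) ≤ (1 + F.x t) * F.r t * (1 / F.N t) / 2 := by
        have : 3 / 2 ≤ (1 + F.x t) * F.r t := by nlinarith
        nlinarith
      have h3 : F.c t = F.cTilde t - (1 + F.x t) * F.r t * (1 / F.N t) / 2 := by
        simp [cTilde]
      have h4 : 1 / F.N t / 2 ≤ |F.c t| := by
        rw [h3]
        refine le_trans ?_ (neg_le_abs _)
        linarith [le_abs_self (F.cTilde t)]
      have h5 : |F.c t| ≤ √(F.a t ^ 2 + F.c t ^ 2) :=
        Real.abs_le_sqrt (by nlinarith [sq_nonneg (F.a t)])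
      rw [hsq t ht]
      nlinarith

lemma tendsto_amplitude_mul_N_sq :
    Tendsto (fun t => √(F.A t ^ 2 + F.C t ^ 2) * F.N t ^ 2) atTop atTop := by
  rcases F.amplitude_dichotomy with ⟨h, hh, hev⟩ | ⟨-, hev⟩
  · refine tendsto_atTop_mono' _ ?_ (F.tendsto_X_mul_N.const_mul_atTop hh)
    filter_upwards [hev, eventually_gt_atTop τ₀,
      F.tendsto_inv_N.eventually_le_const zero_lt_one] with t h1 ht hM
    have hN := F.N_pos t ht
    have hX := F.X_pos ht
    have hN1 : 1 ≤ F.N t := by rwa [div_le_one hN] at hM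
    calc h * (F.X t * F.N t) = h * F.X t * F.N t := by ring
      _ ≤ √(F.A t ^ 2 + F.C t ^ 2) * F.N t ^ 2 := by
        gcongr
        nlinarith
  · refine tendsto_atTop_mono' _ ?_ (F.tendsto_X_mul_N.const_mul_atTop one_half_pos)
    filter_upwards [hev, eventually_gt_atTop τ₀] with t h1 ht
    have hN := F.N_pos t ht
    calc 1 / 2 * (F.X t * F.N t) = F.X t * (1 / F.N t) / 2 * F.N t ^ 2 := by field_simp
      _ ≤ _ := by gcongr

lemma amplitude_ge_of_not_tendsto
    (h : ¬ Tendsto (fun t => √(F.A t ^ 2 + F.C t ^ 2) / F.R t) atTop (𝓝 0)) :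
    ∃ δ > 0, ∀ᶠ t in atTop, δ * F.R t ≤ √(F.A t ^ 2 + F.C t ^ 2) := by
  rcases F.amplitude_dichotomy with ⟨k, hk, hev⟩ | ⟨h0, -⟩
  · obtain ⟨l, hl⟩ := F.r_converges
    have hl2 : 2 ≤ l := ge_of_tendsto hl
      ((eventually_gt_atTop τ₀).mono fun t ht => F.two_le_r ht)
    refine ⟨k / (l + 1), by positivity, ?_⟩
    filter_upwards [hev, hl.eventually_le_const (lt_add_one l), eventually_gt_atTop τ₀]
      with t h1 h2 ht
    refine le_trans ?_ h1
    have h3 : F.R t ≤ (l + 1) * F.X t := by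
      rwa [r, div_le_iff₀ (F.X_pos ht)] at h2
    calc k / (l + 1) * F.R t ≤ k / (l + 1) * ((l + 1) * F.X t) := by gcongr
      _ = _ := by field_simp
  · exact absurd h0 h

end InvariantFlow

/-! ### Connection and curvature of the frame. -/

namespace BianchiModel

/-- Connection coefficients `Γ^c_{ab}` of a class A model with `e₁` in the kernel of `n`, where
`σ = !![-2 * x, y, z; y, x + s, t; z, t, x - s]` and `n = !![0, 0, 0; 0, p + k, l; 0, l, p - k]`. -/
def connTable (H x s t y z p k l w w₁ w₂ : ℝ) : Fin 4 → Fin 4 → Fin 4 → ℝ :=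
  ![![![0, 0, 0, 0], ![0, H - 2 * x, y, z], ![0, y, H + x + s, t], ![0, z, t, H + x - s]],
    ![![0, 0, w₂, -w₁], ![H - 2 * x, 0, 0, 0], ![y, 0, l, -k], ![z, 0, -k, -l]],
    ![![0, -w₂, 0, w], ![y, 0, 0, -p], ![H + x + s, -l, 0, 0], ![t, k, 0, 0]],
    ![![0, w₁, -w, 0], ![z, 0, p, 0], ![t, k, 0, 0], ![H + x - s, l, 0, 0]]]

/-- Riemann tensor in terms of the connection coefficients `Γ` and their clock time derivatives. -/
def riemTable (Γ Γ' : Fin 4 → Fin 4 → Fin 4 → ℝ) (a b c d : Fin 4) : ℝ :=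
  (if c = 0 then Γ' a d b else 0) - (if d = 0 then Γ' a c b else 0) +
    ∑ f, (Γ f d b * Γ a c f - Γ f c b * Γ a d f - (Γ f c d - Γ f d c) * Γ a f b)

variable (B : BianchiModel)

lemma eps3_swap (i j k : Fin 3) : eps3 j i k = -eps3 i j k := by
  unfold eps3; ring

@[simp] lemma sgn_zero : sgn 0 = -1 := rfl
@[simp] lemma sgn_succ (α : Fin 3) : sgn α.succ = 1 := rfl

@[simp] lemma comm_zero (τ : ℝ) (a b : Fin 4) : B.comm τ 0 a b = 0 := rfl
@[simp] lemma comm_succ_zero_zero (τ : ℝ) (γ : Fin 3) : B.comm τ γ.succ 0 0 = 0 := rfl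
@[simp] lemma comm_succ_zero_succ (τ : ℝ) (γ β : Fin 3) :
    B.comm τ γ.succ 0 β.succ = B.timeComm τ γ β := rfl
@[simp] lemma comm_succ_succ_zero (τ : ℝ) (γ β : Fin 3) :
    B.comm τ γ.succ β.succ 0 = -B.timeComm τ γ β := rfl
@[simp] lemma comm_succ_succ_succ (τ : ℝ) (γ α β : Fin 3) :
    B.comm τ γ.succ α.succ β.succ = B.spaceComm τ γ α β := rfl

lemma spaceComm_swap (τ : ℝ) (γ α β : Fin 3) :
    B.spaceComm τ γ β α = -B.spaceComm τ γ α β := by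
  simp only [spaceComm, ← Finset.sum_neg_distrib]
  exact Finset.sum_congr rfl fun δ _ => by rw [eps3_swap]; ring

lemma comm_swap (τ : ℝ) (c a b : Fin 4) : B.comm τ c b a = -B.comm τ c a b := by
  cases c using Fin.cases with
  | zero => simp
  | succ γ =>
    cases a using Fin.cases <;> cases b using Fin.cases <;> simp
    rw [spaceComm_swap]

lemma sgn_mul_self (a : Fin 4) : sgn a * sgn a = 1 := by
  cases a using Fin.cases <;> simp

lemma conn_sub_conn (τ : ℝ) (c a b : Fin 4) :
    B.conn τ c a b - B.conn τ c b a = B.comm τ c a b := by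
  have h := sgn_mul_self c
  simp only [conn, B.comm_swap τ c a b, B.comm_swap τ a c b, B.comm_swap τ b c a]
  linear_combination B.comm τ c a b * h

lemma conn_swap (τ : ℝ) (c a b : Fin 4) :
    sgn b * B.conn τ b a c = -(sgn c * B.conn τ c a b) := by
  have h := sgn_mul_self c
  have hb := sgn_mul_self b
  simp only [conn, B.comm_swap τ a b c, B.comm_swap τ c a b, B.comm_swap τ b a c]
  linear_combination
    (sgn c * B.comm τ c a b - sgn a * B.comm τ a b c - sgn b * B.comm τ b a c) / 2 * (h - hb)

/-- The clock time derivatives of the connection coefficients `Γ^a_{db}`, `d ≠ 0`. -/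
noncomputable def connDeriv (τ : ℝ) : Fin 4 → Fin 4 → Fin 4 → ℝ :=
  connTable (B.H τ * deriv B.H τ)
    (B.H τ * deriv (fun r => (B.σ r 1 1 + B.σ r 2 2) / 2) τ)
    (B.H τ * deriv (fun r => (B.σ r 1 1 - B.σ r 2 2) / 2) τ)
    (B.H τ * deriv (fun r => B.σ r 1 2) τ) (B.H τ * deriv (fun r => B.σ r 0 1) τ)
    (B.H τ * deriv (fun r => B.σ r 0 2) τ)
    (B.H τ * deriv (fun r => (B.n r 1 1 + B.n r 2 2) / 2) τ)
    (B.H τ * deriv (fun r => (B.n r 1 1 - B.n r 2 2) / 2) τ)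
    (B.H τ * deriv (fun r => B.n r 1 2) τ) 0 0 0

variable {B} {τ₀ : ℝ}

/-- The connection coefficients of a model of type VII₀. -/
lemma conn_eq (hB : B.IsRadiationVII0 τ₀) {τ : ℝ} (ht : τ > τ₀) :
    B.conn τ = connTable (B.H τ) ((B.σ τ 1 1 + B.σ τ 2 2) / 2) ((B.σ τ 1 1 - B.σ τ 2 2) / 2)
      (B.σ τ 1 2) (B.σ τ 0 1) (B.σ τ 0 2) ((B.n τ 1 1 + B.n τ 2 2) / 2)
      ((B.n τ 1 1 - B.n τ 2 2) / 2) (B.n τ 1 2) (B.ω τ 0) (B.ω τ 1) (B.ω τ 2) := by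
  have hs := fun i j => (hB.σ_symm τ ht).apply i j
  have hn := fun i j => (hB.n_symm τ ht).apply i j
  have hk := hB.n_ker τ ht
  have h10 := hs 0 1
  have h20 := hs 0 2
  have h21 := hs 1 2
  have n10 : B.n τ 1 0 = 0 := (hn 0 1).trans (hk 1)
  have n20 : B.n τ 2 0 = 0 := (hn 0 2).trans (hk 2)
  have n21 := hn 1 2
  have htr : B.σ τ 0 0 = -B.σ τ 1 1 - B.σ τ 2 2 := by
    have := hB.σ_trace τ ht
    rw [Matrix.trace_fin_three] at this
    linarith
  funext c a b
  cases c using Fin.cases with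
  | zero =>
    cases a using Fin.cases with
    | zero =>
      cases b using Fin.cases with
      | zero => simp [conn, connTable]
      | succ β =>
        simp only [conn, comm_zero, comm_succ_zero_zero]
        fin_cases β <;> simp [connTable]
    | succ α =>
      cases b using Fin.cases with
      | zero =>
        simp only [conn, comm_zero, comm_succ_zero_zero]
        fin_cases α <;> simp [connTable]
      | succ β =>
        simp only [conn, comm_zero, comm_succ_succ_zero, comm_succ_zero_succ, sgn_zero, sgn_succ,
          timeComm]
        fin_cases α <;> fin_cases β <;>
          simp [connTable, eps3, Fin.sum_univ_three, h10, h20, h21, htr] <;> ring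
  | succ γ =>
    cases a using Fin.cases with
    | zero =>
      cases b using Fin.cases with
      | zero =>
        simp only [conn, comm_zero, comm_succ_zero_zero]
        fin_cases γ <;> simp [connTable]
      | succ β =>
        simp only [conn, comm_zero, comm_succ_succ_zero, comm_succ_zero_succ, sgn_zero, sgn_succ,
          timeComm]
        fin_cases γ <;> fin_cases β <;>
          simp [connTable, eps3, Fin.sum_univ_three, h10, h20, h21, htr] <;> ring
    | succ α =>
      cases b using Fin.cases with
      | zero =>
        simp only [conn, comm_zero, comm_succ_succ_zero, comm_succ_zero_succ, sgn_zero, sgn_succ,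
          timeComm]
        fin_cases γ <;> fin_cases α <;>
          simp [connTable, eps3, Fin.sum_univ_three, h10, h20, h21, htr] <;> ring
      | succ β =>
        simp only [conn, comm_succ_succ_succ, sgn_succ, spaceComm]
        fin_cases γ <;> fin_cases α <;> fin_cases β <;>
          simp [connTable, eps3, Fin.sum_univ_three, hk, n10, n20, n21] <;> ring

/-- The index `δ.succ` excludes the rows `Γ^a_{0b}`, the only ones containing the angular velocity,
which is not assumed differentiable. -/
lemma hasDerivAt_connTable {H x s t y z p k l w w₁ w₂ : ℝ → ℝ}
    {H' x' s' t' y' z' p' k' l' τ : ℝ} (hH : HasDerivAt H H' τ) (hx : HasDerivAt x x' τ)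
    (hs : HasDerivAt s s' τ) (ht : HasDerivAt t t' τ) (hy : HasDerivAt y y' τ)
    (hz : HasDerivAt z z' τ) (hp : HasDerivAt p p' τ) (hk : HasDerivAt k k' τ)
    (hl : HasDerivAt l l' τ) (a b : Fin 4) (δ : Fin 3) :
    HasDerivAt (fun r => connTable (H r) (x r) (s r) (t r) (y r) (z r) (p r) (k r) (l r) (w r)
      (w₁ r) (w₂ r) a δ.succ b)
      (connTable H' x' s' t' y' z' p' k' l' 0 0 0 a δ.succ b) τ := by
  have h0 : HasDerivAt (fun _ : ℝ => (0 : ℝ)) 0 τ := hasDerivAt_const τ 0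
  have h1 := hH.fun_sub (hx.const_mul 2)
  have h2 := (hH.fun_add hx).fun_add hs
  have h3 := (hH.fun_add hx).fun_sub hs
  fin_cases a <;> fin_cases δ <;> fin_cases b <;>
    first
    | exact h0 | exact h1 | exact h2 | exact h3 | exact ht | exact hy | exact hz | exact hp
    | exact hk | exact hl | exact hk.neg | exact hl.neg | exact hp.neg

lemma mul_connTable (c H x s t y z p k l : ℝ) (a b d : Fin 4) :
    c * connTable H x s t y z p k l 0 0 0 a b d =
      connTable (c * H) (c * x) (c * s) (c * t) (c * y) (c * z) (c * p) (c * k) (c * l) 0 0 0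
        a b d := by
  fin_cases a <;> fin_cases b <;> fin_cases d <;> simp [connTable] <;> ring

lemma hasDerivAt_conn (hB : B.IsRadiationVII0 τ₀) {τ : ℝ} (ht : τ > τ₀) (a b : Fin 4)
    (δ : Fin 3) :
    HasDerivAt (fun r => B.conn r a δ.succ b) (B.connDeriv τ a δ.succ b / B.H τ) τ := by
  have hσ := fun i j => (hB.σ_diff τ ht i j)
  have hn := fun i j => (hB.n_diff τ ht i j)
  have he : (fun r => B.conn r a δ.succ b) =ᶠ[𝓝 τ] fun r => connTable (B.H r)
      ((B.σ r 1 1 + B.σ r 2 2) / 2) ((B.σ r 1 1 - B.σ r 2 2) / 2)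
      (B.σ r 1 2) (B.σ r 0 1) (B.σ r 0 2) ((B.n r 1 1 + B.n r 2 2) / 2)
      ((B.n r 1 1 - B.n r 2 2) / 2) (B.n r 1 2) (B.ω r 0) (B.ω r 1) (B.ω r 2) a δ.succ b := by
    filter_upwards [eventually_gt_nhds ht] with r hr
    rw [conn_eq hB hr]
  have hd := hasDerivAt_connTable (w := fun r => B.ω r 0) (w₁ := fun r => B.ω r 1)
    (w₂ := fun r => B.ω r 2) (hB.H_diff τ ht).hasDerivAt
    (((hσ 1 1).fun_add (hσ 2 2)).div_const 2).hasDerivAt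
    (((hσ 1 1).fun_sub (hσ 2 2)).div_const 2).hasDerivAt (hσ 1 2).hasDerivAt (hσ 0 1).hasDerivAt
    (hσ 0 2).hasDerivAt (((hn 1 1).fun_add (hn 2 2)).div_const 2).hasDerivAt
    (((hn 1 1).fun_sub (hn 2 2)).div_const 2).hasDerivAt (hn 1 2).hasDerivAt a b δ
  refine (hd.congr_of_eventuallyEq he).congr_deriv ?_
  rw [eq_div_iff (hB.H_pos τ ht).ne', mul_comm, mul_connTable, connDeriv]

lemma frameDeriv_conn (hB : B.IsRadiationVII0 τ₀) {τ : ℝ} (ht : τ > τ₀) (a b : Fin 4)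
    (δ : Fin 3) :
    B.frameDeriv 0 (fun r => B.conn r a δ.succ b) τ = B.connDeriv τ a δ.succ b := by
  rw [frameDeriv, if_pos rfl, (hasDerivAt_conn hB ht a b δ).deriv,
    mul_div_cancel₀ _ (hB.H_pos τ ht).ne']

/-- Derivatives of `Γ^a_{0b}` could occur only for `c = d = 0`, where the two terms cancel; the
zeros that `connDeriv` has in the angular velocity slots are therefore harmless. -/
lemma riem_eq (hB : B.IsRadiationVII0 τ₀) {τ : ℝ} (ht : τ > τ₀) :
    B.riem τ = riemTable (B.conn τ) (B.connDeriv τ) := by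
  funext a b c d
  simp only [riem, riemTable, conn_sub_conn]
  congr 1
  have h0 : ∀ (γ : Fin 3) (f : ℝ → ℝ), B.frameDeriv γ.succ f τ = 0 := fun γ f => by
    simp [frameDeriv]
  cases c using Fin.cases with
  | zero =>
    cases d using Fin.cases with
    | zero => simp
    | succ δ => simp [h0, frameDeriv_conn hB ht]
  | succ γ =>
    cases d using Fin.cases with
    | zero => simp [h0, frameDeriv_conn hB ht]
    | succ δ => simp [h0]

lemma jacobi_spatial (hB : B.IsRadiationVII0 τ₀) {τ : ℝ} (ht : τ > τ₀) (β γ : Fin 3)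
    (d : Fin 4) :
    B.connDeriv τ d β.succ γ.succ - B.connDeriv τ d γ.succ β.succ +
      ∑ f, ((B.conn τ f β.succ γ.succ - B.conn τ f γ.succ β.succ) *
          (B.conn τ d 0 f - B.conn τ d f 0) +
        (B.conn τ f γ.succ 0 - B.conn τ f 0 γ.succ) *
          (B.conn τ d β.succ f - B.conn τ d f β.succ) +
        (B.conn τ f 0 β.succ - B.conn τ f β.succ 0) *
          (B.conn τ d γ.succ f - B.conn τ d f γ.succ)) = 0 := by
  have h0 : ∀ (γ : Fin 3) (f : ℝ → ℝ), B.frameDeriv γ.succ f τ = 0 := fun γ f => by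
    simp [frameDeriv]
  have hd : ∀ β γ : Fin 3, DifferentiableAt ℝ (fun r => B.conn r d β.succ γ.succ) τ :=
    fun β γ => (hasDerivAt_conn hB ht d γ.succ β).differentiableAt
  have h1 : B.frameDeriv 0 (fun r => B.comm r d β.succ γ.succ) τ =
      B.connDeriv τ d β.succ γ.succ - B.connDeriv τ d γ.succ β.succ := by
    rw [← frameDeriv_conn hB ht, ← frameDeriv_conn hB ht]
    simp only [← conn_sub_conn, frameDeriv, if_pos]
    rw [deriv_fun_sub (hd _ _) (hd _ _), mul_sub]
  have := hB.jacobi τ ht 0 β.succ γ.succ d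
  rw [h0, h0, h1] at this
  simp only [conn_sub_conn, Finset.sum_add_distrib]
  linarith

end BianchiModel

/-! ### Block form of irrotational models and the field equations. -/

namespace BianchiModel

lemma eq_zero_of_det_pos {a b c p q : ℝ} (hdet : 0 < a * c - b ^ 2) (h1 : a * p + b * q = 0)
    (h2 : b * p + c * q = 0) : p = 0 ∧ q = 0 := by
  constructor
  · refine (mul_eq_zero.1 (?_ : (a * c - b ^ 2) * p = 0)).resolve_left hdet.ne'
    linear_combination c * h1 - b * h2
  · refine (mul_eq_zero.1 (?_ : (a * c - b ^ 2) * q = 0)).resolve_left hdet.ne'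
    linear_combination a * h2 - b * h1

lemma eq_zero_of_quadratic_form_eq_zero {a b c p q : ℝ} (hdet : 0 < a * c - b ^ 2)
    (h : a * p ^ 2 + 2 * b * p * q + c * q ^ 2 = 0) : p = 0 ∧ q = 0 := by
  have ha : a ≠ 0 := by rintro rfl; nlinarith [sq_nonneg b]
  have h1 : (a * p + b * q) ^ 2 + (a * c - b ^ 2) * q ^ 2 = 0 := by linear_combination a * h
  have h2 : 0 ≤ (a * c - b ^ 2) * q ^ 2 := by positivity
  have h3 : (a * c - b ^ 2) * q ^ 2 = 0 := by nlinarith [sq_nonneg (a * p + b * q)]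
  have hq : q = 0 := by simpa [hdet.ne'] using h3
  subst hq
  have hp : a * p ^ 2 = 0 := by linarith
  exact ⟨by simpa [ha] using hp, rfl⟩

section Definitions

variable (B : BianchiModel) (τ : ℝ)

/-- `H Σ₊`. -/
noncomputable def sPlus : ℝ := (B.σ τ 1 1 + B.σ τ 2 2) / 2

/-- `√3 H Σ₋`. -/
noncomputable def sMinus : ℝ := (B.σ τ 1 1 - B.σ τ 2 2) / 2

/-- `√3 H Σ_×`. -/
def sCross : ℝ := B.σ τ 1 2

/-- `H N₊`. -/
noncomputable def nPlus : ℝ := (B.n τ 1 1 + B.n τ 2 2) / 2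

/-- `√3 H N₋`. -/
noncomputable def nMinus : ℝ := (B.n τ 1 1 - B.n τ 2 2) / 2

/-- `√3 H N_×`. -/
def nCross : ℝ := B.n τ 1 2

/-- `μ Γ²`, where `Γ` is the Lorentz factor of the tilt along `e₁`. -/
noncomputable def boosted : ℝ := B.μ τ / (1 - B.v τ 0 ^ 2)

end Definitions

variable {B : BianchiModel} {τ₀ τ : ℝ}

/-- The purely spatial component of the vorticity condition is `n_{αβ} v^α v^β = 0`, and `n` is
definite on the plane of `e₂`, `e₃`. -/
lemma tilt_eq_zero (hB : B.IsRadiationVII0 τ₀) (ht : τ > τ₀) : B.v τ 1 = 0 ∧ B.v τ 2 = 0 := by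
  have h := hB.irrotational τ ht (0 : Fin 3).succ (1 : Fin 3).succ (2 : Fin 3).succ
  have hs : 0 < √(1 - ∑ α, B.v τ α ^ 2) := Real.sqrt_pos.2 (by linarith [hB.v_lt_one τ ht])
  have hc : ∀ a b : Fin 3,
      B.covU τ a.succ b.succ = -∑ c, B.conn τ c a.succ b.succ * B.u τ c := by
    intro a b
    simp [covU, frameDeriv]
  simp only [hc, Fin.sum_univ_four, conn_eq hB ht] at h
  have hu1 : B.u τ 1 = B.v τ 0 / √(1 - ∑ α, B.v τ α ^ 2) := rfl
  have hu2 : B.u τ 2 = B.v τ 1 / √(1 - ∑ α, B.v τ α ^ 2) := rfl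
  have hu3 : B.u τ 3 = B.v τ 2 / √(1 - ∑ α, B.v τ α ^ 2) := rfl
  simp [connTable, hu1, hu2, hu3] at h
  generalize √(1 - ∑ α, B.v τ α ^ 2) = q at *
  field_simp at h
  refine eq_zero_of_quadratic_form_eq_zero (hB.typeVII τ ht) ?_
  linear_combination -h / 2

lemma sum_tilt_sq (hB : B.IsRadiationVII0 τ₀) (ht : τ > τ₀) :
    ∑ α, B.v τ α ^ 2 = B.v τ 0 ^ 2 := by
  obtain ⟨h1, h2⟩ := tilt_eq_zero hB ht
  simp [Fin.sum_univ_three, h1, h2]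

lemma tilt_sq_lt_one (hB : B.IsRadiationVII0 τ₀) (ht : τ > τ₀) : B.v τ 0 ^ 2 < 1 := by
  rw [← sum_tilt_sq hB ht]
  exact hB.v_lt_one τ ht

lemma stress_eq (hB : B.IsRadiationVII0 τ₀) (ht : τ > τ₀) :
    B.stress τ 0 0 = B.boosted τ * (3 + B.v τ 0 ^ 2) / 3 ∧
    B.stress τ 0 1 = -(4 / 3 * B.boosted τ * B.v τ 0) ∧
    B.stress τ 0 2 = 0 ∧ B.stress τ 0 3 = 0 ∧
    B.stress τ 1 1 = B.boosted τ * (1 + 3 * B.v τ 0 ^ 2) / 3 ∧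
    B.stress τ 2 2 = B.boosted τ * (1 - B.v τ 0 ^ 2) / 3 ∧
    B.stress τ 3 3 = B.boosted τ * (1 - B.v τ 0 ^ 2) / 3 ∧
    B.stress τ 2 3 = 0 := by
  obtain ⟨hv1, hv2⟩ := tilt_eq_zero hB ht
  have hlt := tilt_sq_lt_one hB ht
  have hpos : 0 < 1 - B.v τ 0 ^ 2 := by linarith
  have hq0 : 0 < √(1 - B.v τ 0 ^ 2) := Real.sqrt_pos.2 hpos
  have hq : √(1 - B.v τ 0 ^ 2) ^ 2 = 1 - B.v τ 0 ^ 2 := Real.sq_sqrt hpos.le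
  have hu0 : B.u τ 0 = -1 / √(1 - B.v τ 0 ^ 2) := by rw [← sum_tilt_sq hB ht]; rfl
  have hu1 : B.u τ 1 = B.v τ 0 / √(1 - B.v τ 0 ^ 2) := by rw [← sum_tilt_sq hB ht]; rfl
  have hu2 : B.u τ 2 = 0 := by
    change B.v τ 1 / _ = 0
    rw [hv1, zero_div]
  have hu3 : B.u τ 3 = 0 := by
    change B.v τ 2 / _ = 0
    rw [hv2, zero_div]
  have s1 : sgn 1 = 1 := rfl
  have s2 : sgn 2 = 1 := rfl
  have s3 : sgn 3 = 1 := rfl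
  have hu00 : B.u τ 0 * B.u τ 0 = 1 / (1 - B.v τ 0 ^ 2) := by
    rw [hu0, div_mul_div_comm, ← sq, ← sq, hq]; norm_num
  have hu01 : B.u τ 0 * B.u τ 1 = -B.v τ 0 / (1 - B.v τ 0 ^ 2) := by
    rw [hu0, hu1, div_mul_div_comm, ← sq, hq, neg_one_mul]
  have hu11 : B.u τ 1 * B.u τ 1 = B.v τ 0 ^ 2 / (1 - B.v τ 0 ^ 2) := by
    rw [hu1, div_mul_div_comm, ← sq, ← sq, hq]
  simp only [stress, mul_assoc, hu00, hu01, hu11]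
  simp [g, hu2, hu3, boosted, s1, s2, s3]
  refine ⟨?_, ?_, ?_, ?_⟩ <;> field_simp <;> ring

lemma scalar_eq_zero (hB : B.IsRadiationVII0 τ₀) (ht : τ > τ₀) : B.scalar τ = 0 := by
  obtain ⟨h00, -, -, -, h11, h22, h33, -⟩ := stress_eq hB ht
  have e0 := hB.einstein τ ht 0 0
  have e1 := hB.einstein τ ht 1 1
  have e2 := hB.einstein τ ht 2 2
  have e3 := hB.einstein τ ht 3 3
  have s1 : sgn 1 = 1 := rfl
  have s2 : sgn 2 = 1 := rfl
  have s3 : sgn 3 = 1 := rfl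
  have hs : B.scalar τ = -B.ricci τ 0 0 + B.ricci τ 1 1 + B.ricci τ 2 2 + B.ricci τ 3 3 := by
    simp [scalar, Fin.sum_univ_four, s1, s2, s3]
  rw [h00] at e0
  rw [h11] at e1
  rw [h22] at e2
  rw [h33] at e3
  simp only [g, if_pos, sgn_zero, s1, s2, s3] at e0 e1 e2 e3
  linarith

lemma ricci_eq_stress (hB : B.IsRadiationVII0 τ₀) (ht : τ > τ₀) (a b : Fin 4) :
    B.ricci τ a b = B.stress τ a b := by
  rw [← hB.einstein τ ht a b, scalar_eq_zero hB ht]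
  ring

/-- There is no momentum along `e₂`, `e₃`, so the Codazzi equations say that the invertible block of
`n` annihilates `(σ₁₂, σ₁₃)`. -/
lemma shear_eq_zero (hB : B.IsRadiationVII0 τ₀) (ht : τ > τ₀) :
    B.σ τ 0 1 = 0 ∧ B.σ τ 0 2 = 0 := by
  obtain ⟨-, -, h02, h03, -⟩ := stress_eq hB ht
  have h2 := ricci_eq_stress hB ht 0 2
  have h3 := ricci_eq_stress hB ht 0 3
  rw [h02] at h2
  rw [h03] at h3
  simp [ricci, riem_eq hB ht, conn_eq hB ht, riemTable, connTable, connDeriv,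
    Fin.sum_univ_four] at h2 h3
  refine eq_zero_of_det_pos (hB.typeVII τ ht) ?_ ?_
  · linear_combination h3
  · linear_combination -h2

/-- The Jacobi identity for `e₀, e₂, e₃` expresses that the frame keeps `e₁` in the kernel of `n`:
the block of `n` annihilates `(Ω₃, -Ω₂)`. -/
lemma spin_eq_zero (hB : B.IsRadiationVII0 τ₀) (ht : τ > τ₀) :
    B.ω τ 1 = 0 ∧ B.ω τ 2 = 0 := by
  obtain ⟨hy, hz⟩ := shear_eq_zero hB ht
  have h2 := jacobi_spatial hB ht 1 2 2
  have h3 := jacobi_spatial hB ht 1 2 3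
  simp [Fin.sum_univ_four, conn_eq hB ht, connTable, connDeriv, hy, hz] at h2 h3
  have := eq_zero_of_det_pos (p := B.ω τ 2) (q := -B.ω τ 1) (hB.typeVII τ ht)
    (by linear_combination h2) (by linear_combination h3)
  exact ⟨by linarith [this.2], this.1⟩

/-- In an irrotational model the connection takes its block form. -/
lemma conn_eq_block (hB : B.IsRadiationVII0 τ₀) (ht : τ > τ₀) :
    B.conn τ = connTable (B.H τ) (B.sPlus τ) (B.sMinus τ) (B.sCross τ) 0 0 (B.nPlus τ)
      (B.nMinus τ) (B.nCross τ) (B.ω τ 0) 0 0 := by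
  obtain ⟨hy, hz⟩ := shear_eq_zero hB ht
  obtain ⟨h1, h2⟩ := spin_eq_zero hB ht
  rw [conn_eq hB ht, hy, hz, h1, h2]
  rfl

lemma connDeriv_eq_block (hB : B.IsRadiationVII0 τ₀) (ht : τ > τ₀) :
    B.connDeriv τ = connTable (B.H τ * deriv B.H τ) (B.H τ * deriv B.sPlus τ)
      (B.H τ * deriv B.sMinus τ) (B.H τ * deriv B.sCross τ) 0 0 (B.H τ * deriv B.nPlus τ)
      (B.H τ * deriv B.nMinus τ) (B.H τ * deriv B.nCross τ) 0 0 0 := by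
  have hy : deriv (fun r => B.σ r 0 1) τ = 0 := by
    have : (fun r => B.σ r 0 1) =ᶠ[𝓝 τ] fun _ => 0 := by
      filter_upwards [eventually_gt_nhds ht] with r hr using (shear_eq_zero hB hr).1
    simpa using this.deriv_eq
  have hz : deriv (fun r => B.σ r 0 2) τ = 0 := by
    have : (fun r => B.σ r 0 2) =ᶠ[𝓝 τ] fun _ => 0 := by
      filter_upwards [eventually_gt_nhds ht] with r hr using (shear_eq_zero hB hr).2
    simpa using this.deriv_eq
  rw [connDeriv, hy, hz, mul_zero]
  rfl

lemma ricci_block (hB : B.IsRadiationVII0 τ₀) (ht : τ > τ₀) :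
    B.ricci τ 0 0 = -3 * B.H τ ^ 2 - 3 * (B.H τ * deriv B.H τ) - 2 * B.sMinus τ ^ 2 -
      2 * B.sCross τ ^ 2 - 6 * B.sPlus τ ^ 2 ∧
    B.ricci τ 0 1 = -2 * B.nMinus τ * B.sCross τ + 2 * B.nCross τ * B.sMinus τ ∧
    B.ricci τ 1 1 = 3 * B.H τ ^ 2 - 6 * B.H τ * B.sPlus τ + B.H τ * deriv B.H τ -
      2 * B.nMinus τ ^ 2 - 2 * B.nCross τ ^ 2 - 2 * (B.H τ * deriv B.sPlus τ) ∧
    B.ricci τ 2 2 = 3 * B.H τ ^ 2 + 3 * B.H τ * B.sMinus τ + 3 * B.H τ * B.sPlus τ +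
      B.H τ * deriv B.H τ + 2 * B.nMinus τ * B.nPlus τ + B.H τ * deriv B.sMinus τ +
      2 * B.sCross τ * B.ω τ 0 + B.H τ * deriv B.sPlus τ ∧
    B.ricci τ 3 3 = 3 * B.H τ ^ 2 - 3 * B.H τ * B.sMinus τ + 3 * B.H τ * B.sPlus τ +
      B.H τ * deriv B.H τ - 2 * B.nMinus τ * B.nPlus τ - B.H τ * deriv B.sMinus τ -
      2 * B.sCross τ * B.ω τ 0 + B.H τ * deriv B.sPlus τ ∧
    B.ricci τ 2 3 = 3 * B.H τ * B.sCross τ + 2 * B.nCross τ * B.nPlus τ -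
      2 * B.sMinus τ * B.ω τ 0 + B.H τ * deriv B.sCross τ := by
  simp only [ricci, riem_eq hB ht, conn_eq_block hB ht, connDeriv_eq_block hB ht]
  generalize B.H τ * deriv B.H τ = dH
  generalize B.H τ * deriv B.sPlus τ = dx
  generalize B.H τ * deriv B.sMinus τ = ds
  generalize B.H τ * deriv B.sCross τ = dt
  generalize B.H τ * deriv B.nPlus τ = dp
  generalize B.H τ * deriv B.nMinus τ = dk
  generalize B.H τ * deriv B.nCross τ = dl
  refine ⟨?_, ?_, ?_, ?_, ?_, ?_⟩ <;>
    simp [riemTable, connTable, Fin.sum_univ_four] <;> ring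

/-- The Gauss and Codazzi constraints and the evolution equations, in clock time. -/
lemma field_equations (hB : B.IsRadiationVII0 τ₀) (ht : τ > τ₀) :
    3 * B.H τ ^ 2 = B.boosted τ * (3 + B.v τ 0 ^ 2) / 3 + B.nMinus τ ^ 2 + B.nCross τ ^ 2 +
      B.sMinus τ ^ 2 + B.sCross τ ^ 2 + 3 * B.sPlus τ ^ 2 ∧
    B.sCross τ * B.nMinus τ - B.sMinus τ * B.nCross τ = 2 / 3 * B.boosted τ * B.v τ 0 ∧
    B.H τ * deriv B.H τ = -2 * B.H τ ^ 2 - (B.sMinus τ ^ 2 + B.sCross τ ^ 2 +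
      3 * B.sPlus τ ^ 2 - B.nMinus τ ^ 2 - B.nCross τ ^ 2) / 3 ∧
    B.H τ * deriv B.sPlus τ = -3 * B.H τ * B.sPlus τ -
      2 / 3 * (B.nMinus τ ^ 2 + B.nCross τ ^ 2) - 4 / 9 * B.boosted τ * B.v τ 0 ^ 2 ∧
    B.H τ * deriv B.sMinus τ = -3 * B.H τ * B.sMinus τ - 2 * B.nMinus τ * B.nPlus τ -
      2 * B.sCross τ * B.ω τ 0 ∧
    B.H τ * deriv B.sCross τ = -3 * B.H τ * B.sCross τ - 2 * B.nCross τ * B.nPlus τ +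
      2 * B.sMinus τ * B.ω τ 0 := by
  obtain ⟨r00, r01, r11, r22, r33, r23⟩ := ricci_block hB ht
  obtain ⟨s00, s01, -, -, s11, s22, s33, s23⟩ := stress_eq hB ht
  rw [ricci_eq_stress hB ht, s00] at r00
  rw [ricci_eq_stress hB ht, s01] at r01
  rw [ricci_eq_stress hB ht, s11] at r11
  rw [ricci_eq_stress hB ht, s22] at r22
  rw [ricci_eq_stress hB ht, s33] at r33
  rw [ricci_eq_stress hB ht, s23] at r23
  refine ⟨?_, ?_, ?_, ?_, ?_, ?_⟩ <;> linarith

lemma jacobi_equations (hB : B.IsRadiationVII0 τ₀) (ht : τ > τ₀) :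
    B.H τ * deriv B.nPlus τ = -B.H τ * B.nPlus τ + 2 * B.nPlus τ * B.sPlus τ +
      2 * (B.nMinus τ * B.sMinus τ + B.nCross τ * B.sCross τ) ∧
    B.H τ * deriv B.nMinus τ = -B.H τ * B.nMinus τ + 2 * B.nMinus τ * B.sPlus τ +
      2 * B.nPlus τ * B.sMinus τ - 2 * B.nCross τ * B.ω τ 0 ∧
    B.H τ * deriv B.nCross τ = -B.H τ * B.nCross τ + 2 * B.nCross τ * B.sPlus τ +
      2 * B.nPlus τ * B.sCross τ + 2 * B.nMinus τ * B.ω τ 0 := by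
  have h1 := jacobi_spatial hB ht 0 1 3
  have h2 := jacobi_spatial hB ht 0 1 2
  have h3 := jacobi_spatial hB ht 2 0 2
  simp [Fin.sum_univ_four, conn_eq_block hB ht, connDeriv_eq_block hB ht, connTable] at h1 h2 h3
  refine ⟨?_, ?_, ?_⟩ <;> linarith

/-! ### Hubble-normalized evolution equations. -/

section Normalized

variable (B)

/-- `Σ₊`. -/
noncomputable def iX (τ : ℝ) : ℝ := B.sPlus τ / B.H τ

/-- `𝓡₁`. -/
noncomputable def iR (τ : ℝ) : ℝ :=
  (B.sMinus τ ^ 2 + B.sCross τ ^ 2 + B.nMinus τ ^ 2 + B.nCross τ ^ 2) / (3 * B.H τ ^ 2)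

/-- `Σ₋² + Σ_×² - N₋² - N_×²`. -/
noncomputable def iA (τ : ℝ) : ℝ :=
  (B.sMinus τ ^ 2 + B.sCross τ ^ 2 - B.nMinus τ ^ 2 - B.nCross τ ^ 2) / (3 * B.H τ ^ 2)

/-- `2 (Σ₋ N₋ + Σ_× N_×)`. -/
noncomputable def iC (τ : ℝ) : ℝ :=
  2 * (B.sMinus τ * B.nMinus τ + B.sCross τ * B.nCross τ) / (3 * B.H τ ^ 2)

/-- `Σ_× N₋ - Σ₋ N_×`. -/
noncomputable def iW (τ : ℝ) : ℝ :=
  (B.sCross τ * B.nMinus τ - B.sMinus τ * B.nCross τ) / (3 * B.H τ ^ 2)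

/-- `N₊`. -/
noncomputable def iN (τ : ℝ) : ℝ := B.nPlus τ / B.H τ

end Normalized

lemma hasDerivAt_div_H (hB : B.IsRadiationVII0 τ₀) (ht : τ > τ₀) {f : ℝ → ℝ}
    (hf : DifferentiableAt ℝ f τ) :
    HasDerivAt (fun r => f r / B.H r) (B.H τ * deriv f τ / B.H τ ^ 2 +
      (2 + B.iX τ ^ 2 + B.iA τ) * (f τ / B.H τ)) τ := by
  have hH := (hB.H_pos τ ht).ne'
  obtain ⟨-, -, h, -⟩ := field_equations hB ht
  have h' : deriv B.H τ = -(2 + B.iX τ ^ 2 + B.iA τ) * B.H τ := by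
    apply mul_left_cancel₀ hH
    rw [h, iX, iA]
    field_simp
    ring
  refine (hf.hasDerivAt.fun_div (hB.H_diff τ ht).hasDerivAt hH).congr_deriv ?_
  rw [h']
  field_simp
  ring

lemma hasDerivAt_div_H_sq (hB : B.IsRadiationVII0 τ₀) (ht : τ > τ₀) {f : ℝ → ℝ} {f' : ℝ}
    (hf : HasDerivAt f f' τ) :
    HasDerivAt (fun r => f r / (3 * B.H r ^ 2)) (f' / (3 * B.H τ ^ 2) +
      2 * (2 + B.iX τ ^ 2 + B.iA τ) * (f τ / (3 * B.H τ ^ 2))) τ := by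
  have hH := (hB.H_pos τ ht).ne'
  obtain ⟨-, -, h, -⟩ := field_equations hB ht
  have h' : deriv B.H τ = -(2 + B.iX τ ^ 2 + B.iA τ) * B.H τ := by
    apply mul_left_cancel₀ hH
    rw [h, iX, iA]
    field_simp
    ring
  refine (hf.fun_div (((hB.H_diff τ ht).hasDerivAt.fun_pow 2).const_mul 3)
    (by positivity)).congr_deriv ?_
  rw [h']
  field_simp
  ring

lemma differentiableAt_variables (hB : B.IsRadiationVII0 τ₀) (ht : τ > τ₀) :
    DifferentiableAt ℝ B.sPlus τ ∧ DifferentiableAt ℝ B.sMinus τ ∧ DifferentiableAt ℝ B.sCross τ ∧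
    DifferentiableAt ℝ B.nPlus τ ∧ DifferentiableAt ℝ B.nMinus τ ∧
    DifferentiableAt ℝ B.nCross τ := by
  have hσ := fun i j => (hB.σ_diff τ ht i j)
  have hn := fun i j => (hB.n_diff τ ht i j)
  exact ⟨((hσ 1 1).fun_add (hσ 2 2)).div_const 2, ((hσ 1 1).fun_sub (hσ 2 2)).div_const 2, hσ 1 2,
    ((hn 1 1).fun_add (hn 2 2)).div_const 2, ((hn 1 1).fun_sub (hn 2 2)).div_const 2, hn 1 2⟩

/-- The derivatives of the variables rotated by a change of frame. -/
lemma hasDerivAt_variables (hB : B.IsRadiationVII0 τ₀) (ht : τ > τ₀) :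
    HasDerivAt B.sMinus ((-3 * B.H τ * B.sMinus τ - 2 * B.nMinus τ * B.nPlus τ -
      2 * B.sCross τ * B.ω τ 0) / B.H τ) τ ∧
    HasDerivAt B.sCross ((-3 * B.H τ * B.sCross τ - 2 * B.nCross τ * B.nPlus τ +
      2 * B.sMinus τ * B.ω τ 0) / B.H τ) τ ∧
    HasDerivAt B.nMinus ((-B.H τ * B.nMinus τ + 2 * B.nMinus τ * B.sPlus τ +
      2 * B.nPlus τ * B.sMinus τ - 2 * B.nCross τ * B.ω τ 0) / B.H τ) τ ∧
    HasDerivAt B.nCross ((-B.H τ * B.nCross τ + 2 * B.nCross τ * B.sPlus τ +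
      2 * B.nPlus τ * B.sCross τ + 2 * B.nMinus τ * B.ω τ 0) / B.H τ) τ := by
  have hH := (hB.H_pos τ ht).ne'
  obtain ⟨-, -, -, -, h1, h2⟩ := field_equations hB ht
  obtain ⟨-, h3, h4⟩ := jacobi_equations hB ht
  obtain ⟨-, d1, d2, -, d3, d4⟩ := differentiableAt_variables hB ht
  refine ⟨d1.hasDerivAt.congr_deriv ?_, d2.hasDerivAt.congr_deriv ?_, d3.hasDerivAt.congr_deriv ?_,
    d4.hasDerivAt.congr_deriv ?_⟩ <;> rw [eq_div_iff hH, mul_comm] <;> assumption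

lemma Om_eq (hB : B.IsRadiationVII0 τ₀) (ht : τ > τ₀) :
    B.Ω τ = 1 - B.iX τ ^ 2 - B.iR τ := by
  have hH := (hB.H_pos τ ht).ne'
  obtain ⟨h, -⟩ := field_equations hB ht
  obtain ⟨s00, -⟩ := stress_eq hB ht
  rw [Ω, s00, iX, iR]
  field_simp
  linear_combination -3 * h

lemma hasDerivAt_iX (hB : B.IsRadiationVII0 τ₀) (ht : τ > τ₀) :
    HasDerivAt B.iX ((B.iX τ ^ 2 + B.iA τ - 1) * B.iX τ - (B.iR τ - B.iA τ) -
      4 * B.v τ 0 ^ 2 * (1 - B.iX τ ^ 2 - B.iR τ) / (3 + B.v τ 0 ^ 2)) τ := by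
  have hH := (hB.H_pos τ ht).ne'
  obtain ⟨-, -, -, h, -⟩ := field_equations hB ht
  obtain ⟨s00, -⟩ := stress_eq hB ht
  refine (hasDerivAt_div_H hB ht (differentiableAt_variables hB ht).1).congr_deriv ?_
  have h3 : 3 + B.v τ 0 ^ 2 ≠ 0 := by positivity
  rw [h, ← Om_eq hB ht, Ω, s00]
  simp only [iX, iR, iA]
  field_simp
  ring

lemma hasDerivAt_iN (hB : B.IsRadiationVII0 τ₀) (ht : τ > τ₀) :
    HasDerivAt B.iN (((1 + B.iX τ) ^ 2 + B.iA τ) * B.iN τ + 3 * B.iC τ) τ := by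
  have hH := (hB.H_pos τ ht).ne'
  obtain ⟨h, -⟩ := jacobi_equations hB ht
  refine (hasDerivAt_div_H hB ht (differentiableAt_variables hB ht).2.2.2.1).congr_deriv ?_
  rw [h]
  simp only [iX, iA, iC, iN]
  field_simp
  ring

/-- The angular velocity about `e₁` rotates `(σ₋, σ_×)` and `(n₋, n_×)` by the same angle, so it
drops out here and from the other inner and cross products. -/
lemma hasDerivAt_iR (hB : B.IsRadiationVII0 τ₀) (ht : τ > τ₀) :
    HasDerivAt B.iR
      (2 * (B.iX τ ^ 2 + B.iA τ + B.iX τ) * B.iR τ - 2 * (1 + B.iX τ) * B.iA τ) τ := by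
  have hH := (hB.H_pos τ ht).ne'
  obtain ⟨d1, d2, d3, d4⟩ := hasDerivAt_variables hB ht
  refine (hasDerivAt_div_H_sq hB ht ((((d1.fun_pow 2).fun_add (d2.fun_pow 2)).fun_add
    (d3.fun_pow 2)).fun_add (d4.fun_pow 2))).congr_deriv ?_
  simp only [iX, iA, iR, Nat.cast_ofNat, Nat.add_one_sub_one, pow_one]
  field_simp
  ring

lemma hasDerivAt_iA (hB : B.IsRadiationVII0 τ₀) (ht : τ > τ₀) :
    HasDerivAt B.iA (2 * (B.iX τ ^ 2 + B.iA τ + B.iX τ) * B.iA τ -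
      2 * (1 + B.iX τ) * B.iR τ - 4 * B.iN τ * B.iC τ) τ := by
  have hH := (hB.H_pos τ ht).ne'
  obtain ⟨d1, d2, d3, d4⟩ := hasDerivAt_variables hB ht
  refine (hasDerivAt_div_H_sq hB ht ((((d1.fun_pow 2).fun_add (d2.fun_pow 2)).fun_sub
    (d3.fun_pow 2)).fun_sub (d4.fun_pow 2))).congr_deriv ?_
  simp only [iX, iA, iR, iC, iN, Nat.cast_ofNat, Nat.add_one_sub_one, pow_one]
  field_simp
  ring

lemma hasDerivAt_iC (hB : B.IsRadiationVII0 τ₀) (ht : τ > τ₀) :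
    HasDerivAt B.iC
      (2 * (B.iX τ ^ 2 + B.iA τ + B.iX τ) * B.iC τ + 4 * B.iN τ * B.iA τ) τ := by
  have hH := (hB.H_pos τ ht).ne'
  obtain ⟨d1, d2, d3, d4⟩ := hasDerivAt_variables hB ht
  refine (hasDerivAt_div_H_sq hB ht (((d1.fun_mul d3).fun_add
    (d2.fun_mul d4)).const_mul 2)).congr_deriv ?_
  simp only [iX, iA, iC, iN]
  field_simp
  ring

lemma hasDerivAt_iW (hB : B.IsRadiationVII0 τ₀) (ht : τ > τ₀) :
    HasDerivAt B.iW (2 * (B.iX τ ^ 2 + B.iA τ + B.iX τ) * B.iW τ) τ := by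
  have hH := (hB.H_pos τ ht).ne'
  obtain ⟨d1, d2, d3, d4⟩ := hasDerivAt_variables hB ht
  refine (hasDerivAt_div_H_sq hB ht ((d2.fun_mul d3).fun_sub (d1.fun_mul d4))).congr_deriv ?_
  simp only [iX, iA, iW]
  field_simp
  ring

lemma iW_eq (hB : B.IsRadiationVII0 τ₀) (ht : τ > τ₀) :
    B.iW τ = 2 * B.v τ 0 * (1 - B.iX τ ^ 2 - B.iR τ) / (3 + B.v τ 0 ^ 2) := by
  have hH := (hB.H_pos τ ht).ne'
  have h3 : 3 + B.v τ 0 ^ 2 ≠ 0 := by positivity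
  obtain ⟨-, h, -⟩ := field_equations hB ht
  obtain ⟨s00, -⟩ := stress_eq hB ht
  rw [iW, h, ← Om_eq hB ht, Ω, s00]
  field_simp

/-- Obtained by differentiating the Codazzi relation `X(3 + v²) = 2vΩ` instead of using the
conservation law of the fluid. The coefficient of `v'` is non-zero because `Ω > 0` and `v² < 3`. -/
lemma hasDerivAt_tilt (hB : B.IsRadiationVII0 τ₀) (ht : τ > τ₀) (hΩ : 0 < B.Ω τ) :
    HasDerivAt (fun r => B.v r 0)
      (6 * B.iX τ * B.v τ 0 * (1 - B.v τ 0 ^ 2) / (3 - B.v τ 0 ^ 2)) τ := by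
  have hv := (hB.v_diff τ ht 0).hasDerivAt
  refine hv.congr_deriv ?_
  have hlt := tilt_sq_lt_one hB ht
  have h3 : 0 < 3 + B.v τ 0 ^ 2 := by positivity
  have h3' : 0 < 3 - B.v τ 0 ^ 2 := by linarith
  have d1 := (hasDerivAt_iW hB ht).fun_mul ((hv.fun_pow 2).const_add 3)
  have d2 := (hv.const_mul 2).fun_mul
    ((((hasDerivAt_iX hB ht).fun_pow 2).const_sub 1).fun_sub (hasDerivAt_iR hB ht))
  have he : (fun r => B.iW r * (3 + B.v r 0 ^ 2)) =ᶠ[𝓝 τ]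
      fun r => 2 * B.v r 0 * (1 - B.iX r ^ 2 - B.iR r) := by
    filter_upwards [eventually_gt_nhds ht] with r hr
    have : 3 + B.v r 0 ^ 2 ≠ 0 := by positivity
    rw [iW_eq hB hr, div_mul_cancel₀ _ this]
  have heq := d1.unique (d2.congr_of_eventuallyEq he)
  rw [Om_eq hB ht] at hΩ
  rw [iW_eq hB ht] at heq
  simp only [Nat.cast_ofNat, Nat.add_one_sub_one, pow_one] at heq
  generalize deriv (fun r => B.v r 0) τ = v' at *
  rw [eq_div_iff h3'.ne']
  apply mul_left_cancel₀ hΩ.ne'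
  field_simp at heq
  linear_combination -heq

lemma det_pos (hB : B.IsRadiationVII0 τ₀) (ht : τ > τ₀) :
    0 < B.iN τ ^ 2 - 3 / 2 * (B.iR τ - B.iA τ) := by
  have hH := hB.H_pos τ ht
  have h := hB.typeVII τ ht
  have : B.iN τ ^ 2 - 3 / 2 * (B.iR τ - B.iA τ) =
      (B.n τ 1 1 * B.n τ 2 2 - B.n τ 1 2 ^ 2) / B.H τ ^ 2 := by
    simp only [iN, iR, iA, nPlus, nMinus, nCross]
    field_simp
    ring
  rw [this]
  positivity

lemma iR_nonneg (τ : ℝ) : 0 ≤ B.iR τ := by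
  unfold iR; positivity

lemma iR_sub_iA_nonneg (τ : ℝ) : 0 ≤ B.iR τ - B.iA τ := by
  have : B.iR τ - B.iA τ = 2 * (B.nMinus τ ^ 2 + B.nCross τ ^ 2) / (3 * B.H τ ^ 2) := by
    unfold iR iA; ring
  rw [this]
  positivity

lemma iN_ne_zero (hB : B.IsRadiationVII0 τ₀) (ht : τ > τ₀) : B.iN τ ≠ 0 := by
  have h1 := det_pos hB ht
  have h2 := B.iR_sub_iA_nonneg τ
  intro h
  rw [h] at h1
  linarith

/-- Lagrange's identity for the plane vectors `(Σ₋, Σ_×)` and `(N₋, N_×)`. -/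
lemma iR_sq (hB : B.IsRadiationVII0 τ₀) (ht : τ > τ₀) :
    B.iR τ ^ 2 = B.iA τ ^ 2 + B.iC τ ^ 2 + 4 * B.iW τ ^ 2 := by
  have hH := (hB.H_pos τ ht).ne'
  simp only [iR, iA, iC, iW]
  field_simp
  ring

/-- `N₊` has a constant sign. -/
lemma exists_sign (hB : B.IsRadiationVII0 τ₀) :
    ∃ ε : ℝ, (ε = 1 ∨ ε = -1) ∧ ∀ τ > τ₀, 0 < ε * B.iN τ := by
  have hc : ContinuousOn B.iN (Set.Ioi τ₀) := fun τ ht =>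
    (hasDerivAt_iN hB ht).continuousAt.continuousWithinAt
  by_cases h : ∃ a > τ₀, 0 < B.iN a
  · obtain ⟨a, ha, hpos⟩ := h
    refine ⟨1, Or.inl rfl, fun b hb => ?_⟩
    by_contra hneg
    rw [one_mul, not_lt] at hneg
    obtain ⟨c, hc, h0⟩ := isPreconnected_Ioi.intermediate_value (Set.mem_Ioi.2 hb)
      (Set.mem_Ioi.2 ha) hc ⟨hneg, hpos.le⟩
    exact iN_ne_zero hB hc h0
  · push Not at h
    refine ⟨-1, Or.inr rfl, fun b hb => ?_⟩
    have := lt_of_le_of_ne (h b hb) (iN_ne_zero hB hb)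
    linarith

/-- The invariant flow of a model, with the orientation chosen so that `N₊ > 0`. -/
noncomputable def flow (hB : B.IsRadiationVII0 τ₀) (hΩ : ∀ τ > τ₀, 0 < B.Ω τ)
    (hv : ∀ τ > τ₀, 0 < B.v τ 0) (ε : ℝ) (hε : ε = 1 ∨ ε = -1)
    (hN : ∀ τ > τ₀, 0 < ε * B.iN τ) : InvariantFlow τ₀ where
  x := B.iX
  R := B.iR
  A := B.iA
  -- Changing the signs of `N` and `C` together leaves all the equations invariant.
  C := fun τ => ε * B.iC τ
  X := B.iW
  N := fun τ => ε * B.iN τ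
  v := fun τ => B.v τ 0
  hx := fun _ ht => hasDerivAt_iX hB ht
  hR := fun _ ht => hasDerivAt_iR hB ht
  hA := fun _ ht => (hasDerivAt_iA hB ht).congr_deriv (by rcases hε with rfl | rfl <;> ring)
  hC := fun _ ht => ((hasDerivAt_iC hB ht).const_mul ε).congr_deriv (by ring)
  hX := fun _ ht => hasDerivAt_iW hB ht
  hN := fun _ ht => ((hasDerivAt_iN hB ht).const_mul ε).congr_deriv (by ring)
  hv := fun t ht => hasDerivAt_tilt hB ht (hΩ t ht)
  v_pos := hv
  v_lt := fun t ht => by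
    have := tilt_sq_lt_one hB ht
    nlinarith
  Om_pos := fun t ht => by rw [← Om_eq hB ht]; exact hΩ t ht
  X_eq := fun _ ht => iW_eq hB ht
  R_nonneg := fun _ _ => iR_nonneg _
  R_sq := fun _ ht => by
    rw [iR_sq hB ht]
    rcases hε with rfl | rfl <;> ring
  N_pos := hN
  det_pos := fun _ ht => by
    have := det_pos hB ht
    rcases hε with rfl | rfl <;> linarith

lemma sqrt_three_sq : √3 ^ 2 = (3 : ℝ) := Real.sq_sqrt (by norm_num)

lemma R1_eq (hB : B.IsRadiationVII0 τ₀) (ht : τ > τ₀) : B.R1 τ = B.iR τ := by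
  have hH := (hB.H_pos τ ht).ne'
  simp only [R1, Sm, Sx, Nm, Nx, Sh, N, iR, sMinus, sCross, nMinus, nCross, div_pow, mul_pow,
    sqrt_three_sq]
  field_simp

lemma polar_cos_eq (hB : B.IsRadiationVII0 τ₀) (ht : τ > τ₀) {R2 ψ : ℝ → ℝ}
    (h : B.IsPolar R2 ψ τ) : R2 τ * Real.cos (2 * ψ τ) = B.iA τ := by
  have hH := (hB.H_pos τ ht).ne'
  rw [h.1]
  simp only [Sm, Sx, Nm, Nx, Sh, N, iA, sMinus, sCross, nMinus, nCross, div_pow, mul_pow,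
    sqrt_three_sq]
  field_simp

lemma polar_sin_eq (hB : B.IsRadiationVII0 τ₀) (ht : τ > τ₀) {R2 ψ : ℝ → ℝ}
    (h : B.IsPolar R2 ψ τ) : R2 τ * Real.sin (2 * ψ τ) = B.iC τ := by
  have hH := (hB.H_pos τ ht).ne'
  have h3 : √3 ≠ 0 := by positivity
  rw [h.2]
  simp only [Sm, Sx, Nm, Nx, Sh, N, iC, sMinus, sCross, nMinus, nCross]
  field_simp
  rw [sqrt_three_sq]
  ring

lemma polar_radius_eq (hB : B.IsRadiationVII0 τ₀) (ht : τ > τ₀) {R2 ψ : ℝ → ℝ}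
    (h : B.IsPolar R2 ψ τ) (hpos : 0 < R2 τ) : R2 τ = √(B.iA τ ^ 2 + B.iC τ ^ 2) := by
  rw [← polar_cos_eq hB ht h, ← polar_sin_eq hB ht h, mul_pow, mul_pow, ← mul_add,
    Real.cos_sq_add_sin_sq, mul_one, Real.sqrt_sq hpos.le]

lemma Np_eq (τ : ℝ) : B.Np τ = B.iN τ := by
  simp only [Np, N, iN, nPlus]
  ring

lemma shear_sq (hB : B.IsRadiationVII0 τ₀) (ht : τ > τ₀) :
    B.shear τ = √(B.iX τ ^ 2 + (B.iR τ + B.iA τ) / 2) := by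
  have hH := (hB.H_pos τ ht).ne'
  have hs := fun i j => (hB.σ_symm τ ht).apply i j
  obtain ⟨h01, h02⟩ := shear_eq_zero hB ht
  have htr : B.σ τ 0 0 = -B.σ τ 1 1 - B.σ τ 2 2 := by
    have := hB.σ_trace τ ht
    rw [Matrix.trace_fin_three] at this
    linarith
  rw [shear]
  congr 1
  simp only [Fin.sum_univ_three, hs 0 1, hs 0 2, hs 1 2, h01, h02, htr, iX, iR, iA, sPlus, sMinus,
    sCross]
  field_simp
  ring

end BianchiModel

/-! ### The Weyl tensor and its two quadratic invariants. -/

namespace BianchiModel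

lemma sum_pairs_of_symm (f : Fin 4 → Fin 4 → ℝ) (h0 : ∀ a, f a a = 0)
    (hs : ∀ a b, f b a = f a b) :
    ∑ a, ∑ b, f a b = 2 * (f 0 1 + f 0 2 + f 0 3 + f 1 2 + f 1 3 + f 2 3) := by
  simp only [Fin.sum_univ_four, h0, hs 0 1, hs 0 2, hs 0 3, hs 1 2, hs 1 3, hs 2 3]
  ring

section Symmetries

variable (B : BianchiModel) (τ : ℝ)

lemma riem_swap_right (a b c d : Fin 4) : B.riem τ a b d c = -B.riem τ a b c d := by
  simp only [riem, B.comm_swap τ _ c d, neg_add, ← Finset.sum_neg_distrib]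
  congr 1
  · ring
  · exact Finset.sum_congr rfl fun f _ => by ring

/-- Metric compatibility makes the connection skew at every time, and this passes to derivatives and
to products. The antisymmetries suffice below: the pair symmetry is never invoked, since all 36
components are computed. -/
lemma riem_swap_left (a b c d : Fin 4) :
    sgn b * B.riem τ b a c d = -(sgn a * B.riem τ a b c d) := by
  have hconn : ∀ r (a b c : Fin 4), B.conn r b c a = -(sgn a * sgn b) * B.conn r a c b := by
    intro r a b c
    have h := B.conn_swap r a c b
    have := sgn_mul_self b
    linear_combination sgn b * h - B.conn r b c a * this
  have hfd : ∀ c d : Fin 4, B.frameDeriv c (fun r => B.conn r b d a) τ =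
      -(sgn a * sgn b) * B.frameDeriv c (fun r => B.conn r a d b) τ := by
    intro c d
    simp only [hconn _ a b d, frameDeriv]
    split_ifs
    · rw [deriv_const_mul_field]; ring
    · ring
  have hprod : ∀ c d f : Fin 4, B.conn τ f d a * B.conn τ b c f =
      (sgn a * sgn b) * (B.conn τ f c b * B.conn τ a d f) := by
    intro c d f
    rw [hconn τ f b c, hconn τ a f d]
    linear_combination
      (sgn a * sgn b * B.conn τ f c b * B.conn τ a d f) * sgn_mul_self f
  have ha := sgn_mul_self a
  have hb := sgn_mul_self b
  simp only [riem, hfd, hconn τ a b]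
  have hsum : ∑ f, (B.conn τ f d a * B.conn τ b c f - B.conn τ f c a * B.conn τ b d f -
      B.comm τ f c d * B.conn τ b f a) = -(sgn a * sgn b) * ∑ f, (B.conn τ f d b * B.conn τ a c f -
      B.conn τ f c b * B.conn τ a d f - B.comm τ f c d * B.conn τ a f b) := by
    rw [Finset.mul_sum]
    refine Finset.sum_congr rfl fun f _ => ?_
    rw [hprod, hprod, hconn τ a b f]
    ring
  simp only [hconn τ a b] at hsum
  rw [hsum]
  linear_combination (-sgn a * (B.frameDeriv c (fun r => B.conn r a d b) τ -
    B.frameDeriv d (fun r => B.conn r a c b) τ + ∑ f, (B.conn τ f d b * B.conn τ a c f -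
      B.conn τ f c b * B.conn τ a d f - B.comm τ f c d * B.conn τ a f b))) * hb

lemma g_symm (a b : Fin 4) : g a b = g b a := by
  unfold g
  split_ifs with h1 h2 h2
  · rw [h1]
  · exact absurd h1.symm h2
  · exact absurd h2.symm h1
  · rfl

lemma weyl_swap_right (a b c d : Fin 4) : B.weyl τ a b d c = -B.weyl τ a b c d := by
  simp only [weyl, B.riem_swap_right τ a b c d]
  ring

lemma weyl_swap_left (a b c d : Fin 4) : B.weyl τ b a c d = -B.weyl τ a b c d := by
  simp only [weyl, B.riem_swap_left τ a b c d]
  ring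

lemma weyl_diag_left (a c d : Fin 4) : B.weyl τ a a c d = 0 := by
  linarith [B.weyl_swap_left τ a a c d]

/-- The components of the dual Weyl tensor in terms of those of the Weyl tensor. -/
lemma weylDual_eq (c d : Fin 4) :
    B.weylDual τ 0 1 c d = -B.weyl τ 2 3 c d ∧ B.weylDual τ 0 2 c d = B.weyl τ 1 3 c d ∧
    B.weylDual τ 0 3 c d = -B.weyl τ 1 2 c d ∧ B.weylDual τ 1 2 c d = B.weyl τ 0 3 c d ∧
    B.weylDual τ 1 3 c d = -B.weyl τ 0 2 c d ∧ B.weylDual τ 2 3 c d = B.weyl τ 0 1 c d := by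
  have s1 : sgn 1 = 1 := rfl
  have s2 : sgn 2 = 1 := rfl
  have s3 : sgn 3 = 1 := rfl
  have h10 := B.weyl_swap_left τ 0 1 c d
  have h20 := B.weyl_swap_left τ 0 2 c d
  have h30 := B.weyl_swap_left τ 0 3 c d
  have h21 := B.weyl_swap_left τ 1 2 c d
  have h31 := B.weyl_swap_left τ 1 3 c d
  have h32 := B.weyl_swap_left τ 2 3 c d
  refine ⟨?_, ?_, ?_, ?_, ?_, ?_⟩ <;>
    simp [weylDual, Fin.sum_univ_four, eps4, weyl_diag_left, s1, s2, s3, h10, h20, h30, h21, h31,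
      h32] <;> ring

lemma weylDual_swap_right (a b c d : Fin 4) : B.weylDual τ a b d c = -B.weylDual τ a b c d := by
  simp only [weylDual, B.weyl_swap_right τ _ _ c d, mul_neg, Finset.sum_neg_distrib, neg_div]

lemma weylDual_swap_left (a b c d : Fin 4) : B.weylDual τ b a c d = -B.weylDual τ a b c d := by
  have : ∀ e f, eps4 b a e f = -eps4 a b e f := fun e f => by unfold eps4; ring
  simp only [weylDual, this, neg_mul, Finset.sum_neg_distrib, neg_div]

/-- A full contraction of two tensors with the antisymmetries of the Weyl tensor. -/
lemma sum_contract (T U : Fin 4 → Fin 4 → Fin 4 → Fin 4 → ℝ)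
    (hT : ∀ a b c d, T b a c d = -T a b c d) (hT' : ∀ a b c d, T a b d c = -T a b c d)
    (hU : ∀ a b c d, U b a c d = -U a b c d) (hU' : ∀ a b c d, U a b d c = -U a b c d) :
    let k := fun a b => T a b 0 1 * U a b 0 1 + T a b 0 2 * U a b 0 2 + T a b 0 3 * U a b 0 3 -
      T a b 1 2 * U a b 1 2 - T a b 1 3 * U a b 1 3 - T a b 2 3 * U a b 2 3
    ∑ a, ∑ b, ∑ c, ∑ d, sgn a * sgn b * sgn c * sgn d * T a b c d * U a b c d =
      4 * (k 0 1 + k 0 2 + k 0 3 - k 1 2 - k 1 3 - k 2 3) := by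
  intro k
  have s1 : sgn 1 = 1 := rfl
  have s2 : sgn 2 = 1 := rfl
  have s3 : sgn 3 = 1 := rfl
  have h0 : ∀ a c d, T a a c d = 0 := fun a c d => by linarith [hT a a c d]
  have h0' : ∀ a b c, T a b c c = 0 := fun a b c => by linarith [hT' a b c c]
  have inner : ∀ a b, ∑ c, ∑ d, sgn a * sgn b * sgn c * sgn d * T a b c d * U a b c d =
      -(2 * (sgn a * sgn b * k a b)) := by
    intro a b
    rw [sum_pairs_of_symm _ (fun c => by rw [h0']; ring)
      (fun c d => by rw [hT' a b c d, hU' a b c d]; ring)]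
    simp only [sgn_zero, s1, s2, s3, k]
    ring
  simp only [inner]
  rw [sum_pairs_of_symm _ (fun a => by simp [k, h0])
    (fun a b => by simp only [k, hT a b, hU a b]; ring)]
  simp only [sgn_zero, s1, s2, s3]
  ring

end Symmetries

variable {B : BianchiModel} {τ₀ τ : ℝ}

lemma ricci_off_diagonal (hB : B.IsRadiationVII0 τ₀) (ht : τ > τ₀) :
    B.ricci τ 0 2 = 0 ∧ B.ricci τ 0 3 = 0 ∧ B.ricci τ 1 2 = 0 ∧ B.ricci τ 1 3 = 0 := by
  obtain ⟨hv1, hv2⟩ := tilt_eq_zero hB ht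
  have hu2 : B.u τ 2 = 0 := by
    change B.v τ 1 / _ = 0
    rw [hv1, zero_div]
  have hu3 : B.u τ 3 = 0 := by
    change B.v τ 2 / _ = 0
    rw [hv2, zero_div]
  refine ⟨?_, ?_, ?_, ?_⟩ <;> simp [ricci_eq_stress hB ht, stress, hu2, hu3, g]

lemma ricci_symm (hB : B.IsRadiationVII0 τ₀) (ht : τ > τ₀) (a b : Fin 4) :
    B.ricci τ b a = B.ricci τ a b := by
  rw [ricci_eq_stress hB ht, ricci_eq_stress hB ht]
  simp only [stress, g_symm b a]
  ring

section Components

variable (B τ)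

/-- The electric component `E₁₁` of the Weyl tensor. -/
noncomputable def elec : ℝ := -2 * B.H τ * B.sPlus τ - 4 / 3 * (B.nMinus τ ^ 2 + B.nCross τ ^ 2) +
  2 / 3 * (B.sMinus τ ^ 2 + B.sCross τ ^ 2) - 2 * B.sPlus τ ^ 2 -
  4 / 9 * B.boosted τ * B.v τ 0 ^ 2

/-- The electric component `(E₂₂ - E₃₃) / 2`. -/
noncomputable def elecMinus : ℝ := (B.H τ - 2 * B.sPlus τ) * B.sMinus τ + 2 * B.nMinus τ * B.nPlus τ

/-- The electric component `E₂₃`. -/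
noncomputable def elecCross : ℝ := (B.H τ - 2 * B.sPlus τ) * B.sCross τ + 2 * B.nCross τ * B.nPlus τ

/-- The magnetic component along `e₁`. -/
noncomputable def magn : ℝ := -2 * (B.nMinus τ * B.sMinus τ + B.nCross τ * B.sCross τ)

/-- The difference of the diagonal magnetic components transverse to `e₁`. -/
noncomputable def magnMinus : ℝ := 3 * B.nMinus τ * B.sPlus τ + 2 * B.nPlus τ * B.sMinus τ

/-- The off-diagonal magnetic component transverse to `e₁`. -/
noncomputable def magnCross : ℝ := 3 * B.nCross τ * B.sPlus τ + 2 * B.nPlus τ * B.sCross τ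

end Components

lemma weyl_time_eq (hB : B.IsRadiationVII0 τ₀) (ht : τ > τ₀) :
    B.weyl τ 0 1 0 1 = B.elec τ ∧ B.weyl τ 0 1 0 2 = 0 ∧ B.weyl τ 0 1 0 3 = 0 ∧
    B.weyl τ 0 1 1 2 = 0 ∧ B.weyl τ 0 1 1 3 = 0 ∧ B.weyl τ 0 1 2 3 = B.magn τ ∧
    B.weyl τ 0 2 0 1 = 0 ∧ B.weyl τ 0 2 0 2 = -B.elec τ / 2 + B.elecMinus τ ∧
    B.weyl τ 0 2 0 3 = B.elecCross τ ∧ B.weyl τ 0 2 1 2 = B.magnCross τ ∧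
    B.weyl τ 0 2 1 3 = B.magn τ / 2 - B.magnMinus τ ∧ B.weyl τ 0 2 2 3 = 0 ∧
    B.weyl τ 0 3 0 1 = 0 ∧ B.weyl τ 0 3 0 2 = B.elecCross τ ∧
    B.weyl τ 0 3 0 3 = -B.elec τ / 2 - B.elecMinus τ ∧
    B.weyl τ 0 3 1 2 = -B.magn τ / 2 - B.magnMinus τ ∧ B.weyl τ 0 3 1 3 = -B.magnCross τ ∧
    B.weyl τ 0 3 2 3 = 0 := by
  obtain ⟨h02, h03, h12, h13⟩ := ricci_off_diagonal hB ht
  obtain ⟨f1, f2, f3, f4, f5, f6⟩ := field_equations hB ht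
  obtain ⟨j1, j2, j3⟩ := jacobi_equations hB ht
  obtain ⟨r00, r01, r11, r22, r33, r23⟩ := ricci_block hB ht
  have h10 := (ricci_symm hB ht 0 1).trans r01
  have h20 := (ricci_symm hB ht 0 2).trans h02
  have h30 := (ricci_symm hB ht 0 3).trans h03
  have h21 := (ricci_symm hB ht 1 2).trans h12
  have h31 := (ricci_symm hB ht 1 3).trans h13
  have h32 := (ricci_symm hB ht 2 3).trans r23
  have s1 : sgn 1 = 1 := rfl
  have s2 : sgn 2 = 1 := rfl
  have s3 : sgn 3 = 1 := rfl
  simp only [weyl, scalar_eq_zero hB ht, riem_eq hB ht, conn_eq_block hB ht,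
    connDeriv_eq_block hB ht, r00, r01, r11, r22, r33, r23, h02, h03, h12, h13, h10, h20, h30, h21,
    h31, h32]
  generalize B.H τ * deriv B.H τ = dH at *
  generalize B.H τ * deriv B.sPlus τ = dx at *
  generalize B.H τ * deriv B.sMinus τ = ds at *
  generalize B.H τ * deriv B.sCross τ = dt at *
  generalize B.H τ * deriv B.nPlus τ = dp at *
  generalize B.H τ * deriv B.nMinus τ = dk at *
  generalize B.H τ * deriv B.nCross τ = dl at *
  clear r00 r01 r11 r22 r33 r23 h02 h03 h12 h13 h10 h20 h30 h21 h31 h32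
  refine ⟨?_, ?_, ?_, ?_, ?_, ?_, ?_, ?_, ?_, ?_, ?_, ?_, ?_, ?_, ?_, ?_, ?_, ?_⟩ <;>
    simp [riemTable, connTable, Fin.sum_univ_four, g, s1, s2, s3, elec, elecMinus, elecCross, magn,
      magnMinus, magnCross] <;> linarith

lemma weyl_space_eq (hB : B.IsRadiationVII0 τ₀) (ht : τ > τ₀) :
    B.weyl τ 1 2 0 1 = 0 ∧ B.weyl τ 1 2 0 2 = B.magnCross τ ∧
    B.weyl τ 1 2 0 3 = -B.magn τ / 2 - B.magnMinus τ ∧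
    B.weyl τ 1 2 1 2 = B.elec τ / 2 + B.elecMinus τ ∧ B.weyl τ 1 2 1 3 = B.elecCross τ ∧
    B.weyl τ 1 2 2 3 = 0 ∧
    B.weyl τ 1 3 0 1 = 0 ∧ B.weyl τ 1 3 0 2 = B.magn τ / 2 - B.magnMinus τ ∧
    B.weyl τ 1 3 0 3 = -B.magnCross τ ∧ B.weyl τ 1 3 1 2 = B.elecCross τ ∧
    B.weyl τ 1 3 1 3 = B.elec τ / 2 - B.elecMinus τ ∧ B.weyl τ 1 3 2 3 = 0 ∧
    B.weyl τ 2 3 0 1 = B.magn τ ∧ B.weyl τ 2 3 0 2 = 0 ∧ B.weyl τ 2 3 0 3 = 0 ∧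
    B.weyl τ 2 3 1 2 = 0 ∧ B.weyl τ 2 3 1 3 = 0 ∧ B.weyl τ 2 3 2 3 = -B.elec τ := by
  obtain ⟨h02, h03, h12, h13⟩ := ricci_off_diagonal hB ht
  obtain ⟨f1, f2, f3, f4, f5, f6⟩ := field_equations hB ht
  obtain ⟨j1, j2, j3⟩ := jacobi_equations hB ht
  obtain ⟨r00, r01, r11, r22, r33, r23⟩ := ricci_block hB ht
  have h10 := (ricci_symm hB ht 0 1).trans r01
  have h20 := (ricci_symm hB ht 0 2).trans h02
  have h30 := (ricci_symm hB ht 0 3).trans h03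
  have h21 := (ricci_symm hB ht 1 2).trans h12
  have h31 := (ricci_symm hB ht 1 3).trans h13
  have h32 := (ricci_symm hB ht 2 3).trans r23
  have s1 : sgn 1 = 1 := rfl
  have s2 : sgn 2 = 1 := rfl
  have s3 : sgn 3 = 1 := rfl
  simp only [weyl, scalar_eq_zero hB ht, riem_eq hB ht, conn_eq_block hB ht,
    connDeriv_eq_block hB ht, r11, r22, r33, r23, h12, h13, h10, h20, h30, h21, h31, h32]
  generalize B.H τ * deriv B.H τ = dH at *
  generalize B.H τ * deriv B.sPlus τ = dx at *
  generalize B.H τ * deriv B.sMinus τ = ds at *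
  generalize B.H τ * deriv B.sCross τ = dt at *
  generalize B.H τ * deriv B.nPlus τ = dp at *
  generalize B.H τ * deriv B.nMinus τ = dk at *
  generalize B.H τ * deriv B.nCross τ = dl at *
  clear r00 r01 r11 r22 r33 r23 h02 h03 h12 h13 h10 h20 h30 h21 h31 h32
  refine ⟨?_, ?_, ?_, ?_, ?_, ?_, ?_, ?_, ?_, ?_, ?_, ?_, ?_, ?_, ?_, ?_, ?_, ?_⟩ <;>
    simp [riemTable, connTable, Fin.sum_univ_four, g, s1, s2, s3, elec, elecMinus, elecCross, magn,
      magnMinus, magnCross] <;> linarith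

lemma W1_eq (hB : B.IsRadiationVII0 τ₀) (ht : τ > τ₀) :
    B.W1 τ = (3 * B.elec τ ^ 2 + 4 * B.elecMinus τ ^ 2 + 4 * B.elecCross τ ^ 2 -
      3 * B.magn τ ^ 2 - 4 * B.magnMinus τ ^ 2 - 4 * B.magnCross τ ^ 2) / (12 * B.H τ ^ 4) := by
  have hH := (hB.H_pos τ ht).ne'
  obtain ⟨a1, a2, a3, a4, a5, a6, b1, b2, b3, b4, b5, b6, c1, c2, c3, c4, c5, c6⟩ :=
    weyl_time_eq hB ht
  obtain ⟨d1, d2, d3, d4, d5, d6, e1, e2, e3, e4, e5, e6, f1, f2, f3, f4, f5, f6⟩ :=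
    weyl_space_eq hB ht
  rw [W1, sum_contract (B.weyl τ) (B.weyl τ) (B.weyl_swap_left τ) (B.weyl_swap_right τ)
    (B.weyl_swap_left τ) (B.weyl_swap_right τ)]
  simp only [a1, a2, a3, a4, a5, a6, b1, b2, b3, b4, b5, b6, c1, c2, c3, c4, c5, c6, d1, d2, d3, d4,
    d5, d6, e1, e2, e3, e4, e5, e6, f1, f2, f3, f4, f5, f6]
  field_simp
  ring

lemma W2_eq (hB : B.IsRadiationVII0 τ₀) (ht : τ > τ₀) :
    B.W2 τ = -(3 * B.elec τ * B.magn τ + 4 * B.elecMinus τ * B.magnMinus τ +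
      4 * B.elecCross τ * B.magnCross τ) / (6 * B.H τ ^ 4) := by
  have hH := (hB.H_pos τ ht).ne'
  obtain ⟨a1, a2, a3, a4, a5, a6, b1, b2, b3, b4, b5, b6, c1, c2, c3, c4, c5, c6⟩ :=
    weyl_time_eq hB ht
  obtain ⟨d1, d2, d3, d4, d5, d6, e1, e2, e3, e4, e5, e6, f1, f2, f3, f4, f5, f6⟩ :=
    weyl_space_eq hB ht
  have hd := B.weylDual_eq τ
  rw [W2, sum_contract (B.weyl τ) (B.weylDual τ) (B.weyl_swap_left τ) (B.weyl_swap_right τ)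
    (B.weylDual_swap_left τ) (B.weylDual_swap_right τ)]
  simp only [(hd _ _).1, (hd _ _).2.1, (hd _ _).2.2.1, (hd _ _).2.2.2.1, (hd _ _).2.2.2.2.1,
    (hd _ _).2.2.2.2.2, a1, a2, a3, a4, a5, a6, b1, b2, b3, b4, b5, b6, c1, c2, c3, c4, c5, c6, d1,
    d2, d3, d4, d5, d6, e1, e2, e3, e4, e5, e6, f1, f2, f3, f4, f5, f6]
  field_simp
  ring

/-- The normalized component `E₁₁ / H²`. -/
noncomputable def elecN (B : BianchiModel) (τ : ℝ) : ℝ :=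
  -2 * B.iX τ - 2 * B.iX τ ^ 2 - 2 * (B.iR τ - B.iA τ) + (B.iR τ + B.iA τ) -
    4 * B.v τ 0 ^ 2 * (1 - B.iX τ ^ 2 - B.iR τ) / (3 + B.v τ 0 ^ 2)

lemma elec_eq (hB : B.IsRadiationVII0 τ₀) (ht : τ > τ₀) :
    B.elec τ = B.elecN τ * B.H τ ^ 2 := by
  have hH := (hB.H_pos τ ht).ne'
  obtain ⟨s00, -⟩ := stress_eq hB ht
  have h3 : 3 + B.v τ 0 ^ 2 ≠ 0 := by positivity
  rw [elecN, ← Om_eq hB ht, Ω, s00]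
  simp only [elec, iX, iR, iA]
  field_simp
  ring

/-- For large `N₊` the transverse electric part is about `2n₊(n₋, n_×)` and the magnetic part about
`2n₊(σ₋, σ_×)`. The difference of their squares gives `-4N²A`, their inner product `-4N²C` in
`W2_expansion`. -/
lemma W1_expansion (hB : B.IsRadiationVII0 τ₀) (ht : τ > τ₀) :
    B.W1 τ = -4 * B.iN τ ^ 2 * B.iA τ + (2 * B.iN τ * (1 - 5 * B.iX τ) * B.iC τ +
      (B.elecN τ ^ 2 / 4 - 9 / 4 * B.iC τ ^ 2 +
        (1 - 2 * B.iX τ) ^ 2 * (B.iR τ + B.iA τ) / 2 -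
        9 / 2 * B.iX τ ^ 2 * (B.iR τ - B.iA τ))) := by
  have hH := (hB.H_pos τ ht).ne'
  rw [W1_eq hB ht, elec_eq hB ht]
  simp only [elecMinus, elecCross, magn, magnMinus, magnCross, iN, iA, iX, iC, iR]
  field_simp
  ring

lemma W2_expansion (hB : B.IsRadiationVII0 τ₀) (ht : τ > τ₀) :
    B.W2 τ = -4 * B.iN τ ^ 2 * B.iC τ + (B.iN τ * (-6 * B.iX τ * (B.iR τ - B.iA τ) -
      2 * (1 - 2 * B.iX τ) * (B.iR τ + B.iA τ)) +
      (3 / 2 * B.elecN τ * B.iC τ - 3 * B.iX τ * (1 - 2 * B.iX τ) * B.iC τ)) := by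
  have hH := (hB.H_pos τ ht).ne'
  rw [W2_eq hB ht, elec_eq hB ht]
  simp only [elecMinus, elecCross, magn, magnMinus, magnCross, iN, iA, iX, iC, iR]
  field_simp
  ring

lemma abs_elecN_le {x R A v : ℝ} (hx : |x| ≤ 1) (hA : |A| ≤ R) (hR : R ≤ 1)
    (hΩ : 0 ≤ 1 - x ^ 2 - R) :
    |-2 * x - 2 * x ^ 2 - 2 * (R - A) + (R + A) - 4 * v ^ 2 * (1 - x ^ 2 - R) / (3 + v ^ 2)| ≤
      14 := by
  have hA' := abs_le.1 hA
  have hx' := abs_le.1 hx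
  have hx2 : x ^ 2 ≤ 1 := by nlinarith
  have h1 : 0 ≤ 4 * v ^ 2 * (1 - x ^ 2 - R) / (3 + v ^ 2) := by positivity
  have h2 : 4 * v ^ 2 * (1 - x ^ 2 - R) / (3 + v ^ 2) ≤ 4 := by
    rw [div_le_iff₀ (by positivity)]
    nlinarith [sq_nonneg v, sq_nonneg x]
  rw [abs_le]
  constructor <;> nlinarith [sq_nonneg x]

lemma weyl_remainder_le {x R A C N e : ℝ} (hx : |x| ≤ 1) (hA : |A| ≤ R) (hC : |C| ≤ R)
    (hR : R ≤ 1) (he : |e| ≤ 14) :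
    |2 * N * (1 - 5 * x) * C + (e ^ 2 / 4 - 9 / 4 * C ^ 2 + (1 - 2 * x) ^ 2 * (R + A) / 2 -
      9 / 2 * x ^ 2 * (R - A))| ≤ 24 * |N| * R + 70 ∧
    |N * (-6 * x * (R - A) - 2 * (1 - 2 * x) * (R + A)) +
      (3 / 2 * e * C - 3 * x * (1 - 2 * x) * C)| ≤ 24 * |N| * R + 70 := by
  have hA' := abs_le.1 hA
  have hx' := abs_le.1 hx
  have he' := abs_le.1 he
  have hC1 : |C| ≤ 1 := hC.trans hR
  have hC' := abs_le.1 hC1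
  have hR0 : 0 ≤ R := (abs_nonneg _).trans hA
  have hx2 : x ^ 2 ≤ 1 := by nlinarith
  have hC2 : C ^ 2 ≤ 1 := by nlinarith
  have he2 : e ^ 2 ≤ 196 := by nlinarith
  constructor
  · have h1 : |2 * N * (1 - 5 * x) * C| ≤ 2 * |N| * 6 * R := by
      rw [abs_mul, abs_mul, abs_mul, abs_two]
      have : |1 - 5 * x| ≤ 6 := abs_le.2 ⟨by linarith, by linarith⟩
      gcongr
    have h2 : 0 ≤ (1 - 2 * x) ^ 2 * (R + A) := mul_nonneg (sq_nonneg _) (by linarith)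
    have h3 : (1 - 2 * x) ^ 2 * (R + A) ≤ 9 * 2 := by
      have : (1 - 2 * x) ^ 2 ≤ 9 := by nlinarith
      gcongr <;> linarith
    have h4 : 0 ≤ x ^ 2 * (R - A) := mul_nonneg (sq_nonneg _) (by linarith)
    have h5 : x ^ 2 * (R - A) ≤ 1 * 2 := by
      gcongr <;> linarith
    have h6 := abs_le.1 h1
    have h7 : 0 ≤ |N| * R := by positivity
    rw [abs_le]
    constructor <;> nlinarith [sq_nonneg e, sq_nonneg C]
  · have h1 : |-6 * x * (R - A) - 2 * (1 - 2 * x) * (R + A)| ≤ 24 * R := by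
      rw [abs_le]
      constructor <;> nlinarith
    have h2 : |N * (-6 * x * (R - A) - 2 * (1 - 2 * x) * (R + A))| ≤ |N| * (24 * R) := by
      rw [abs_mul]; gcongr
    have h3 : |3 / 2 * e * C| ≤ 3 / 2 * 14 * 1 := by
      rw [abs_mul, abs_mul, abs_of_pos (by norm_num : (0 : ℝ) < 3 / 2)]
      gcongr
    have h4 : |3 * x * (1 - 2 * x) * C| ≤ 3 * 1 * 3 * 1 := by
      rw [abs_mul, abs_mul, abs_mul, abs_of_pos (by norm_num : (0 : ℝ) < 3)]
      have : |1 - 2 * x| ≤ 3 := abs_le.2 ⟨by linarith, by linarith⟩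
      gcongr
    have h5 := abs_le.1 h2
    have h6 := abs_le.1 h3
    have h7 := abs_le.1 h4
    rw [abs_le]
    constructor <;> linarith

end BianchiModel

/-! ### Asymptotics of the Weyl parameters and conclusion. -/

lemma exists_relative_error {W K c M : ℝ → ℝ} {k : ℝ}
    (hK : ∀ᶠ t in atTop, 0 < K t) (h : ∀ᶠ t in atTop, |W t + K t * c t| ≤ k * K t * |M t|) :
    ∃ ε : ℝ → ℝ, ε =O[atTop] M ∧ ∀ᶠ t in atTop, W t = -K t * (c t + ε t) := by
  refine ⟨fun t => -(W t + K t * c t) / K t, IsBigO.of_bound k ?_, ?_⟩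
  · filter_upwards [hK, h] with t h1 h2
    rw [Real.norm_eq_abs, Real.norm_eq_abs, abs_div, abs_neg, abs_of_pos h1, div_le_iff₀ h1]
    linarith
  · filter_upwards [hK] with t h1
    field_simp
    ring

theorem theorem2 (B : BianchiModel) (τ₀ : ℝ) (hB : B.IsRadiationVII0 τ₀)
    (R2 ψ : ℝ → ℝ) (hpolar : ∀ τ > τ₀, B.IsPolar R2 ψ τ)
    (hΩ : ∀ τ > τ₀, 0 < B.Ω τ) (hR1 : ∀ τ > τ₀, 0 < B.R1 τ)
    (hR2 : ∀ τ > τ₀, 0 < R2 τ) (hv : ∀ τ > τ₀, 0 < B.v τ 0) :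
    Tendsto B.Ω atTop (𝓝 1) ∧
    (∀ α, Tendsto (fun τ => B.v τ α) atTop (𝓝 0)) ∧
    Tendsto B.shear atTop (𝓝 0) ∧
    Tendsto B.M atTop (𝓝 0) ∧
    Tendsto (fun τ => R2 τ / B.M τ ^ 2) atTop atTop ∧
    (¬ Tendsto (fun τ => R2 τ / B.R1 τ) atTop (𝓝 0) →
      (∃ ε₁ ε₂ : ℝ → ℝ, ε₁ =O[atTop] B.M ∧ ε₂ =O[atTop] B.M ∧
        ∀ᶠ τ in atTop,
          B.W1 τ = -(4 * R2 τ / B.M τ ^ 2) * (Real.cos (2 * ψ τ) + ε₁ τ) ∧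
          B.W2 τ = -(4 * R2 τ / B.M τ ^ 2) * (Real.sin (2 * ψ τ) + ε₂ τ)) ∧
      Tendsto (fun τ => √(B.W1 τ ^ 2 + B.W2 τ ^ 2)) atTop atTop) := by
  obtain ⟨ε, hε, hN⟩ := BianchiModel.exists_sign hB
  have hε2 : ε ^ 2 = 1 := by rcases hε with rfl | rfl <;> norm_num
  set F := BianchiModel.flow hB hΩ hv ε hε hN with hF
  have hgt := eventually_gt_atTop τ₀
  have hx : Tendsto B.iX atTop (𝓝 0) := F.tendsto_x
  have hR : Tendsto B.iR atTop (𝓝 0) := F.tendsto_R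
  have hA : Tendsto B.iA atTop (𝓝 0) := F.tendsto_A
  have hFN : ∀ τ, F.N τ = ε * B.iN τ := fun _ => rfl
  have hamp : ∀ τ > τ₀, √(F.A τ ^ 2 + F.C τ ^ 2) = R2 τ := fun τ ht => by
    rw [BianchiModel.polar_radius_eq hB ht (hpolar τ ht) (hR2 τ ht)]
    change √(B.iA τ ^ 2 + (ε * B.iC τ) ^ 2) = _
    rw [mul_pow, hε2, one_mul]
  have hM : ∀ τ, B.M τ = 1 / B.iN τ := fun τ => by rw [BianchiModel.M, BianchiModel.Np_eq]
  have hMF : ∀ τ > τ₀, B.M τ = ε * (1 / F.N τ) := fun τ ht => by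
    have := BianchiModel.iN_ne_zero hB ht
    rw [hM, hFN]
    rcases hε with rfl | rfl <;> field_simp
  have habsM : ∀ τ > τ₀, |B.M τ| = 1 / F.N τ := fun τ ht => by
    rw [hMF τ ht, abs_mul, abs_of_pos (F.inv_N_pos ht)]
    rcases hε with rfl | rfl <;> simp
  have hdivM : ∀ τ > τ₀, R2 τ / B.M τ ^ 2 = R2 τ * F.N τ ^ 2 := fun τ ht => by
    have := (F.N_pos τ ht).ne'
    rw [← sq_abs, habsM τ ht]
    field_simp
  have hMlim : Tendsto B.M atTop (𝓝 0) := by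
    have := F.tendsto_inv_N.const_mul ε
    rw [mul_zero] at this
    refine this.congr' ?_
    filter_upwards [hgt] with τ ht using (hMF τ ht).symm
  have hRM : Tendsto (fun τ => R2 τ / B.M τ ^ 2) atTop atTop := by
    refine F.tendsto_amplitude_mul_N_sq.congr' ?_
    filter_upwards [hgt] with τ ht
    rw [hdivM τ ht, hamp τ ht]
  refine ⟨?_, ?_, ?_, hMlim, hRM, fun hnot => ?_⟩
  · have := (hx.pow 2).const_sub 1 |>.sub hR
    simp only [ne_eq, OfNat.ofNat_ne_zero, not_false_eq_true, zero_pow, sub_zero] at this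
    refine this.congr' ?_
    filter_upwards [hgt] with τ ht using (BianchiModel.Om_eq hB ht).symm
  · intro α
    fin_cases α
    · exact F.tendsto_v
    · refine tendsto_const_nhds.congr' ?_
      filter_upwards [hgt] with τ ht using (BianchiModel.tilt_eq_zero hB ht).1.symm
    · refine tendsto_const_nhds.congr' ?_
      filter_upwards [hgt] with τ ht using (BianchiModel.tilt_eq_zero hB ht).2.symm
  · have := ((hx.pow 2).add ((hR.add hA).div_const 2)).sqrt
    simp only [ne_eq, OfNat.ofNat_ne_zero, not_false_eq_true, zero_pow, add_zero, zero_div,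
      Real.sqrt_zero] at this
    refine this.congr' ?_
    filter_upwards [hgt] with τ ht using (BianchiModel.shear_sq hB ht).symm
  obtain ⟨δ, hδ, hamp_ge⟩ := F.amplitude_ge_of_not_tendsto (fun h => hnot (h.congr' (by
    filter_upwards [hgt] with τ ht
    rw [hamp τ ht, BianchiModel.R1_eq hB ht]
    rfl)))
  have hKpos : ∀ᶠ τ in atTop, 0 < 4 * R2 τ / B.M τ ^ 2 := by
    filter_upwards [hgt] with τ ht
    have h1 := hdivM τ ht
    have h2 := hR2 τ ht
    have h3 := F.N_pos τ ht
    rw [mul_div_assoc, h1]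
    positivity
  have hrem : ∀ᶠ τ in atTop,
      |B.W1 τ + 4 * R2 τ / B.M τ ^ 2 * Real.cos (2 * ψ τ)| ≤
        24 / δ * (4 * R2 τ / B.M τ ^ 2) * |B.M τ| ∧
      |B.W2 τ + 4 * R2 τ / B.M τ ^ 2 * Real.sin (2 * ψ τ)| ≤
        24 / δ * (4 * R2 τ / B.M τ ^ 2) * |B.M τ| := by
    -- `XN ≥ 1` gives `NR ≥ 2`, so the bounded part `70` of the remainder is at most `35NR`. Then `R
    -- ≤ 𝓡₂/δ` turns the total into a multiple of `𝓡₂N² · |M|`.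
    filter_upwards [hgt, hamp_ge, F.tendsto_X_mul_N.eventually_ge_atTop 1] with τ ht h1 h2
    rw [hamp τ ht] at h1
    have hNpos := F.N_pos τ ht
    have hNsq : F.N τ ^ 2 = B.iN τ ^ 2 := by rw [hFN, mul_pow, hε2, one_mul]
    have hNabs : |B.iN τ| = F.N τ := by
      rw [← abs_of_pos hNpos, hFN, abs_mul]
      rcases hε with rfl | rfl <;> simp
    have hC : |B.iC τ| ≤ B.iR τ := by
      have : |ε * B.iC τ| ≤ B.iR τ := F.abs_C_le ht
      rw [abs_mul] at this
      rcases hε with rfl | rfl <;> simpa using this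
    have he : |B.elecN τ| ≤ 14 :=
      BianchiModel.abs_elecN_le (F.abs_x_le ht) (F.abs_A_le ht) (F.R_lt_one ht).le
        (F.Om_pos τ ht).le
    obtain ⟨r1, r2⟩ := BianchiModel.weyl_remainder_le (x := B.iX τ) (R := B.iR τ) (A := B.iA τ)
      (N := B.iN τ) (F.abs_x_le ht) (F.abs_A_le ht) hC (F.R_lt_one ht).le he
    have h3 : 1 ≤ F.N τ * F.R τ / 2 := by
      have := F.two_mul_X_le ht
      nlinarith
    have hbound : 24 * |B.iN τ| * F.R τ + 70 ≤ 24 / δ * (4 * R2 τ / B.M τ ^ 2) * |B.M τ| := by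
      rw [hNabs, mul_div_assoc 4, hdivM τ ht, habsM τ ht]
      have h4 : 24 / δ * (4 * (R2 τ * F.N τ ^ 2)) * (1 / F.N τ) = 96 * (F.N τ * (R2 τ / δ)) := by
        field_simp
        ring
      have h5 : F.R τ ≤ R2 τ / δ := by
        rw [le_div_iff₀ hδ]
        linarith
      have h6 : F.N τ * F.R τ ≤ F.N τ * (R2 τ / δ) := by gcongr
      rw [h4]
      linarith
    have e1 : B.W1 τ + 4 * R2 τ / B.M τ ^ 2 * Real.cos (2 * ψ τ) =
        B.W1 τ + 4 * B.iN τ ^ 2 * B.iA τ := by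
      rw [mul_div_assoc, hdivM τ ht, hNsq, ← BianchiModel.polar_cos_eq hB ht (hpolar τ ht)]
      ring
    have e2 : B.W2 τ + 4 * R2 τ / B.M τ ^ 2 * Real.sin (2 * ψ τ) =
        B.W2 τ + 4 * B.iN τ ^ 2 * B.iC τ := by
      rw [mul_div_assoc, hdivM τ ht, hNsq, ← BianchiModel.polar_sin_eq hB ht (hpolar τ ht)]
      ring
    rw [e1, e2, BianchiModel.W1_expansion hB ht, BianchiModel.W2_expansion hB ht]
    refine ⟨le_trans (le_of_eq ?_) (r1.trans hbound), le_trans (le_of_eq ?_) (r2.trans hbound)⟩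
    · congr 1; ring
    · congr 1; ring
  obtain ⟨ε₁, hε₁, hW1⟩ := exists_relative_error hKpos (hrem.mono fun _ h => h.1)
  obtain ⟨ε₂, hε₂, hW2⟩ := exists_relative_error hKpos (hrem.mono fun _ h => h.2)
  refine ⟨⟨ε₁, ε₂, hε₁, hε₂, hW1.and hW2⟩, ?_⟩
  have l1 : Tendsto (fun τ => |ε₁ τ|) atTop (𝓝 0) := by
    simpa using (hε₁.trans_tendsto hMlim).abs
  have l2 : Tendsto (fun τ => |ε₂ τ|) atTop (𝓝 0) := by
    simpa using (hε₂.trans_tendsto hMlim).abs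
  refine tendsto_atTop_mono' _ ?_ (hRM.const_mul_atTop (by norm_num : (0 : ℝ) < 2))
  filter_upwards [hW1, hW2, hKpos, l1.eventually_le_const (by norm_num : (0 : ℝ) < 1 / 8),
    l2.eventually_le_const (by norm_num : (0 : ℝ) < 1 / 8)] with τ h1 h2 h3 h4 h5
  have h6 := abs_le.1 h4
  have h7 := abs_le.1 h5
  rw [mul_div_assoc] at h1 h2 h3
  set K := R2 τ / B.M τ ^ 2
  have hK : 0 ≤ K := by linarith
  apply Real.le_sqrt_of_sq_le
  have hc := Real.cos_sq_add_sin_sq (2 * ψ τ)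
  have t1 : |Real.cos (2 * ψ τ) * ε₁ τ| ≤ 1 * (1 / 8) := by
    rw [abs_mul]
    have := Real.abs_cos_le_one (2 * ψ τ)
    gcongr
  have t2 : |Real.sin (2 * ψ τ) * ε₂ τ| ≤ 1 * (1 / 8) := by
    rw [abs_mul]
    have := Real.abs_sin_le_one (2 * ψ τ)
    gcongr
  have t1' := (abs_le.1 t1).1
  have t2' := (abs_le.1 t2).1
  -- A unit vector perturbed by at most `1/8` in each component keeps length at least `1/2`, so the
  -- norm is at least `2𝓡₂/M²`.
  have t3 : 1 / 4 ≤ (Real.cos (2 * ψ τ) + ε₁ τ) ^ 2 + (Real.sin (2 * ψ τ) + ε₂ τ) ^ 2 := by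
    nlinarith [sq_nonneg (ε₁ τ), sq_nonneg (ε₂ τ)]
  rw [h1, h2]
  calc (2 * K) ^ 2 = (4 * K) ^ 2 * (1 / 4) := by ring
    _ ≤ (4 * K) ^ 2 * ((Real.cos (2 * ψ τ) + ε₁ τ) ^ 2 + (Real.sin (2 * ψ τ) + ε₂ τ) ^ 2) := by
      gcongr
    _ = _ := by ring
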